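/- Let $X,S,Y$ be random vectors with values in $\mathbb R^{n_x},\mathbb R^{n_s},\mathbb R^{n_y}$ such that $(X,S,Y)$ is jointly Gaussian with mean zero and $Q_Y=\mathbf E[YY^T]$ is invertible. Write $Q_{U,V}=\mathbf E[UV^T]$ for centered vectors, $Q_{U,V|Z}=\mathbf E[(U-\mathbf E(U|Z))(V-\mathbf E(V|Z))^T]$ and $Q_{U|Z}=Q_{U,U|Z}$. For $\Delta_X\ge 0$ let $\mathcal M_A(\Delta_X)$ be the set of random vectors $\widehat X$ in $\mathbb R^{n_x}$, defined jointly with $(X,S,Y)$ (on a probability space that may be enlarged), such that $\mathbf P_{\widehat X|S,Y,X}=\mathbf P_{\widehat X|S,Y}$ and $\mathbf E\|X-\widehat X\|^2\le\Delta_X$, and let $$R_{S;\widehat X|Y}(\Delta_X)=\inf_{\widehat X\in\mathcal M_A(\Delta_X)} I(S;\widehat X|Y)\in[0,\infty],\qquad \inf\emptyset=\infty.$$ Call $(\Sigma_\Delta,H,Q_W)$, with $\Sigma_\Delta,Q_W\in\mathbb R^{n_x\times n_x}$ and $H\in\mathbb R^{n_x\times n_s}$, feasible if $\Sigma_\Delta\succeq0$,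 $Q_W\succeq0$, $$HQ_{X,S|Y}^T=Q_{X|Y}-\Sigma_\Delta,\qquad HQ_{X,S|Y}^T=Q_{X,S|Y}H^T\succeq0,\qquad Q_W=HQ_{X,S|Y}^T-HQ_{S|Y}H^T=Q_{X|Y}-\Sigma_\Delta-HQ_{S|Y}H^T.$$ Here $Q_{X|Y}\succeq 0$, $Q_{S|Y}\succeq0$ and $Q_{X,S|Y}=Q_{X,S}-Q_{X,Y}Q_Y^{-1}Q_{Y,S}$. For $0\preceq B\preceq A$, the quantity $\frac12\log(\det A/\det B)$ is $+\infty$ if $\det A\ne0=\det B$, and if $\det A=0$ it is understood as $\lim_{\varepsilon\downarrow0}\frac12\log\big(\det(A+\varepsilon I)/\det(B+\varepsilon I)\big)\in[0,\infty]$. The symbol $\dagger$ denotes the Moore–Penrose pseudoinverse. Then the following hold. (a) Let $(\Sigma_\Delta,H,Q_W)$ be feasible, let $W\in G(0,Q_W)$ (centered Gaussian with covariance $Q_W$) be independent of $(X,S,Y)$, and put $$\widehat X=HS+(Q_{X,Y}-HQ_{S,Y})Q_Y^{-1}Y+W .$$ Then almost surely $\widehat X=HS+\mathbf E(X|Y)-H\,\mathbf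 E(S|Y)+W$; $\mathbf E[(X-\widehat X)(X-\widehat X)^T]=\Sigma_\Delta$; (i) $\mathbf P_{X|\widehat X,Y}=\mathbf P_{X|\widehat X}$; (ii) $\mathbf P_{\widehat X|S,Y,X}=\mathbf P_{\widehat X|S,Y}$ and $\mathbf P_{X|S,Y,\widehat X}=\mathbf P_{X|S,Y}$; (iii) $\mathbf E(X|\widehat X,Y)=\mathbf E(X|\widehat X)=\widehat X$ a.s., and $\mathbf E(X|Y)=\mathbf E(\widehat X|Y)$ a.s. Moreover $$Q_{\widehat X|Y}=HQ_{S|Y}H^T+Q_W=Q_{X|Y}-\Sigma_\Delta,\qquad Q_{S|\widehat X,Y}=Q_{S|Y}-Q_{S|Y}H^TQ_{\widehat X|Y}^\dagger HQ_{S|Y},$$ $\widehat X\in\mathcal M_A(\Delta_X)$ whenever $\operatorname{trace}(\Sigma_\Delta)\le\Delta_X$, and $$I(S;\widehat X|Y)=\tfrac12\log\frac{\det Q_{S|Y}}{\det Q_{S|\widehat X,Y}}=\tfrac12\log\frac{\det Q_{\widehat X|Y}}{\det Q_W}.$$ (b) With $Q_{\widehat X|Y}$ and $Q_{S|\widehat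 X,Y}$ given in terms of $(\Sigma_\Delta,H)$ by the formulas in (a), $$R_{S;\widehat X|Y}(\Delta_X)=\inf\ \tfrac12\log\frac{\det Q_{S|Y}}{\det Q_{S|\widehat X,Y}}=\inf\ \tfrac12\log\frac{\det Q_{\widehat X|Y}}{\det Q_W},$$ where both infima are over the feasible $(\Sigma_\Delta,H,Q_W)$ with $\operatorname{trace}(\Sigma_\Delta)\le\Delta_X$, subject to $Q_{S|Y}\succeq Q_{S|\widehat X,Y}\succeq0$ in the first and $Q_{\widehat X|Y}\succeq Q_W\succeq0$ in the second. Every $\widehat X\in\mathcal M_A(\Delta_X)$ has $I(S;\widehat X|Y)\ge R_{S;\widehat X|Y}(\Delta_X)$, and if $\mathcal M_A(\Delta_X)\neq\emptyset$ then $R_{S;\widehat X|Y}(\Delta_X)$ and both infima are attained by a realization as in (a). -/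

import Mathlib

open MeasureTheory ProbabilityTheory InformationTheory
open scoped ENNReal NNReal Matrix

noncomputable section

namespace RemoteRDF

/-- `ℝⁿ` with the Euclidean norm. -/
abbrev Vec (n : ℕ) : Type := EuclideanSpace ℝ (Fin n)

/-! ### Linear algebra -/

/-- The four Penrose equations: `B` is the Moore–Penrose pseudoinverse of `A`. -/
structure IsPseudoinverse {m n : ℕ} (A : Matrix (Fin m) (Fin n) ℝ)
    (B : Matrix (Fin n) (Fin m) ℝ) : Prop where
  mul_mul_left : A * B * A = A
  mul_mul_right : B * A * B = B
  symm_left : (A * B)ᵀ = A * B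
  symm_right : (B * A)ᵀ = B * A

/-- The Moore–Penrose pseudoinverse `A†` (see `isPseudoinverse_pinv` and
`IsPseudoinverse.unique`). -/
def pinv {n : ℕ} (A : Matrix (Fin n) (Fin n) ℝ) : Matrix (Fin n) (Fin n) ℝ :=
  Classical.epsilon (IsPseudoinverse A)

theorem IsPseudoinverse.unique {m n : ℕ} {A : Matrix (Fin m) (Fin n) ℝ}
    {B C : Matrix (Fin n) (Fin m) ℝ} (hB : IsPseudoinverse A B) (hC : IsPseudoinverse A C) :
    B = C := by
  have h1 : A * B = A * C := by
    calc A * B = (A * B)ᵀ := hB.symm_left.symm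
      _ = ((A * C) * (A * B))ᵀ := by
          rw [← Matrix.mul_assoc, hC.mul_mul_left]
      _ = (A * B) * (A * C) := by
          rw [Matrix.transpose_mul, hB.symm_left, hC.symm_left]
      _ = A * C := by rw [← Matrix.mul_assoc, hB.mul_mul_left]
  have h2 : B * A = C * A := by
    calc B * A = (B * A)ᵀ := hB.symm_right.symm
      _ = ((B * A) * (C * A))ᵀ := by
          rw [Matrix.mul_assoc, ← Matrix.mul_assoc A, hC.mul_mul_left]
      _ = (C * A) * (B * A) := by
          rw [Matrix.transpose_mul, hB.symm_right, hC.symm_right]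
      _ = C * A := by rw [Matrix.mul_assoc, ← Matrix.mul_assoc A, hB.mul_mul_left]
  calc B = B * A * B := hB.mul_mul_right.symm
    _ = C * A * C := by rw [h2, Matrix.mul_assoc, h1, ← Matrix.mul_assoc]
    _ = C := hC.mul_mul_right

theorem isPseudoinverse_pinv {n : ℕ} {A : Matrix (Fin n) (Fin n) ℝ} (hA : A.IsHermitian) :
    IsPseudoinverse A (pinv A) := by
  refine Classical.epsilon_spec (p := IsPseudoinverse A) ?_
  obtain ⟨U, d, hU, hd⟩ : ∃ (U : Matrix (Fin n) (Fin n) ℝ) (d : Fin n → ℝ),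
      Uᵀ * U = 1 ∧ A = U * Matrix.diagonal d * Uᵀ := by
    refine ⟨hA.eigenvectorUnitary, hA.eigenvalues, ?_, ?_⟩
    · have := Unitary.coe_star_mul_self hA.eigenvectorUnitary
      simpa [Matrix.star_eq_conjTranspose] using this
    · have := hA.spectral_theorem
      rw [Unitary.conjStarAlgAut_apply] at this
      simpa [Matrix.star_eq_conjTranspose, Function.comp_def] using this
  have key : ∀ a b : Fin n → ℝ, U * Matrix.diagonal a * Uᵀ * (U * Matrix.diagonal b * Uᵀ)
      = U * Matrix.diagonal (fun i => a i * b i) * Uᵀ := by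
    intro a b
    calc _ = U * Matrix.diagonal a * (Uᵀ * U) * Matrix.diagonal b * Uᵀ := by
          simp only [Matrix.mul_assoc]
      _ = _ := by rw [hU, Matrix.mul_one, Matrix.mul_assoc U, Matrix.diagonal_mul_diagonal]
  refine ⟨U * Matrix.diagonal (fun i => (d i)⁻¹) * Uᵀ, ?_, ?_, ?_, ?_⟩
  · rw [hd, key, key]; congr 3; funext i; exact mul_inv_mul_cancel _
  · rw [hd, key, key]; congr 3; funext i; simpa using mul_inv_mul_cancel (d i)⁻¹
  · rw [hd, key]; simp [Matrix.mul_assoc]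
  · rw [hd, key]; simp [Matrix.mul_assoc]

/-- `½ log (det A / det B) ∈ [0, ∞]` for positive semidefinite `B ⪯ A`.
If `det A ≠ 0` this is the literal expression (`∞` if `det B = 0`). If `det A = 0`, where the
quotient would read `0 / 0`, it is the limit of `½ log (det (A + ε I) / det (B + ε I))` as
`ε ↓ 0`. For `B ⪯ A` this expression is antitone in `ε`, so the limit is a supremum; it is the
corresponding quotient of the determinants of `A` and `B` restricted to the range of `A`. -/
def halfLogDetRatio {n : ℕ} (A B : Matrix (Fin n) (Fin n) ℝ) : ℝ≥0∞ :=
  if A.det ≠ 0 then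
    if B.det = 0 then ∞ else ENNReal.ofReal (1 / 2 * Real.log (A.det / B.det))
  else
    ⨆ (ε : ℝ) (_ : 0 < ε), ENNReal.ofReal
      (1 / 2 * Real.log ((A + ε • (1 : Matrix (Fin n) (Fin n) ℝ)).det /
        (B + ε • (1 : Matrix (Fin n) (Fin n) ℝ)).det))

/-! ### Random vectors -/

section Probability

variable {Ω : Type*} [MeasurableSpace Ω]

/-- The matrix `Q_{U,V} = E[U Vᵀ]` (the covariance, for centered random vectors). -/
def covMat {m n : ℕ} (μ : Measure Ω) (U : Ω → Vec m) (V : Ω → Vec n) :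
    Matrix (Fin m) (Fin n) ℝ :=
  Matrix.of fun i j => ∫ ω, U ω i * V ω j ∂μ

/-- The conditional expectation `E(U | Z)` given a random variable `Z`. -/
def cexp {n : ℕ} {β : Type*} [MeasurableSpace β] (μ : Measure Ω) (U : Ω → Vec n) (Z : Ω → β) :
    Ω → Vec n :=
  condExp (MeasurableSpace.comap Z inferInstance) μ U

/-- The (nonrandom) conditional covariance
`Q_{U,V|Z} = E[(U - E(U|Z)) (V - E(V|Z))ᵀ]` of jointly Gaussian vectors. -/
def condCov {m n : ℕ} {β : Type*} [MeasurableSpace β] (μ : Measure Ω) (U : Ω → Vec m)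
    (V : Ω → Vec n) (Z : Ω → β) : Matrix (Fin m) (Fin n) ℝ :=
  covMat μ (fun ω => U ω - cexp μ U Z ω) (fun ω => V ω - cexp μ V Z ω)

/-- `P_{U|V,T} = P_{U|V}` almost surely. -/
def CondLawDrops {α β γ : Type*} [MeasurableSpace α] [StandardBorelSpace α] [Nonempty α]
    [MeasurableSpace β] [MeasurableSpace γ] (μ : Measure Ω) [IsFiniteMeasure μ]
    (U : Ω → α) (V : Ω → β) (T : Ω → γ) : Prop :=
  ∀ᵐ p ∂(μ.map fun ω => (V ω, T ω)),
    condDistrib U (fun ω => (V ω, T ω)) μ p = condDistrib U V μ p.1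

/-- The conditional mutual information `I(A;B|C)`: the divergence of `P_{C,A,B}` from
`P_C ⊗ (P_{A|C} × P_{B|C})`, in nats. -/
def condMutualInfo {α β γ : Type*} [MeasurableSpace α] [StandardBorelSpace α] [Nonempty α]
    [MeasurableSpace β] [StandardBorelSpace β] [Nonempty β] [MeasurableSpace γ]
    (μ : Measure Ω) [IsFiniteMeasure μ] (A : Ω → α) (B : Ω → β) (C : Ω → γ) : ℝ≥0∞ :=
  klDiv (μ.map fun ω => (C ω, (A ω, B ω)))
    ((μ.map C) ⊗ₘ ((condDistrib A C μ) ×ₖ (condDistrib B C μ)))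

/-- `U ∈ G(0, Q)`: a centered Gaussian vector (possibly degenerate) with covariance `Q`. -/
structure IsCenteredGaussian {n : ℕ} (μ : Measure Ω) (U : Ω → Vec n)
    (Q : Matrix (Fin n) (Fin n) ℝ) : Prop where
  measurable : Measurable U
  gaussian : HasGaussianLaw U μ
  mean : ∫ ω, U ω ∂μ = 0
  cov : covMat μ U U = Q

/-- Membership of `Xhat` in the set `M_A(Δ)` of admissible reproductions:
`P_{Xhat|S,Y,X} = P_{Xhat|S,Y}` and `E ‖X - Xhat‖² ≤ Δ`. -/
structure IsAdmissible {nx ns ny : ℕ} (μ : Measure Ω) [IsFiniteMeasure μ] (X : Ω → Vec nx)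
    (S : Ω → Vec ns) (Y : Ω → Vec ny) (Xhat : Ω → Vec nx) (Δ : ℝ≥0) : Prop where
  measurable : Measurable Xhat
  markov : CondLawDrops μ Xhat (fun ω => (S ω, Y ω)) X
  distortion : ∫⁻ ω, ‖X ω - Xhat ω‖ₑ ^ 2 ∂μ ≤ Δ

/-- The affine realization `Xhat = H S + (Q_{X,Y} - H Q_{S,Y}) Q_Y⁻¹ Y + W`. -/
def realization {nx ns ny : ℕ} (μ : Measure Ω) (X : Ω → Vec nx) (S : Ω → Vec ns)
    (Y : Ω → Vec ny) (H : Matrix (Fin nx) (Fin ns) ℝ) (W : Ω → Vec nx) : Ω → Vec nx :=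
  fun ω => Matrix.toEuclideanLin H (S ω)
    + Matrix.toEuclideanLin ((covMat μ X Y - H * covMat μ S Y) * (covMat μ Y Y)⁻¹) (Y ω) + W ω

end Probability

/-- The joint laws of quadruples `((X, S, Y), Xhat)` with `(X, S, Y)` distributed as `P` and
`Xhat ∈ M_A(Δ)`. Working with laws means that the underlying probability space may be as rich as
necessary. -/
def admissibleLaws {nx ns ny : ℕ} (P : Measure (Vec nx × Vec ns × Vec ny)) (Δ : ℝ≥0) :
    Set (ProbabilityMeasure ((Vec nx × Vec ns × Vec ny) × Vec nx)) :=
  {ν | (ν : Measure ((Vec nx × Vec ns × Vec ny) × Vec nx)).map Prod.fst = P ∧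
    IsAdmissible (ν : Measure ((Vec nx × Vec ns × Vec ny) × Vec nx))
      (fun q => q.1.1) (fun q => q.1.2.1) (fun q => q.1.2.2) (fun q => q.2) Δ}

/-- The rate distortion function `R_{S;Xhat|Y}(Δ) = inf_{M_A(Δ)} I(S;Xhat|Y)`, with values in
`[0, ∞]` (`∞` if `M_A(Δ)` is empty). -/
def rdf {nx ns ny : ℕ} (P : Measure (Vec nx × Vec ns × Vec ny)) (Δ : ℝ≥0) : ℝ≥0∞ :=
  ⨅ ν ∈ admissibleLaws P Δ,
    condMutualInfo (ν : Measure ((Vec nx × Vec ns × Vec ny) × Vec nx))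
      (fun q => q.1.2.1) (fun q => q.2) (fun q => q.1.2.2)

/-! ### The parameters of the test channel -/

/-- The constraints on `(Σ, H, Q_W)`, where `QX = Q_{X|Y}`, `QXS = Q_{X,S|Y}`, `QS = Q_{S|Y}`. -/
structure IsFeasible {nx ns : ℕ} (QX : Matrix (Fin nx) (Fin nx) ℝ)
    (QXS : Matrix (Fin nx) (Fin ns) ℝ) (QS : Matrix (Fin ns) (Fin ns) ℝ)
    (Sig : Matrix (Fin nx) (Fin nx) ℝ) (H : Matrix (Fin nx) (Fin ns) ℝ)
    (QW : Matrix (Fin nx) (Fin nx) ℝ) : Prop where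
  sig_psd : Sig.PosSemidef
  gain : H * QXSᵀ = QX - Sig
  gain_symm : H * QXSᵀ = QXS * Hᵀ
  gain_psd : (H * QXSᵀ).PosSemidef
  noise : QW = H * QXSᵀ - H * QS * Hᵀ
  noise_psd : QW.PosSemidef

/-- The matrix `Q_{S|Y} - Q_{S|Y} Hᵀ (Q_{X|Y} - Σ)† H Q_{S|Y}`, the value of `Q_{S|Xhat,Y}`. -/
def postCovS {nx ns : ℕ} (QX : Matrix (Fin nx) (Fin nx) ℝ) (QS : Matrix (Fin ns) (Fin ns) ℝ)
    (Sig : Matrix (Fin nx) (Fin nx) ℝ) (H : Matrix (Fin nx) (Fin ns) ℝ) :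
    Matrix (Fin ns) (Fin ns) ℝ :=
  QS - QS * Hᵀ * pinv (QX - Sig) * H * QS

end RemoteRDF

end

open RemoteRDF

/-!
Write `X` and `S` as their regressions on `Y` plus residuals, and put `V = S - E(S|Y)`. Relative to
`Y`, the realization is the Gaussian channel `HV + W`, and the gain equation makes its covariance
with `X - E(X|Y)` equal to its own covariance `Q_{X|Y} - Σ`. Hence the reproduction is the
conditional mean of `X`, and for Gaussian vectors every Markov and independence claim becomes a
vanishing covariance.

Conversely, let `Xhat` be admissible, let `Z` be its residual given `Y`, and let `AZ` be the best
linear estimate of `X - E(X|Y)` from `Z`. The Markov condition makes `AZ` uncorrelated with the part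
of `X` left unexplained by `S` and `Y`, so the second moments of `AZ` and `V` determine feasible
parameters of no larger distortion. Their rate is no larger either: a conditional mutual information
is bounded below by the expectation of any log-likelihood ratio, and a Gaussian one has as its
expectation half the log of the ratio of determinants. The infimum is attained because the feasible
gains which vanish on the kernel of `Q_{S|Y}` form a compact set, on which the log ratio of
determinants, a supremum of continuous regularizations, is lower semicontinuous.
-/

open MeasureTheory ProbabilityTheory InformationTheory
open scoped ENNReal NNReal Matrix

noncomputable section

namespace RemoteRDF

open Matrix Filter Topology

/-! ### Positive semidefinite matrices -/

section PosSemidef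

variable {m n : Type*}

theorem posSemidef_mul_mul_transpose [Finite m] [Fintype n] {A : Matrix n n ℝ}
    (hA : A.PosSemidef) (E : Matrix m n ℝ) : (E * A * Eᵀ).PosSemidef := by
  simpa using hA.mul_mul_conjTranspose_same E

theorem transpose_eq_of_posSemidef {A : Matrix n n ℝ} (hA : A.PosSemidef) : Aᵀ = A := by
  simpa using hA.isHermitian.eq

theorem posDef_add_smul_one [DecidableEq n] {M : Matrix n n ℝ} (hM : M.PosSemidef) {ε : ℝ}
    (hε : 0 < ε) : (M + ε • (1 : Matrix n n ℝ)).PosDef :=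
  PosDef.posSemidef_add hM (PosDef.one.smul hε)

variable [Fintype n]

theorem exists_orthogonal_diagonalization [DecidableEq n] {A : Matrix n n ℝ} (hA : A.PosSemidef) :
    ∃ (U : Matrix n n ℝ) (d : n → ℝ),
      Uᵀ * U = 1 ∧ U * Uᵀ = 1 ∧ A = U * diagonal d * Uᵀ ∧ ∀ i, 0 ≤ d i := by
  refine ⟨hA.1.eigenvectorUnitary, hA.1.eigenvalues, ?_, ?_, ?_, hA.eigenvalues_nonneg⟩
  · simpa [star_eq_conjTranspose] using Unitary.coe_star_mul_self hA.1.eigenvectorUnitary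
  · simpa [star_eq_conjTranspose] using Unitary.coe_mul_star_self hA.1.eigenvectorUnitary
  · simpa [Unitary.conjStarAlgAut_apply, star_eq_conjTranspose, Function.comp_def]
      using hA.1.spectral_theorem

theorem mul_eq_zero_of_mul_mul_transpose_eq_zero {D : Matrix n n ℝ} (hD : D.PosSemidef)
    {E : Matrix m n ℝ} (h : E * D * Eᵀ = 0) : E * D = 0 := by
  classical
  obtain ⟨U, d, -, -, rfl, hd⟩ := exists_orthogonal_diagonalization hD
  have hsqrt : diagonal d = diagonal (fun i => √(d i)) * diagonal (fun i => √(d i)) := by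
    simp only [diagonal_mul_diagonal, Real.mul_self_sqrt (hd _)]
  set F := E * U * diagonal (fun i => √(d i)) with hF
  have hFF : F * Fᴴ = 0 := by
    rw [← h, hsqrt, hF]
    simp only [conjTranspose_eq_transpose_of_trivial, transpose_mul, diagonal_transpose,
      Matrix.mul_assoc]
  calc E * (U * diagonal d * Uᵀ) = F * (diagonal (fun i => √(d i)) * Uᵀ) := by
        rw [hsqrt, hF]; simp only [Matrix.mul_assoc]
    _ = 0 := by rw [self_mul_conjTranspose_eq_zero.mp hFF, Matrix.zero_mul]

theorem mul_eq_zero_of_mul_eq_zero_of_le [Finite m] {A D : Matrix n n ℝ} (hD : D.PosSemidef)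
    (hAD : (A - D).PosSemidef) {E : Matrix m n ℝ} (h : E * A = 0) : E * D = 0 := by
  cases nonempty_fintype m
  have hD' := posSemidef_mul_mul_transpose hD E
  have hAD' := posSemidef_mul_mul_transpose hAD E
  rw [Matrix.mul_sub, h, zero_sub, Matrix.neg_mul] at hAD'
  refine mul_eq_zero_of_mul_mul_transpose_eq_zero hD
    (hD'.trace_eq_zero_iff.mp (le_antisymm ?_ hD'.trace_nonneg))
  simpa using hAD'.trace_nonneg

theorem exists_full_rank_factorization {A : Matrix n n ℝ} (hA : A.PosSemidef) :
    ∃ (k : ℕ) (T : Matrix n (Fin k) ℝ) (R : Matrix (Fin k) n ℝ), R * T = 1 ∧ A = T * Tᵀ := by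
  classical
  obtain ⟨U, a, hU, -, hUa, ha⟩ := exists_orthogonal_diagonalization hA
  let e : Fin (Fintype.card {i // a i ≠ 0}) ≃ {i // a i ≠ 0} := (Fintype.equivFin _).symm
  refine ⟨_, of fun i j => U i (e j) * √(a (e j)), of fun j i => (√(a (e j)))⁻¹ * U i (e j), ?_, ?_⟩
  · ext i j
    have hs : √(a (e i)) ≠ 0 := (Real.sqrt_pos.mpr ((ha _).lt_of_ne (e i).2.symm)).ne'
    calc _ = (√(a (e i)))⁻¹ * √(a (e j)) * (Uᵀ * U) (e i) (e j) := by
          simp only [mul_apply, of_apply, transpose_apply, Finset.mul_sum]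
          exact Finset.sum_congr rfl fun x _ => by ring
      _ = (1 : Matrix _ _ ℝ) i j := by
          rw [hU]
          obtain rfl | hij := eq_or_ne i j
          · simp [hs]
          · rw [one_apply_ne hij, one_apply_ne fun h => hij (e.injective (Subtype.ext h)), mul_zero]
  · ext i j
    calc A i j = ∑ x, U i x * a x * U j x := by
          rw [hUa, mul_apply]; simp only [mul_diagonal, transpose_apply]
      _ = ∑ x : {x // a x ≠ 0}, U i x * a x * U j x := by
          rw [← Finset.sum_subtype (Finset.univ.filter fun x => a x ≠ 0) (by simp)
            (fun x => U i x * a x * U j x), Finset.sum_filter]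
          exact Finset.sum_congr rfl fun x _ => by by_cases hx : a x = 0 <;> simp [hx]
      _ = _ := by
          rw [mul_apply, ← Equiv.sum_comp e]
          refine Finset.sum_congr rfl fun x _ => ?_
          simp only [of_apply, transpose_apply]
          linear_combination -U i (e x) * U j (e x) * Real.mul_self_sqrt (ha (e x))

end PosSemidef

/-- A simultaneous diagonalization of `0 ⪯ D ⪯ A` on the range of `A`: the columns of `T` form a
basis of that range, in which `A` becomes the identity and `D` becomes `diagonal lam`. The left
inverse `R` of `T` reads off the coordinates. -/
structure IsJointDiagonalization {n k : ℕ} (A D : Matrix (Fin n) (Fin n) ℝ)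
    (T : Matrix (Fin n) (Fin k) ℝ) (R : Matrix (Fin k) (Fin n) ℝ) (lam : Fin k → ℝ) : Prop where
  left_inv : R * T = 1
  eq_mul_transpose : A = T * Tᵀ
  eq_conj : D = T * diagonal lam * Tᵀ
  nonneg : ∀ i, 0 ≤ lam i
  le_one : ∀ i, lam i ≤ 1

section Determinants

variable {n : ℕ} {A D : Matrix (Fin n) (Fin n) ℝ}

theorem eq_conj_of_le {k : ℕ} {T : Matrix (Fin n) (Fin k) ℝ} {R : Matrix (Fin k) (Fin n) ℝ}
    (hRT : R * T = 1) (hD : D.PosSemidef) (hAD : (T * Tᵀ - D).PosSemidef) :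
    D = T * (R * D * Rᵀ) * Tᵀ := by
  have hTRD : T * R * D = D := by
    have h0 : (1 - T * R) * (T * Tᵀ) = 0 := by
      rw [Matrix.sub_mul, Matrix.one_mul, Matrix.mul_assoc T R, ← Matrix.mul_assoc R, hRT,
        Matrix.one_mul, sub_self]
    have := mul_eq_zero_of_mul_eq_zero_of_le hD hAD h0
    rwa [Matrix.sub_mul, Matrix.one_mul, sub_eq_zero, eq_comm] at this
  have hDTR : D * (T * R)ᵀ = D := by
    simpa [transpose_mul, transpose_eq_of_posSemidef hD] using congrArg transpose hTRD
  calc D = T * R * D * (T * R)ᵀ := by rw [hTRD, hDTR]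
    _ = _ := by rw [transpose_mul]; simp only [Matrix.mul_assoc]

theorem exists_isJointDiagonalization (hD : D.PosSemidef) (hAD : (A - D).PosSemidef) :
    ∃ (k : ℕ) (T : Matrix (Fin n) (Fin k) ℝ) (R : Matrix (Fin k) (Fin n) ℝ) (lam : Fin k → ℝ),
      IsJointDiagonalization A D T R lam := by
  obtain ⟨k, V, L, hLV, rfl⟩ :=
    exists_full_rank_factorization (by simpa using hAD.add hD : A.PosSemidef)
  obtain ⟨U, lam, hUU, hUU', hlam, hlam0⟩ :=
    exists_orthogonal_diagonalization (posSemidef_mul_mul_transpose hD L)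
  have hRT : Uᵀ * L * (V * U) = 1 := by
    calc Uᵀ * L * (V * U) = Uᵀ * (L * V) * U := by simp only [Matrix.mul_assoc]
      _ = 1 := by rw [hLV, Matrix.mul_one, hUU]
  have hVV : V * Vᵀ = V * U * (V * U)ᵀ := by
    calc V * Vᵀ = V * (U * Uᵀ) * Vᵀ := by rw [hUU', Matrix.mul_one]
      _ = _ := by rw [transpose_mul]; simp only [Matrix.mul_assoc]
  have hDT : D = V * U * diagonal lam * (V * U)ᵀ := by
    calc D = V * (U * diagonal lam * Uᵀ) * Vᵀ := hlam ▸ eq_conj_of_le hLV hD hAD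
      _ = _ := by rw [transpose_mul]; simp only [Matrix.mul_assoc]
  refine ⟨k, V * U, Uᵀ * L, lam, hRT, hVV, hDT, hlam0, fun i => ?_⟩
  have hsub : Uᵀ * L * (V * Vᵀ - D) * (Uᵀ * L)ᵀ = diagonal fun i => 1 - lam i := by
    calc _ = Uᵀ * L * (V * U) * (1 - diagonal lam) * (Uᵀ * L * (V * U))ᵀ := by
          rw [hVV, hDT, transpose_mul (Uᵀ * L) (V * U)]
          simp only [Matrix.mul_sub, Matrix.sub_mul, Matrix.mul_one, Matrix.mul_assoc]
      _ = _ := by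
          rw [hRT, Matrix.one_mul, transpose_one, Matrix.mul_one, ← diagonal_one, diagonal_sub]
  have := (hsub ▸ posSemidef_mul_mul_transpose hAD (Uᵀ * L)).diag_nonneg (i := i)
  simpa using this

/-- The value `½ ∑ log (1 / lam i)`, infinite as soon as some `lam i` vanishes: the divergence
rate of `k` independent scalar Gaussian channels with error variances `lam i`. -/
def diagRate {k : ℕ} (lam : Fin k → ℝ) : ℝ≥0∞ :=
  if ∏ i, lam i = 0 then ∞ else ENNReal.ofReal (1 / 2 * Real.log (1 / ∏ i, lam i))

/-- The regularized form of `halfLogDetRatio`, without a case distinction. -/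
def regLogDetRatio (A B : Matrix (Fin n) (Fin n) ℝ) : ℝ≥0∞ :=
  ⨆ (ε : ℝ) (_ : 0 < ε), ENNReal.ofReal
    (1 / 2 * Real.log ((A + ε • (1 : Matrix (Fin n) (Fin n) ℝ)).det /
      (B + ε • (1 : Matrix (Fin n) (Fin n) ℝ)).det))

theorem det_mul_add_smul_one {𝕜 m l : Type*} [Field 𝕜] [Fintype m] [DecidableEq m] [Fintype l]
    [DecidableEq l] (U : Matrix m l 𝕜) (V : Matrix l m 𝕜) {ε : 𝕜} (hε : ε ≠ 0) :
    ε ^ Fintype.card l * (U * V + ε • 1).det = ε ^ Fintype.card m * (V * U + ε • 1).det := by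
  have h₁ : U * V + ε • 1 = ε • (1 + (ε⁻¹ • U) * V) := by
    rw [smul_add, smul_mul, smul_smul, mul_inv_cancel₀ hε, one_smul, add_comm]
  have h₂ : V * U + ε • 1 = ε • (1 + V * (ε⁻¹ • U)) := by
    rw [smul_add, Matrix.mul_smul, smul_smul, mul_inv_cancel₀ hε, one_smul, add_comm]
  rw [h₁, h₂, det_smul, det_smul, det_one_add_mul_comm]
  ring

theorem tendsto_det_add_smul_one {m : Type*} [Fintype m] [DecidableEq m] (M : Matrix m m ℝ) :
    Tendsto (fun ε : ℝ => (M + ε • (1 : Matrix m m ℝ)).det) (𝓝[>] 0) (𝓝 M.det) := by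
  have h : Continuous fun ε : ℝ => (M + ε • (1 : Matrix m m ℝ)).det := by fun_prop
  simpa using (h.tendsto 0).mono_left (nhdsWithin_le_nhds (s := Set.Ioi 0))

namespace IsJointDiagonalization

variable {k : ℕ} {T : Matrix (Fin n) (Fin k) ℝ} {R : Matrix (Fin k) (Fin n) ℝ} {lam : Fin k → ℝ}

theorem posSemidef_left (h : IsJointDiagonalization A D T R lam) : A.PosSemidef := by
  rw [h.eq_mul_transpose]
  simpa using posSemidef_self_mul_conjTranspose T

theorem posSemidef_right (h : IsJointDiagonalization A D T R lam) : D.PosSemidef :=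
  h.eq_conj ▸ posSemidef_mul_mul_transpose (PosSemidef.diagonal h.nonneg) T

theorem posDef_gram (h : IsJointDiagonalization A D T R lam) : (Tᵀ * T).PosDef := by
  refine conjTranspose_eq_transpose_of_trivial T ▸ PosDef.conjTranspose_mul_self T ?_
  refine Function.LeftInverse.injective (g := R.mulVec) fun x => ?_
  rw [mulVec_mulVec, h.left_inv, one_mulVec]

theorem det_eq (h : IsJointDiagonalization A D T R lam) : D.det = A.det * ∏ i, lam i := by
  have hTR : Tᵀ * Rᵀ = 1 := by rw [← transpose_mul, h.left_inv, transpose_one]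
  have hD : D = A * (1 - Rᵀ * ((1 - diagonal lam) * Tᵀ)) := by
    rw [h.eq_conj, h.eq_mul_transpose, Matrix.mul_sub, Matrix.mul_one, Matrix.mul_assoc T Tᵀ,
      ← Matrix.mul_assoc Tᵀ Rᵀ, hTR, Matrix.one_mul, Matrix.sub_mul, Matrix.one_mul,
      Matrix.mul_sub, sub_sub_cancel, Matrix.mul_assoc]
  rw [hD, det_mul, det_one_sub_mul_comm, Matrix.mul_assoc, hTR, Matrix.mul_one, sub_sub_cancel,
    det_diagonal]

end IsJointDiagonalization

theorem det_le_det_of_posSemidef_sub (hD : D.PosSemidef) (hAD : (A - D).PosSemidef) :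
    D.det ≤ A.det := by
  obtain ⟨k, T, R, lam, h⟩ := exists_isJointDiagonalization hD hAD
  rw [h.det_eq]
  exact mul_le_of_le_one_right h.posSemidef_left.det_nonneg
    (Finset.prod_le_one (fun i _ => h.nonneg i) fun i _ => h.le_one i)

namespace IsJointDiagonalization

variable {k : ℕ} {T : Matrix (Fin n) (Fin k) ℝ} {R : Matrix (Fin k) (Fin n) ℝ} {lam : Fin k → ℝ}

theorem det_add_smul_one_mul_det_gram (h : IsJointDiagonalization A D T R lam) {ε : ℝ}
    (hε : ε ≠ 0) :
    (D + ε • 1).det * (Tᵀ * T + ε • 1).det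
      = (A + ε • 1).det * (diagonal lam * (Tᵀ * T) + ε • 1).det := by
  have hA := det_mul_add_smul_one T Tᵀ hε
  have hD := det_mul_add_smul_one T (diagonal lam * Tᵀ) hε
  rw [← h.eq_mul_transpose] at hA
  rw [← Matrix.mul_assoc, ← h.eq_conj, Matrix.mul_assoc] at hD
  refine mul_left_cancel₀ (pow_ne_zero (Fintype.card (Fin k)) hε) ?_
  linear_combination (Tᵀ * T + ε • 1).det * hD - (diagonal lam * (Tᵀ * T) + ε • 1).det * hA

theorem det_diagonal_mul_gram_pos (h : IsJointDiagonalization A D T R lam) {ε : ℝ} (hε : 0 < ε) :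
    0 < (diagonal lam * (Tᵀ * T) + ε • 1).det := by
  have hA := (posDef_add_smul_one h.posSemidef_left hε).det_pos
  have hD := (posDef_add_smul_one h.posSemidef_right hε).det_pos
  have hG := (posDef_add_smul_one h.posDef_gram.posSemidef hε).det_pos
  refine pos_of_mul_pos_right ?_ hA.le
  rw [← h.det_add_smul_one_mul_det_gram hε.ne']
  exact mul_pos hD hG

theorem det_ratio_eq (h : IsJointDiagonalization A D T R lam) {ε : ℝ} (hε : 0 < ε) :
    (A + ε • 1).det / (D + ε • 1).det
      = (Tᵀ * T + ε • 1).det / (diagonal lam * (Tᵀ * T) + ε • 1).det := by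
  rw [div_eq_div_iff (posDef_add_smul_one h.posSemidef_right hε).det_pos.ne'
    (h.det_diagonal_mul_gram_pos hε).ne', ← h.det_add_smul_one_mul_det_gram hε.ne', mul_comm]

theorem prod_mul_det_gram_le (h : IsJointDiagonalization A D T R lam)
    (hlam : ∀ i, lam i ≠ 0) {ε : ℝ} (hε : 0 < ε) :
    (∏ i, lam i) * (Tᵀ * T + ε • 1).det ≤ (diagonal lam * (Tᵀ * T) + ε • 1).det := by
  have hP : (diagonal fun i => ε * ((lam i)⁻¹ - 1)).PosSemidef := by
    refine PosSemidef.diagonal fun i => mul_nonneg hε.le (sub_nonneg.mpr ?_)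
    exact (one_le_inv₀ ((h.nonneg i).lt_of_ne' (hlam i))).mpr (h.le_one i)
  have hfactor : diagonal lam * (Tᵀ * T) + ε • 1
      = diagonal lam * (Tᵀ * T + ε • 1 + diagonal fun i => ε * ((lam i)⁻¹ - 1)) := by
    rw [Matrix.mul_add, Matrix.mul_add, add_assoc, ← diagonal_one, ← diagonal_smul,
      diagonal_mul_diagonal, diagonal_mul_diagonal, diagonal_add]
    congr 2; funext i
    have := hlam i
    simp only [Pi.smul_apply, smul_eq_mul]
    field_simp; ring
  rw [hfactor, det_mul, det_diagonal]
  exact mul_le_mul_of_nonneg_left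
    (det_le_det_of_posSemidef_sub (posDef_add_smul_one h.posDef_gram.posSemidef hε).posSemidef
      (by rwa [add_sub_cancel_left]))
    (Finset.prod_nonneg fun i _ => h.nonneg i)

theorem regularized_le_diagRate (h : IsJointDiagonalization A D T R lam) {ε : ℝ} (hε : 0 < ε) :
    ENNReal.ofReal (1 / 2 * Real.log ((A + ε • 1).det / (D + ε • 1).det)) ≤ diagRate lam := by
  unfold diagRate
  split_ifs with h0
  · exact le_top
  have hlam : ∀ i, lam i ≠ 0 := fun i => Finset.prod_ne_zero_iff.mp h0 i (Finset.mem_univ i)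
  have hprod : 0 < ∏ i, lam i := (Finset.prod_nonneg fun i _ => h.nonneg i).lt_of_ne' h0
  have hG := (posDef_add_smul_one h.posDef_gram.posSemidef hε).det_pos
  have hL := h.det_diagonal_mul_gram_pos hε
  rw [h.det_ratio_eq hε]
  refine ENNReal.ofReal_le_ofReal
    (mul_le_mul_of_nonneg_left (Real.log_le_log (div_pos hG hL) ?_) one_half_pos.le)
  rw [div_le_div_iff₀ hL hprod, one_mul, mul_comm]
  exact h.prod_mul_det_gram_le hlam hε

theorem tendsto_regularized (h : IsJointDiagonalization A D T R lam) :
    Tendsto (fun ε : ℝ => ENNReal.ofReal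
      (1 / 2 * Real.log ((A + ε • 1).det / (D + ε • 1).det))) (𝓝[>] 0) (𝓝 (diagRate lam)) := by
  have hG := h.posDef_gram.det_pos
  have hnum := tendsto_det_add_smul_one (Tᵀ * T)
  have hden := tendsto_det_add_smul_one (diagonal lam * (Tᵀ * T))
  rw [det_mul, det_diagonal] at hden
  suffices hlim : Tendsto (fun ε : ℝ => ENNReal.ofReal (1 / 2 * Real.log
      ((Tᵀ * T + ε • 1).det / (diagonal lam * (Tᵀ * T) + ε • 1).det))) (𝓝[>] 0)
      (𝓝 (diagRate lam)) from
    hlim.congr' (eventually_mem_nhdsWithin.mono fun ε hε => by simp only [h.det_ratio_eq hε])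
  unfold diagRate
  split_ifs with h0
  · rw [h0, zero_mul] at hden
    have hden' := tendsto_nhdsWithin_iff.mpr
      ⟨hden, eventually_mem_nhdsWithin.mono fun ε hε => h.det_diagonal_mul_gram_pos hε⟩
    have hratio := hnum.pos_mul_atTop hG hden'.inv_tendsto_nhdsGT_zero
    exact ENNReal.tendsto_ofReal_atTop.comp
      ((Real.tendsto_log_atTop.comp hratio).const_mul_atTop one_half_pos)
  · have hratio := hnum.div hden (mul_ne_zero h0 hG.ne')
    rw [div_mul_cancel_right₀ hG.ne', ← one_div] at hratio
    exact ENNReal.tendsto_ofReal ((hratio.log (one_div_ne_zero h0)).const_mul (1 / 2 : ℝ))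

theorem regLogDetRatio_eq (h : IsJointDiagonalization A D T R lam) :
    regLogDetRatio A D = diagRate lam :=
  le_antisymm (iSup₂_le fun _ hε => h.regularized_le_diagRate hε)
    (le_of_tendsto h.tendsto_regularized (eventually_mem_nhdsWithin.mono fun ε hε =>
      le_iSup₂_of_le ε hε le_rfl))

theorem halfLogDetRatio_eq (h : IsJointDiagonalization A D T R lam) :
    halfLogDetRatio A D = diagRate lam := by
  by_cases hA : A.det = 0
  · rw [← h.regLogDetRatio_eq]
    simp [halfLogDetRatio, hA, regLogDetRatio]
  · have hD : D.det = 0 ↔ ∏ i, lam i = 0 := by simp [h.det_eq, hA]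
    simp only [halfLogDetRatio, ne_eq, hA, not_false_eq_true, if_true, diagRate, hD]
    rw [h.det_eq, div_mul_cancel_left₀ hA, ← one_div]

end IsJointDiagonalization

theorem halfLogDetRatio_eq_regLogDetRatio (hD : D.PosSemidef) (hAD : (A - D).PosSemidef) :
    halfLogDetRatio A D = regLogDetRatio A D := by
  obtain ⟨k, T, R, lam, h⟩ := exists_isJointDiagonalization hD hAD
  rw [h.halfLogDetRatio_eq, h.regLogDetRatio_eq]

end Determinants

/-! ### Second moments and independence -/

section SecondMoments

variable {Ω : Type*} [MeasurableSpace Ω] {μ : Measure Ω}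

theorem toEuclideanLin_apply_apply {m n : ℕ} (A : Matrix (Fin m) (Fin n) ℝ) (v : Vec n)
    (i : Fin m) : toEuclideanLin A v i = ∑ j, A i j * v j := by
  simp [toLpLin_apply, mulVec, dotProduct]

theorem toEuclideanLin_mul_apply {l m n : ℕ} (A : Matrix (Fin l) (Fin m) ℝ)
    (B : Matrix (Fin m) (Fin n) ℝ) (v : Vec n) :
    toEuclideanLin (A * B) v = toEuclideanLin A (toEuclideanLin B v) := by
  simp [toLpLin_apply]

@[fun_prop]
theorem measurable_toEuclideanLin {m n : ℕ} (A : Matrix (Fin m) (Fin n) ℝ) :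
    Measurable fun v : Vec n => toEuclideanLin A v :=
  (LinearMap.continuous_of_finiteDimensional _).measurable

theorem memLp_toEuclideanLin {m n : ℕ} (A : Matrix (Fin m) (Fin n) ℝ) {p : ℝ≥0∞} {U : Ω → Vec n}
    (hU : MemLp U p μ) : MemLp (fun ω => toEuclideanLin A (U ω)) p μ :=
  (LinearMap.toContinuousLinearMap (toEuclideanLin A)).comp_memLp' hU

theorem integrable_coord_mul {m n : ℕ} {U : Ω → Vec m} {V : Ω → Vec n} (hU : MemLp U 2 μ)
    (hV : MemLp V 2 μ) (i : Fin m) (j : Fin n) : Integrable (fun ω => U ω i * V ω j) μ :=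
  (hU.eval_piLp i).integrable_mul (hV.eval_piLp j)

theorem covMat_transpose {m n : ℕ} (U : Ω → Vec m) (V : Ω → Vec n) :
    (covMat μ U V)ᵀ = covMat μ V U := by
  ext i j
  simp only [covMat, transpose_apply, of_apply, mul_comm]

theorem covMat_congr {m n : ℕ} {U U' : Ω → Vec m} {V V' : Ω → Vec n} (hU : U =ᵐ[μ] U')
    (hV : V =ᵐ[μ] V') : covMat μ U V = covMat μ U' V' := by
  ext i j
  refine integral_congr_ae ?_
  filter_upwards [hU, hV] with ω h1 h2
  rw [h1, h2]

theorem covMat_add_left {m n : ℕ} {U U' : Ω → Vec m} {V : Ω → Vec n} (hU : MemLp U 2 μ)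
    (hU' : MemLp U' 2 μ) (hV : MemLp V 2 μ) :
    covMat μ (fun ω => U ω + U' ω) V = covMat μ U V + covMat μ U' V := by
  ext i j
  simp only [covMat, of_apply, Matrix.add_apply, PiLp.add_apply, add_mul]
  exact integral_add (integrable_coord_mul hU hV i j) (integrable_coord_mul hU' hV i j)

theorem covMat_sub_left {m n : ℕ} {U U' : Ω → Vec m} {V : Ω → Vec n} (hU : MemLp U 2 μ)
    (hU' : MemLp U' 2 μ) (hV : MemLp V 2 μ) :
    covMat μ (fun ω => U ω - U' ω) V = covMat μ U V - covMat μ U' V := by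
  ext i j
  simp only [covMat, of_apply, Matrix.sub_apply, PiLp.sub_apply, sub_mul]
  exact integral_sub (integrable_coord_mul hU hV i j) (integrable_coord_mul hU' hV i j)

theorem covMat_add_right {m n : ℕ} {U : Ω → Vec m} {V V' : Ω → Vec n} (hU : MemLp U 2 μ)
    (hV : MemLp V 2 μ) (hV' : MemLp V' 2 μ) :
    covMat μ U (fun ω => V ω + V' ω) = covMat μ U V + covMat μ U V' := by
  rw [← covMat_transpose, covMat_add_left hV hV' hU, transpose_add, covMat_transpose,
    covMat_transpose]

theorem covMat_sub_right {m n : ℕ} {U : Ω → Vec m} {V V' : Ω → Vec n} (hU : MemLp U 2 μ)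
    (hV : MemLp V 2 μ) (hV' : MemLp V' 2 μ) :
    covMat μ U (fun ω => V ω - V' ω) = covMat μ U V - covMat μ U V' := by
  rw [← covMat_transpose, covMat_sub_left hV hV' hU, transpose_sub, covMat_transpose,
    covMat_transpose]

theorem covMat_toEuclideanLin_left {l m n : ℕ} (A : Matrix (Fin l) (Fin m) ℝ) {U : Ω → Vec m}
    {V : Ω → Vec n} (hU : MemLp U 2 μ) (hV : MemLp V 2 μ) :
    covMat μ (fun ω => toEuclideanLin A (U ω)) V = A * covMat μ U V := by
  ext i j
  simp only [covMat, of_apply, mul_apply, toEuclideanLin_apply_apply, Finset.sum_mul]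
  rw [integral_finsetSum]
  · refine Finset.sum_congr rfl fun x _ => ?_
    rw [← integral_const_mul]
    simp only [mul_assoc]
  · intro x _
    simp only [mul_assoc]
    exact (integrable_coord_mul hU hV x j).const_mul _

theorem covMat_toEuclideanLin_right {l m n : ℕ} (A : Matrix (Fin l) (Fin n) ℝ) {U : Ω → Vec m}
    {V : Ω → Vec n} (hU : MemLp U 2 μ) (hV : MemLp V 2 μ) :
    covMat μ U (fun ω => toEuclideanLin A (V ω)) = covMat μ U V * Aᵀ := by
  rw [← covMat_transpose, covMat_toEuclideanLin_left A hV hU, transpose_mul, covMat_transpose]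

theorem covMat_toEuclideanLin_self {m n : ℕ} (A : Matrix (Fin m) (Fin n) ℝ) {U : Ω → Vec n}
    (hU : MemLp U 2 μ) :
    covMat μ (fun ω => toEuclideanLin A (U ω)) (fun ω => toEuclideanLin A (U ω))
      = A * covMat μ U U * Aᵀ := by
  rw [covMat_toEuclideanLin_left A hU (memLp_toEuclideanLin A hU),
    covMat_toEuclideanLin_right A hU hU, Matrix.mul_assoc]

theorem integral_toEuclideanLin {m n : ℕ} (A : Matrix (Fin m) (Fin n) ℝ) {U : Ω → Vec n}
    (hU : Integrable U μ) :
    ∫ ω, toEuclideanLin A (U ω) ∂μ = toEuclideanLin A (∫ ω, U ω ∂μ) :=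
  (LinearMap.toContinuousLinearMap (toEuclideanLin A)).integral_comp_comm hU

theorem covMat_eq_zero_of_indepFun {m n : ℕ} {U : Ω → Vec m} {V : Ω → Vec n}
    (hU : Integrable U μ) (hV : Integrable V μ) (h : IndepFun U V μ) (h0 : ∫ ω, V ω ∂μ = 0) :
    covMat μ U V = 0 := by
  ext i j
  have hij : IndepFun (fun ω => U ω i) (fun ω => V ω j) μ :=
    h.comp (φ := fun v : Vec m => v i) (ψ := fun v : Vec n => v j) (by fun_prop) (by fun_prop)
  have hmul := hij.integral_fun_mul_eq_mul_integral
    (hU.eval_piLp i).aestronglyMeasurable (hV.eval_piLp j).aestronglyMeasurable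
  rw [covMat, of_apply, hmul, ← eval_integral_piLp fun j => hV.eval_piLp j, h0]
  simp

theorem covMat_self_quadratic {n : ℕ} {U : Ω → Vec n} (hU : MemLp U 2 μ) (v : Fin n → ℝ) :
    v ⬝ᵥ (covMat μ U U *ᵥ v) = ∫ ω, (∑ i, v i * U ω i) ^ 2 ∂μ := by
  have hexpand : ∀ ω, (∑ i, v i * U ω i) ^ 2
      = ∑ i, ∑ j, v i * v j * (U ω i * U ω j) := fun ω => by
    rw [sq, Finset.sum_mul_sum]
    exact Finset.sum_congr rfl fun i _ => Finset.sum_congr rfl fun j _ => by ring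
  simp_rw [hexpand]
  rw [integral_finsetSum _ fun i _ => integrable_finsetSum _ fun j _ =>
    (integrable_coord_mul hU hU i j).const_mul _]
  simp only [dotProduct, mulVec, covMat, of_apply, Finset.mul_sum]
  refine Finset.sum_congr rfl fun i _ => ?_
  rw [integral_finsetSum _ fun j _ => (integrable_coord_mul hU hU i j).const_mul _]
  refine Finset.sum_congr rfl fun j _ => ?_
  rw [integral_const_mul]; ring

theorem posSemidef_covMat_self {n : ℕ} {U : Ω → Vec n} (hU : MemLp U 2 μ) :
    (covMat μ U U).PosSemidef := by
  refine PosSemidef.of_dotProduct_mulVec_nonneg ?_ fun v => ?_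
  · rw [IsHermitian, conjTranspose_eq_transpose_of_trivial, covMat_transpose]
  · rw [star_trivial, covMat_self_quadratic hU]
    exact integral_nonneg fun ω => sq_nonneg _

theorem trace_covMat_self {n : ℕ} {U : Ω → Vec n} (hU : MemLp U 2 μ) :
    (covMat μ U U).trace = ∫ ω, ‖U ω‖ ^ 2 ∂μ := by
  simp only [trace, diag, covMat, of_apply, EuclideanSpace.real_norm_sq_eq]
  rw [integral_finsetSum _ fun i _ => by
    simpa [sq] using integrable_coord_mul hU hU i i]
  simp only [sq]

theorem ae_eq_zero_of_covMat_self_eq_zero {n : ℕ} {U : Ω → Vec n} (hU : MemLp U 2 μ)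
    (h : covMat μ U U = 0) : U =ᵐ[μ] 0 := by
  have hnorm := trace_covMat_self hU
  rw [h, trace_zero, eq_comm, integral_eq_zero_iff_of_nonneg (fun ω => sq_nonneg ‖U ω‖)
    ((memLp_two_iff_integrable_sq_norm hU.1).mp hU)] at hnorm
  filter_upwards [hnorm] with ω hω
  simpa using hω

end SecondMoments

section Independence

variable {Ω : Type*} [MeasurableSpace Ω] {μ : Measure Ω}

theorem strongDual_vec_apply {n : ℕ} (L : StrongDual ℝ (Vec n)) (v : Vec n) :
    L v = ∑ i, v i * L (EuclideanSpace.single i 1) := by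
  conv_lhs => rw [← (EuclideanSpace.basisFun (Fin n) ℝ).sum_repr v]
  simp

/-- `U` and `V` are uncorrelated, provided that `U` is centered: every continuous linear functional
of `V` is orthogonal in `L²` to the coordinates of `U`. Unlike `covMat μ U V = 0` this also makes
sense for `V` with values in a product of Euclidean spaces. -/
def Uncorrelated {n : ℕ} {E : Type*} [NormedAddCommGroup E] [NormedSpace ℝ E] (μ : Measure Ω)
    (U : Ω → Vec n) (V : Ω → E) : Prop :=
  ∀ i (L : StrongDual ℝ E), ∫ ω, U ω i * L (V ω) ∂μ = 0

theorem Uncorrelated.of_covMat {m n : ℕ} {U : Ω → Vec m} {V : Ω → Vec n} (hU : MemLp U 2 μ)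
    (hV : MemLp V 2 μ) (h : covMat μ U V = 0) : Uncorrelated μ U V := by
  intro i L
  have hexpand : ∀ ω, U ω i * L (V ω) = ∑ j, U ω i * V ω j * L (EuclideanSpace.single j 1) :=
    fun ω => by rw [strongDual_vec_apply L (V ω), Finset.mul_sum]; simp only [mul_assoc]
  simp_rw [hexpand]
  rw [integral_finsetSum _ fun j _ => (integrable_coord_mul hU hV i j).mul_const _]
  refine Finset.sum_eq_zero fun j _ => ?_
  rw [integral_mul_const]
  have hij : ∫ ω, U ω i * V ω j ∂μ = 0 := congrFun (congrFun h i) j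
  rw [hij, zero_mul]

theorem Uncorrelated.prodMk {n : ℕ} {E F : Type*} [NormedAddCommGroup E] [NormedSpace ℝ E]
    [NormedAddCommGroup F] [NormedSpace ℝ F] {U : Ω → Vec n} {V : Ω → E} {T : Ω → F}
    (hU : MemLp U 2 μ) (hV : MemLp V 2 μ) (hT : MemLp T 2 μ) (h1 : Uncorrelated μ U V)
    (h2 : Uncorrelated μ U T) : Uncorrelated μ U (fun ω => (V ω, T ω)) := by
  intro i L
  have hsplit : ∀ ω, U ω i * L (V ω, T ω) = U ω i * (L ∘L .inl ℝ E F) (V ω)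
      + U ω i * (L ∘L .inr ℝ E F) (T ω) := fun ω => by
    rw [← mul_add]; congr 1
    simp [← map_add]
  simp_rw [hsplit]
  rw [integral_add, h1, h2, add_zero]
  · exact (hU.eval_piLp i).integrable_mul ((L ∘L .inl ℝ E F).comp_memLp' hV)
  · exact (hU.eval_piLp i).integrable_mul ((L ∘L .inr ℝ E F).comp_memLp' hT)

theorem Uncorrelated.integral_strongDual_mul {n : ℕ} {E : Type*} [NormedAddCommGroup E]
    [NormedSpace ℝ E] {U : Ω → Vec n} {V : Ω → E} (hU : MemLp U 2 μ) (hV : MemLp V 2 μ)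
    (h : Uncorrelated μ U V) (L₁ : StrongDual ℝ (Vec n)) (L₂ : StrongDual ℝ E) :
    ∫ ω, L₁ (U ω) * L₂ (V ω) ∂μ = 0 := by
  have hexpand : ∀ ω, L₁ (U ω) * L₂ (V ω)
      = ∑ i, L₁ (EuclideanSpace.single i 1) * (U ω i * L₂ (V ω)) := fun ω => by
    rw [strongDual_vec_apply L₁ (U ω), Finset.sum_mul]
    exact Finset.sum_congr rfl fun i _ => by ring
  have hint : ∀ i, Integrable (fun ω => U ω i * L₂ (V ω)) μ := fun i =>
    (hU.eval_piLp i).integrable_mul (L₂.comp_memLp' hV)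
  simp_rw [hexpand]
  rw [integral_finsetSum _ fun i _ => (hint i).const_mul _]
  exact Finset.sum_eq_zero fun i _ => by rw [integral_const_mul, h i L₂, mul_zero]

theorem Uncorrelated.indepFun {n : ℕ} {E : Type*} [NormedAddCommGroup E] [NormedSpace ℝ E]
    [MeasurableSpace E] [BorelSpace E] [SecondCountableTopology E] [CompleteSpace E]
    {U : Ω → Vec n} {V : Ω → E} (hG : HasGaussianLaw (fun ω => (U ω, V ω)) μ)
    (h0 : ∫ ω, U ω ∂μ = 0) (h : Uncorrelated μ U V) : IndepFun U V μ := by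
  have := hG.isProbabilityMeasure
  have hU := hG.fst.memLp_two
  have hV := hG.snd.memLp_two
  refine hG.indepFun_of_covariance_strongDual fun L₁ L₂ => ?_
  have hmean : ∫ ω, L₁ (U ω) ∂μ = 0 := by
    rw [L₁.integral_comp_comm (hU.integrable one_le_two), h0, map_zero]
  rw [covariance_eq_sub (L₁.comp_memLp' hU) (L₂.comp_memLp' hV)]
  simp only [Pi.mul_apply, Function.comp_apply]
  rw [h.integral_strongDual_mul hU hV, hmean, zero_mul, sub_zero]

theorem cexp_ae_eq_of_indepFun {n : ℕ} {β : Type*} [MeasurableSpace β] [IsFiniteMeasure μ]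
    {U u : Ω → Vec n} {Z : Ω → β} {M : β → Vec n} (hZ : Measurable Z) (hM : Measurable M)
    (hu : Measurable u)
    (hUM : U =ᵐ[μ] fun ω => M (Z ω) + u ω) (hMi : Integrable (fun ω => M (Z ω)) μ)
    (hui : Integrable u μ) (h0 : ∫ ω, u ω ∂μ = 0) (hind : IndepFun u Z μ) :
    cexp μ U Z =ᵐ[μ] fun ω => M (Z ω) := by
  have hMZ : condExp (MeasurableSpace.comap Z inferInstance) μ (fun ω => M (Z ω))
      = fun ω => M (Z ω) :=
    condExp_of_stronglyMeasurable hZ.comap_le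
      ((hM.comp (comap_measurable Z)).stronglyMeasurable) hMi
  have hu0 := condExp_indep_eq hu.comap_le hZ.comap_le (comap_measurable u).stronglyMeasurable
    hind
  have hadd := condExp_add hMi hui (MeasurableSpace.comap Z inferInstance)
  rw [hMZ] at hadd
  refine (condExp_congr_ae hUM).trans (hadd.trans ?_)
  filter_upwards [hu0] with ω hω
  simp [hω, h0]

section Kernels

variable {β : Type*} [MeasurableSpace β] {n : ℕ}

/-- The kernel `z ↦ law of M z + u`, where `u` has law `ρ`. -/
def shiftKernel (ρ : Measure (Vec n)) (M : β → Vec n) :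
    Kernel β (Vec n) :=
  (Kernel.id ×ₖ Kernel.const β ρ).map fun p => M p.1 + p.2

theorem shiftKernel_apply (ρ : Measure (Vec n)) [IsProbabilityMeasure ρ] {M : β → Vec n}
    (hM : Measurable M) (z : β) : shiftKernel ρ M z = ρ.map (fun v => M z + v) := by
  have hm : Measurable fun p : β × Vec n => M p.1 + p.2 :=
    (hM.comp measurable_fst).add measurable_snd
  rw [shiftKernel, Kernel.map_apply _ hm, Kernel.prod_apply, Kernel.id_apply,
    Kernel.const_apply, Measure.dirac_prod, Measure.map_map hm (by fun_prop)]
  rfl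

theorem isMarkovKernel_shiftKernel (ρ : Measure (Vec n)) [IsProbabilityMeasure ρ] {M : β → Vec n}
    (hM : Measurable M) : IsMarkovKernel (shiftKernel ρ M) :=
  Kernel.IsMarkovKernel.map _ ((hM.comp measurable_fst).add measurable_snd)

theorem lintegral_shiftKernel (ρ : Measure (Vec n)) [IsProbabilityMeasure ρ] {M : β → Vec n}
    (hM : Measurable M) (z : β) {f : Vec n → ℝ≥0∞} (hf : Measurable f) :
    ∫⁻ v, f v ∂(shiftKernel ρ M z) = ∫⁻ v, f (M z + v) ∂ρ := by
  rw [shiftKernel_apply ρ hM, lintegral_map hf (by fun_prop)]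

variable [IsProbabilityMeasure μ]

theorem condDistrib_ae_eq_shiftKernel {U u : Ω → Vec n} {Z : Ω → β} {M : β → Vec n}
    (hZ : Measurable Z) (hM : Measurable M) (hu : Measurable u)
    (hUM : U = fun ω => M (Z ω) + u ω) (hind : IndepFun u Z μ)
    [IsProbabilityMeasure (μ.map u)] :
    condDistrib U Z μ =ᵐ[μ.map Z] shiftKernel (μ.map u) M := by
  have := isMarkovKernel_shiftKernel (μ.map u) hM
  have hU : Measurable U := by rw [hUM]; exact (hM.comp hZ).add hu
  have hlaw := (indepFun_iff_map_prod_eq_prod_map_map hZ.aemeasurable hu.aemeasurable).mp hind.symm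
  refine condDistrib_ae_eq_of_measure_eq_compProd Z hU.aemeasurable
    (Measure.ext_of_lintegral _ fun f hf => ?_)
  have hg : Measurable fun p : β × Vec n => f (p.1, M p.1 + p.2) :=
    hf.comp (measurable_fst.prodMk ((hM.comp measurable_fst).add measurable_snd))
  rw [Measure.lintegral_compProd hf, lintegral_map hf (hZ.prodMk hU)]
  calc ∫⁻ a, f (Z a, U a) ∂μ = ∫⁻ p, f (p.1, M p.1 + p.2) ∂(μ.map fun ω => (Z ω, u ω)) := by
        rw [lintegral_map hg (hZ.prodMk hu), hUM]
    _ = ∫⁻ z, ∫⁻ v, f (z, M z + v) ∂(μ.map u) ∂(μ.map Z) := by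
        rw [hlaw, lintegral_prod _ hg.aemeasurable]
    _ = _ := by
        refine lintegral_congr fun z => ?_
        rw [lintegral_shiftKernel _ hM z (f := fun v => f (z, v)) (by fun_prop)]

theorem condLawDrops_of_indepFun {γ : Type*} [MeasurableSpace γ] {U u : Ω → Vec n} {V : Ω → β}
    {T : Ω → γ} {M : β → Vec n} (hV : Measurable V) (hT : Measurable T) (hM : Measurable M)
    (hu : Measurable u) (hUM : U = fun ω => M (V ω) + u ω)
    (hind : IndepFun u (fun ω => (V ω, T ω)) μ) : CondLawDrops μ U V T := by
  have := Measure.isProbabilityMeasure_map (μ := μ) hu.aemeasurable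
  have hVT := condDistrib_ae_eq_shiftKernel (Z := fun ω => (V ω, T ω)) (M := fun p => M p.1)
    (hV.prodMk hT) (hM.comp measurable_fst) hu hUM hind
  have hV' : ∀ᵐ p ∂(μ.map fun ω => (V ω, T ω)),
      condDistrib U V μ p.1 = shiftKernel (μ.map u) M p.1 := by
    refine ae_of_ae_map (μ := μ.map fun ω => (V ω, T ω)) (f := Prod.fst)
      (p := fun v => condDistrib U V μ v = shiftKernel (μ.map u) M v)
      measurable_fst.aemeasurable ?_
    rw [Measure.map_map measurable_fst (hV.prodMk hT)]
    exact condDistrib_ae_eq_shiftKernel hV hM hu hUM (hind.comp measurable_id measurable_fst)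
  filter_upwards [hVT, hV'] with p hpVT hpV
  rw [hpVT, hpV, shiftKernel_apply (M := fun p : β × γ => M p.1) _ (hM.comp measurable_fst),
    shiftKernel_apply _ hM]

end Kernels

end Independence

/-! ### Divergence and mutual information -/

section Divergence

variable {α β : Type*} [MeasurableSpace α] [MeasurableSpace β]

theorem klDiv_map_of_ae_leftInverse {μ ν : Measure α} [IsFiniteMeasure μ] [IsFiniteMeasure ν]
    {f : α → β} {g : β → α} (hf : Measurable f) (hg : Measurable g)
    (hμ : ∀ᵐ x ∂μ, g (f x) = x) (hν : ∀ᵐ x ∂ν, g (f x) = x) :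
    klDiv (μ.map f) (ν.map f) = klDiv μ ν := by
  have hinv : ∀ {ρ : Measure α}, (∀ᵐ x ∂ρ, g (f x) = x) → (ρ.map f).map g = ρ := fun h => by
    rw [Measure.map_map hg hf, Measure.map_congr (f := g ∘ f) (g := id) h, Measure.map_id]
  refine le_antisymm (klDiv_map_le μ ν hf) ?_
  have h := klDiv_map_le (μ.map f) (ν.map f) hg
  rwa [hinv hμ, hinv hν] at h

theorem integrable_exp_of_lintegral {ν : Measure α} {f : α → ℝ} (hf : Measurable f)
    (h : ∫⁻ x, ENNReal.ofReal (Real.exp (f x)) ∂ν = 1) :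
    Integrable (fun x => Real.exp (f x)) ν ∧ ∫ x, Real.exp (f x) ∂ν = 1 := by
  have hm : AEStronglyMeasurable (fun x => Real.exp (f x)) ν :=
    (Real.measurable_exp.comp hf).aestronglyMeasurable
  have h0 : 0 ≤ᵐ[ν] fun x => Real.exp (f x) := ae_of_all _ fun x => (Real.exp_pos _).le
  refine ⟨⟨hm, ?_⟩, ?_⟩
  · rw [hasFiniteIntegral_iff_ofReal h0, h]; exact ENNReal.one_lt_top
  · rw [integral_eq_lintegral_of_nonneg_ae h0 hm, h, ENNReal.toReal_one]

-- The Donsker–Varadhan inequality.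
theorem ofReal_integral_le_klDiv {μ ν : Measure α} [IsProbabilityMeasure μ]
    [IsProbabilityMeasure ν] {f : α → ℝ} (hf : Measurable f) (hfμ : Integrable f μ)
    (h : ∫⁻ x, ENNReal.ofReal (Real.exp (f x)) ∂ν = 1) :
    ENNReal.ofReal (∫ x, f x ∂μ) ≤ klDiv μ ν := by
  by_cases hfin : klDiv μ ν = ∞
  · rw [hfin]; exact le_top
  obtain ⟨hac, hinteg⟩ := klDiv_ne_top_iff.mp hfin
  obtain ⟨hi, h1⟩ := integrable_exp_of_lintegral hf h
  have := isProbabilityMeasure_tilted hi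
  have h2 := integral_llr_add_sub_measure_univ_nonneg
    (hac.trans (absolutelyContinuous_tilted hi)) (integrable_llr_tilted_right hac hfμ hinteg hi)
  rw [integral_llr_tilted_right hac hfμ hi hinteg, h1] at h2
  rw [klDiv_of_ac_of_integrable hac hinteg]
  refine ENNReal.ofReal_le_ofReal ?_
  simp only [Real.log_one, probReal_univ] at h2 ⊢
  linarith

theorem klDiv_withDensity_exp {ν : Measure α} [IsProbabilityMeasure ν] {f : α → ℝ}
    (hf : Measurable f) (h : ∫⁻ x, ENNReal.ofReal (Real.exp (f x)) ∂ν = 1)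
    (hfμ : Integrable f (ν.withDensity fun x => ENNReal.ofReal (Real.exp (f x)))) :
    klDiv (ν.withDensity fun x => ENNReal.ofReal (Real.exp (f x))) ν
      = ENNReal.ofReal (∫ x, f x ∂(ν.withDensity fun x => ENNReal.ofReal (Real.exp (f x)))) := by
  obtain ⟨hi, h1⟩ := integrable_exp_of_lintegral hf h
  have ht : (ν.withDensity fun x => ENNReal.ofReal (Real.exp (f x))) = ν.tilted f := by
    simp [Measure.tilted, h1]
  rw [ht] at hfμ ⊢
  have := isProbabilityMeasure_tilted hi
  have hl : llr (ν.tilted f) ν =ᵐ[ν.tilted f] f := by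
    refine (tilted_absolutelyContinuous ν f).ae_le ?_
    filter_upwards [log_rnDeriv_tilted_left_self hi] with x hx
    rw [llr, hx, h1, Real.log_one, sub_zero]
  rw [klDiv_of_ac_of_integrable (tilted_absolutelyContinuous ν f) ((integrable_congr hl).mpr hfμ),
    integral_congr_ae hl]
  simp

end Divergence

section GaussianDensity

/-- The log-likelihood ratio of `N(ρ, diag lam)` with respect to `N(0, 1)` at the point `v`. -/
def gaussLLR {k : ℕ} (lam ρ v : Fin k → ℝ) : ℝ :=
  ∑ i, (-(1 / 2) * Real.log (lam i) - (v i - ρ i) ^ 2 / (2 * lam i) + v i ^ 2 / 2)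

theorem gaussianReal_eq_withDensity {l : ℝ} (hl : 0 < l) (r : ℝ) :
    gaussianReal r l.toNNReal = (gaussianReal 0 1).withDensity fun x => ENNReal.ofReal
      (Real.exp (-(1 / 2) * Real.log l - (x - r) ^ 2 / (2 * l) + x ^ 2 / 2)) := by
  rw [gaussianReal_of_var_ne_zero _ (by simpa using hl), gaussianReal_of_var_ne_zero _ one_ne_zero,
    ← withDensity_mul _ (measurable_gaussianPDF 0 1) (by fun_prop)]
  congr 1
  ext x
  simp only [Pi.mul_apply, gaussianPDF]
  rw [← ENNReal.ofReal_mul (gaussianPDFReal_nonneg _ _ _)]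
  congr 1
  simp only [gaussianPDFReal, NNReal.coe_one, mul_one, sub_zero, Real.coe_toNNReal _ hl.le]
  have h1 : Real.exp (-(1 / 2) * Real.log l) = (√l)⁻¹ := by
    rw [← Real.sqrt_inv, Real.sqrt_eq_rpow, Real.rpow_def_of_pos (by positivity), Real.log_inv]
    congr 1; ring
  rw [show -(1 / 2) * Real.log l - (x - r) ^ 2 / (2 * l) + x ^ 2 / 2
    = -(1 / 2) * Real.log l + (-(x - r) ^ 2 / (2 * l) + x ^ 2 / 2) by ring, Real.exp_add,
    Real.exp_add, h1, Real.sqrt_mul (by positivity) l, mul_inv]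
  have h2 : Real.exp (-x ^ 2 / 2) * Real.exp (x ^ 2 / 2) = 1 := by
    rw [← Real.exp_add]; simp [neg_div]
  linear_combination (-(√(2 * Real.pi))⁻¹ * (√l)⁻¹ * Real.exp (-(x - r) ^ 2 / (2 * l))) * h2

theorem pi_withDensity_prod {k : ℕ} (ν : Fin k → Measure ℝ) [∀ i, IsProbabilityMeasure (ν i)]
    (h : Fin k → ℝ → ℝ≥0∞) (hh : ∀ i, Measurable (h i))
    [∀ i, SigmaFinite ((ν i).withDensity (h i))] :
    Measure.pi (fun i => (ν i).withDensity (h i))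
      = (Measure.pi ν).withDensity fun v => ∏ i, h i (v i) := by
  refine (Measure.pi_eq fun s hs => ?_)
  have hm : ∀ i, Measurable ((s i).indicator (h i)) := fun i => (hh i).indicator (hs i)
  rw [withDensity_apply _ (MeasurableSet.univ_pi hs),
    ← lintegral_indicator (MeasurableSet.univ_pi hs)]
  have e : ∀ v : Fin k → ℝ, (Set.univ.pi s).indicator (fun v => ∏ i, h i (v i)) v
      = ∏ i, (s i).indicator (h i) (v i) := fun v => by
    by_cases hv : v ∈ Set.univ.pi s
    · rw [Set.indicator_of_mem hv]
      exact Finset.prod_congr rfl fun i _ => (Set.indicator_of_mem (hv i (Set.mem_univ i)) _).symm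
    · rw [Set.indicator_of_notMem hv]
      obtain ⟨i, hi⟩ : ∃ i, v i ∉ s i := by simpa using hv
      exact (Finset.prod_eq_zero (Finset.mem_univ i) (Set.indicator_of_notMem hi _)).symm
  simp_rw [e]
  rw [lintegral_prod_eq_prod_lintegral_of_indepFun Finset.univ
    (fun i (v : Fin k → ℝ) => (s i).indicator (h i) (v i))
    (iIndepFun_pi fun i => (hm i).aemeasurable) fun i => (hm i).comp (measurable_pi_apply i)]
  refine Finset.prod_congr rfl fun i _ => ?_
  rw [withDensity_apply _ (hs i), ← lintegral_indicator (hs i),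
    ← (measurePreserving_eval ν i).lintegral_comp (hm i)]

theorem pi_gaussianReal_eq_withDensity {k : ℕ} {lam : Fin k → ℝ} (hl : ∀ i, 0 < lam i)
    (ρ : Fin k → ℝ) :
    Measure.pi (fun i => gaussianReal (ρ i) (lam i).toNNReal)
      = (Measure.pi fun _ : Fin k => gaussianReal 0 1).withDensity
        fun v => ENNReal.ofReal (Real.exp (gaussLLR lam ρ v)) := by
  have h1 := fun i => gaussianReal_eq_withDensity (hl i) (ρ i)
  have : ∀ i, SigmaFinite ((gaussianReal 0 1).withDensity fun x => ENNReal.ofReal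
      (Real.exp (-(1 / 2) * Real.log (lam i) - (x - ρ i) ^ 2 / (2 * lam i) + x ^ 2 / 2))) :=
    fun i => by rw [← h1 i]; infer_instance
  simp_rw [h1]
  rw [pi_withDensity_prod (fun _ : Fin k => gaussianReal 0 1) _ (fun i => by fun_prop)]
  congr 1
  ext v
  rw [gaussLLR, Real.exp_sum, ENNReal.ofReal_prod_of_nonneg fun i _ => (Real.exp_pos _).le]

theorem pi_gaussianReal_map_add {k : ℕ} (lam : Fin k → ℝ) (ρ : Fin k → ℝ) :
    (Measure.pi fun i => gaussianReal 0 (lam i).toNNReal).map (fun v => ρ + v)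
      = Measure.pi (fun i => gaussianReal (ρ i) (lam i).toNNReal) := by
  have := Measure.pi_map_pi (μ := fun i => gaussianReal 0 (lam i).toNNReal)
    (f := fun i x => ρ i + x) (fun i => by fun_prop)
  rw [show (fun v : Fin k → ℝ => ρ + v) = fun v i => ρ i + v i from rfl, this]
  congr 1; ext1 i
  rw [gaussianReal_map_const_add, zero_add]

variable {Ω ζ : Type*} [MeasurableSpace Ω] [MeasurableSpace ζ] {μ : Measure Ω}
  [IsProbabilityMeasure μ] {k : ℕ} {lam : Fin k → ℝ}

theorem integrable_gaussLLR {x r : Ω → Fin k → ℝ} (hx : ∀ i, MemLp (fun ω => x ω i) 2 μ)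
    (he : ∀ i, MemLp (fun ω => x ω i - r ω i) 2 μ) :
    Integrable (fun ω => gaussLLR lam (r ω) (x ω)) μ :=
  integrable_finsetSum _ fun i _ => ((integrable_const _).sub
    ((he i).integrable_sq.div_const _)).add ((hx i).integrable_sq.div_const _)

theorem integral_gaussLLR {x r : Ω → Fin k → ℝ} (hx : ∀ i, MemLp (fun ω => x ω i) 2 μ)
    (he : ∀ i, MemLp (fun ω => x ω i - r ω i) 2 μ) :
    ∫ ω, gaussLLR lam (r ω) (x ω) ∂μ = ∑ i, (-(1 / 2) * Real.log (lam i)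
      - (∫ ω, (x ω i - r ω i) ^ 2 ∂μ) / (2 * lam i) + (∫ ω, x ω i ^ 2 ∂μ) / 2) := by
  have hi : ∀ i, Integrable (fun ω => -(1 / 2) * Real.log (lam i)
      - (x ω i - r ω i) ^ 2 / (2 * lam i)) μ := fun i =>
    (integrable_const _).sub ((he i).integrable_sq.div_const _)
  have hx2 : ∀ i, Integrable (fun ω => x ω i ^ 2 / 2) μ := fun i =>
    (hx i).integrable_sq.div_const _
  have hterm : ∀ i, Integrable (fun ω => -(1 / 2) * Real.log (lam i)
      - (x ω i - r ω i) ^ 2 / (2 * lam i) + x ω i ^ 2 / 2) μ := fun i => (hi i).add (hx2 i)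
  simp only [gaussLLR]
  rw [integral_finsetSum _ fun i _ => hterm i]
  refine Finset.sum_congr rfl fun i _ => ?_
  rw [integral_add (hi i) (hx2 i), integral_sub (integrable_const _)
    ((he i).integrable_sq.div_const _), integral_div, integral_div]
  simp

theorem measurable_gaussLLR {ρ : ζ → Fin k → ℝ} (hρ : Measurable ρ) :
    Measurable fun p : ζ × (Fin k → ℝ) => gaussLLR lam (ρ p.1) p.2 := by
  unfold gaussLLR
  fun_prop

theorem lintegral_exp_gaussLLR (κ : Measure ζ) [IsProbabilityMeasure κ] {ρ : ζ → Fin k → ℝ}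
    (hρ : Measurable ρ) (hl : ∀ i, 0 < lam i) :
    ∫⁻ p, ENNReal.ofReal (Real.exp (gaussLLR lam (ρ p.1) p.2))
      ∂(κ.prod (Measure.pi fun _ : Fin k => gaussianReal 0 1)) = 1 := by
  have hm : Measurable fun p : ζ × (Fin k → ℝ) =>
      ENNReal.ofReal (Real.exp (gaussLLR lam (ρ p.1) p.2)) :=
    (Real.measurable_exp.comp (measurable_gaussLLR hρ)).ennreal_ofReal
  have hfiber : ∀ z, ∫⁻ v, ENNReal.ofReal (Real.exp (gaussLLR lam (ρ z) v))
      ∂(Measure.pi fun _ : Fin k => gaussianReal 0 1) = 1 := fun z => by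
    rw [← setLIntegral_univ, ← withDensity_apply _ MeasurableSet.univ,
      ← pi_gaussianReal_eq_withDensity hl, measure_univ]
  rw [lintegral_prod _ hm.aemeasurable]
  simp [hfiber]

theorem ofReal_integral_gaussLLR_le_klDiv {Z : Ω → ζ} {x : Ω → Fin k → ℝ} {ρ : ζ → Fin k → ℝ}
    (hZ : Measurable Z) (hx : Measurable x) (hρ : Measurable ρ) (hl : ∀ i, 0 < lam i)
    (hint : Integrable (fun ω => gaussLLR lam (ρ (Z ω)) (x ω)) μ) :
    ENNReal.ofReal (∫ ω, gaussLLR lam (ρ (Z ω)) (x ω) ∂μ)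
      ≤ klDiv (μ.map fun ω => (Z ω, x ω))
        ((μ.map Z).prod (Measure.pi fun _ : Fin k => gaussianReal 0 1)) := by
  have hZx := hZ.prodMk hx
  have hL := measurable_gaussLLR (lam := lam) hρ
  have := Measure.isProbabilityMeasure_map (μ := μ) hZ.aemeasurable
  have := Measure.isProbabilityMeasure_map (μ := μ) hZx.aemeasurable
  have h := ofReal_integral_le_klDiv (μ := μ.map fun ω => (Z ω, x ω)) hL
    ((integrable_map_measure hL.aestronglyMeasurable hZx.aemeasurable).mpr hint)
    (lintegral_exp_gaussLLR (μ.map Z) hρ hl)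
  rwa [integral_map hZx.aemeasurable hL.aestronglyMeasurable] at h

theorem map_prodMk_eq_withDensity_gaussLLR {Z : Ω → ζ} {w : Ω → Fin k → ℝ} {ρ : ζ → Fin k → ℝ}
    (hZ : Measurable Z) (hw : Measurable w) (hρ : Measurable ρ) (hl : ∀ i, 0 < lam i)
    (hind : IndepFun Z w μ)
    (hlaw : μ.map w = Measure.pi fun i => gaussianReal 0 (lam i).toNNReal) :
    μ.map (fun ω => (Z ω, ρ (Z ω) + w ω))
      = ((μ.map Z).prod (Measure.pi fun _ : Fin k => gaussianReal 0 1)).withDensity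
        fun p => ENNReal.ofReal (Real.exp (gaussLLR lam (ρ p.1) p.2)) := by
  have := Measure.isProbabilityMeasure_map (μ := μ) hZ.aemeasurable
  have := Measure.isProbabilityMeasure_map (μ := μ) hw.aemeasurable
  have hd : Measurable fun p : ζ × (Fin k → ℝ) =>
      ENNReal.ofReal (Real.exp (gaussLLR lam (ρ p.1) p.2)) :=
    (Real.measurable_exp.comp (measurable_gaussLLR hρ)).ennreal_ofReal
  refine Measure.ext_of_lintegral _ fun φ hφ => ?_
  have hφ' : Measurable fun p : ζ × (Fin k → ℝ) => φ (p.1, ρ p.1 + p.2) := by fun_prop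
  calc ∫⁻ p, φ p ∂(μ.map fun ω => (Z ω, ρ (Z ω) + w ω))
      = ∫⁻ p, φ (p.1, ρ p.1 + p.2) ∂(μ.map fun ω => (Z ω, w ω)) := by
        rw [lintegral_map hφ (by fun_prop), lintegral_map hφ' (by fun_prop)]
    _ = ∫⁻ z, ∫⁻ v, φ (z, ρ z + v) ∂(μ.map w) ∂(μ.map Z) := by
        rw [(indepFun_iff_map_prod_eq_prod_map_map hZ.aemeasurable hw.aemeasurable).mp hind,
          lintegral_prod _ hφ'.aemeasurable]
    _ = ∫⁻ z, ∫⁻ u, φ (z, u) ∂((Measure.pi fun _ : Fin k => gaussianReal 0 1).withDensity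
          fun u => ENNReal.ofReal (Real.exp (gaussLLR lam (ρ z) u))) ∂(μ.map Z) := by
        refine lintegral_congr fun z => ?_
        rw [← pi_gaussianReal_eq_withDensity hl, ← pi_gaussianReal_map_add, ← hlaw,
          lintegral_map (f := fun u => φ (z, u)) (by fun_prop) (measurable_const_add _)]
    _ = ∫⁻ p, φ p ∂(((μ.map Z).prod (Measure.pi fun _ => gaussianReal 0 1)).withDensity
          fun p => ENNReal.ofReal (Real.exp (gaussLLR lam (ρ p.1) p.2))) := by
        rw [lintegral_withDensity_eq_lintegral_mul _ hd hφ,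
          lintegral_prod _ (hd.mul hφ).aemeasurable]
        refine lintegral_congr fun z => ?_
        exact lintegral_withDensity_eq_lintegral_mul _ (hd.comp measurable_prodMk_left)
          (hφ.comp measurable_prodMk_left)

theorem klDiv_eq_ofReal_integral_gaussLLR {Z : Ω → ζ} {w : Ω → Fin k → ℝ} {ρ : ζ → Fin k → ℝ}
    (hZ : Measurable Z) (hw : Measurable w) (hρ : Measurable ρ) (hl : ∀ i, 0 < lam i)
    (hind : IndepFun Z w μ)
    (hlaw : μ.map w = Measure.pi fun i => gaussianReal 0 (lam i).toNNReal)
    (hint : Integrable (fun ω => gaussLLR lam (ρ (Z ω)) (ρ (Z ω) + w ω)) μ) :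
    klDiv (μ.map fun ω => (Z ω, ρ (Z ω) + w ω))
        ((μ.map Z).prod (Measure.pi fun _ : Fin k => gaussianReal 0 1))
      = ENNReal.ofReal (∫ ω, gaussLLR lam (ρ (Z ω)) (ρ (Z ω) + w ω) ∂μ) := by
  have hL := measurable_gaussLLR (lam := lam) hρ
  have hm : Measurable fun ω => (Z ω, ρ (Z ω) + w ω) := by fun_prop
  have hdens := map_prodMk_eq_withDensity_gaussLLR hZ hw hρ hl hind hlaw
  have := Measure.isProbabilityMeasure_map (μ := μ) hZ.aemeasurable
  have hint' := (integrable_map_measure hL.aestronglyMeasurable hm.aemeasurable).mpr hint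
  rw [hdens] at hint'
  have h := klDiv_withDensity_exp hL (lintegral_exp_gaussLLR _ hρ hl) hint'
  rw [← hdens] at h
  rw [h, integral_map hm.aemeasurable hL.aestronglyMeasurable]

end GaussianDensity

section GaussianLaw

variable {Ω : Type*} [MeasurableSpace Ω] {μ : Measure Ω} {n k : ℕ}
  {T : Matrix (Fin n) (Fin k) ℝ} {R : Matrix (Fin k) (Fin n) ℝ} {lam : Fin k → ℝ} {w : Ω → Vec n}

/-- The vector `R v` in `Fin k → ℝ`, the space on which `Measure.pi` lives. -/
def coords (R : Matrix (Fin k) (Fin n) ℝ) (v : Vec n) : Fin k → ℝ :=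
  toEuclideanLin R v

theorem measurable_coords (R : Matrix (Fin k) (Fin n) ℝ) : Measurable (coords R) :=
  (WithLp.measurable_ofLp 2 _).comp (measurable_toEuclideanLin R)

theorem coords_sub (R : Matrix (Fin k) (Fin n) ℝ) (u v : Vec n) :
    coords R (u - v) = coords R u - coords R v := by
  simp [coords]

theorem memLp_coords (R : Matrix (Fin k) (Fin n) ℝ) (hw : MemLp w 2 μ) (i : Fin k) :
    MemLp (fun ω => coords R (w ω) i) 2 μ :=
  (memLp_toEuclideanLin R hw).eval_piLp i

theorem mul_conj_diagonal_mul_transpose {D : Matrix (Fin n) (Fin n) ℝ} (hRT : R * T = 1)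
    (hD : D = T * diagonal lam * Tᵀ) : R * D * Rᵀ = diagonal lam := by
  calc R * D * Rᵀ = (R * T) * diagonal lam * (R * T)ᵀ := by
        rw [hD, transpose_mul]; simp only [Matrix.mul_assoc]
    _ = diagonal lam := by rw [hRT]; simp

theorem integral_coords_mul_coords (hw : MemLp w 2 μ) (hRT : R * T = 1)
    (hD : covMat μ w w = T * diagonal lam * Tᵀ) (i j : Fin k) :
    ∫ ω, coords R (w ω) i * coords R (w ω) j ∂μ = diagonal lam i j := by
  rw [← mul_conj_diagonal_mul_transpose hRT hD, ← covMat_toEuclideanLin_self R hw]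
  rfl

theorem integral_coords_sq (hw : MemLp w 2 μ) (hRT : R * T = 1)
    (hD : covMat μ w w = T * diagonal lam * Tᵀ) (i : Fin k) :
    ∫ ω, coords R (w ω) i ^ 2 ∂μ = lam i := by
  simpa only [sq, diagonal_apply_eq] using integral_coords_mul_coords hw hRT hD i i

theorem ae_eq_of_covMat_range (hw : MemLp w 2 μ) (hRT : R * T = 1)
    (hD : covMat μ w w = T * diagonal lam * Tᵀ) :
    ∀ᵐ ω ∂μ, toEuclideanLin T (toEuclideanLin R (w ω)) = w ω := by
  have hproj : (1 - T * R) * T = 0 := by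
    rw [Matrix.sub_mul, Matrix.one_mul, Matrix.mul_assoc, hRT, Matrix.mul_one, sub_self]
  have hcov := covMat_toEuclideanLin_self (1 - T * R) hw
  rw [hD, ← Matrix.mul_assoc, ← Matrix.mul_assoc, hproj, Matrix.zero_mul, Matrix.zero_mul,
    Matrix.zero_mul] at hcov
  filter_upwards [ae_eq_zero_of_covMat_self_eq_zero (memLp_toEuclideanLin _ hw) hcov] with ω hω
  rw [map_sub, LinearMap.sub_apply, Pi.zero_apply, sub_eq_zero, toEuclideanLin_mul_apply] at hω
  simpa using hω.symm

theorem map_coords_eq_pi_gaussianReal (hwG : IsCenteredGaussian μ w (T * diagonal lam * Tᵀ))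
    (hRT : R * T = 1) :
    μ.map (fun ω => coords R (w ω)) = Measure.pi fun i => gaussianReal 0 (lam i).toNNReal := by
  have hG := hwG.gaussian
  have := hG.isProbabilityMeasure
  have hw := hG.memLp_two
  have hGc : HasGaussianLaw (fun ω => coords R (w ω)) μ :=
    (hG.map_fun (LinearMap.toContinuousLinearMap (toEuclideanLin R))).map_equiv_fun
      (PiLp.continuousLinearEquiv 2 ℝ (fun _ : Fin k => ℝ))
  have hmean : ∀ i, ∫ ω, coords R (w ω) i ∂μ = 0 := fun i => by
    have h := eval_integral_piLp (fun j => ((memLp_toEuclideanLin R hw).integrable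
      one_le_two).eval_piLp j) (i := i)
    rw [integral_toEuclideanLin R (hw.integrable one_le_two), hwG.mean, map_zero] at h
    exact h.symm
  have hcov : ∀ i j, cov[fun ω => coords R (w ω) i, fun ω => coords R (w ω) j; μ]
      = diagonal lam i j := fun i j => by
    rw [covariance_eq_sub (memLp_coords R hw i) (memLp_coords R hw j), hmean i, zero_mul, sub_zero,
      ← integral_coords_mul_coords hw hRT hwG.cov]
    rfl
  have hind := HasGaussianLaw.iIndepFun_of_covariance_eq_zero
    (X := fun i ω => coords R (w ω) i) hGc fun i j hij => by
      rw [hcov, diagonal_apply_ne _ hij]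
  rw [(iIndepFun_iff_map_fun_eq_pi_map fun i => (hGc.eval i).aemeasurable).mp hind]
  congr 1; ext1 i
  rw [(hGc.eval i).map_eq_gaussianReal, hmean i, ← covariance_self (hGc.eval i).aemeasurable,
    hcov i i, diagonal_apply_eq]

end GaussianLaw

section MutualInfo

variable {Ω : Type*} [MeasurableSpace Ω] {μ : Measure Ω} [IsProbabilityMeasure μ]

theorem condMutualInfo_comm {α β γ : Type*} [MeasurableSpace α] [StandardBorelSpace α]
    [Nonempty α] [MeasurableSpace β] [StandardBorelSpace β] [Nonempty β] [MeasurableSpace γ]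
    {A : Ω → α} {B : Ω → β} {C : Ω → γ} (hA : Measurable A) (hB : Measurable B)
    (hC : Measurable C) : condMutualInfo μ A B C = condMutualInfo μ B A C := by
  have hswap : Measurable (Prod.map id Prod.swap : γ × (α × β) → γ × (β × α)) := by fun_prop
  have hjoint : μ.map (fun ω => (C ω, (B ω, A ω)))
      = (μ.map fun ω => (C ω, (A ω, B ω))).map (Prod.map id Prod.swap) := by
    rw [Measure.map_map hswap (by fun_prop)]
    rfl
  have href : (μ.map C) ⊗ₘ (condDistrib B C μ ×ₖ condDistrib A C μ)
      = ((μ.map C) ⊗ₘ (condDistrib A C μ ×ₖ condDistrib B C μ)).map (Prod.map id Prod.swap) := by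
    rw [← Kernel.map_prod_swap, Measure.compProd_map measurable_swap]
  have := Measure.isProbabilityMeasure_map (μ := μ) hC.aemeasurable
  rw [condMutualInfo, condMutualInfo, hjoint, href]
  exact (klDiv_map_of_ae_leftInverse (g := Prod.map id Prod.swap) hswap (by fun_prop)
    (ae_of_all _ fun _ => rfl) (ae_of_all _ fun _ => rfl)).symm

variable {β γ : Type*} [MeasurableSpace β] [StandardBorelSpace β] [Nonempty β] [MeasurableSpace γ]
  {n : ℕ} {S s : Ω → Vec n} {B : Ω → β} {Y : Ω → γ} {F : γ → Vec n}

theorem compProd_condDistrib_eq_map_prod (hB : Measurable B) (hY : Measurable Y)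
    (hs : Measurable s) (hF : Measurable F) (hS : S = fun ω => F (Y ω) + s ω)
    (hind : IndepFun s Y μ) :
    (μ.map Y) ⊗ₘ ((condDistrib S Y μ) ×ₖ (condDistrib B Y μ))
      = ((μ.map fun ω => (Y ω, B ω)).prod (μ.map s)).map
        fun q => (q.1.1, (F q.1.1 + q.2, q.1.2)) := by
  have := Measure.isProbabilityMeasure_map (μ := μ) hs.aemeasurable
  have := Measure.isProbabilityMeasure_map (μ := μ) hY.aemeasurable
  have := isMarkovKernel_shiftKernel (μ.map s) hF
  have hker : ((condDistrib S Y μ) ×ₖ (condDistrib B Y μ) : Kernel γ (Vec n × β)) =ᵐ[μ.map Y]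
      ((shiftKernel (μ.map s) F) ×ₖ (condDistrib B Y μ) : Kernel γ (Vec n × β)) := by
    filter_upwards [condDistrib_ae_eq_shiftKernel hY hF hs hS hind] with y hy
    rw [Kernel.prod_apply, Kernel.prod_apply, hy]
  rw [Measure.compProd_congr hker, ← compProd_map_condDistrib hB.aemeasurable]
  refine Measure.ext_of_lintegral _ fun f hf => ?_
  have hfg : Measurable fun q : (γ × β) × Vec n => f (q.1.1, (F q.1.1 + q.2, q.1.2)) := by
    fun_prop
  rw [lintegral_map hf (by fun_prop), Measure.lintegral_compProd hf,
    lintegral_prod _ hfg.aemeasurable, Measure.lintegral_compProd hfg.lintegral_prod_right']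
  refine lintegral_congr fun y => ?_
  rw [Kernel.prod_apply, lintegral_prod_symm _ (by fun_prop)]
  refine lintegral_congr fun b => ?_
  rw [lintegral_shiftKernel _ hF y (f := fun v => f (y, (v, b))) (by fun_prop)]

theorem condMutualInfo_eq_klDiv_prod (hB : Measurable B) (hY : Measurable Y)
    (hs : Measurable s) (hF : Measurable F) (hS : S = fun ω => F (Y ω) + s ω)
    (hind : IndepFun s Y μ) :
    condMutualInfo μ S B Y = klDiv (μ.map fun ω => ((Y ω, B ω), s ω))
      ((μ.map fun ω => (Y ω, B ω)).prod (μ.map s)) := by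
  have hassemble : Measurable fun q : (γ × β) × Vec n => (q.1.1, (F q.1.1 + q.2, q.1.2)) := by
    fun_prop
  have hjoint : μ.map (fun ω => (Y ω, (S ω, B ω)))
      = (μ.map fun ω => ((Y ω, B ω), s ω)).map fun q => (q.1.1, (F q.1.1 + q.2, q.1.2)) := by
    rw [Measure.map_map hassemble (by fun_prop), hS]
    rfl
  rw [condMutualInfo, compProd_condDistrib_eq_map_prod hB hY hs hF hS hind, hjoint]
  exact klDiv_map_of_ae_leftInverse (g := fun p => ((p.1, p.2.2), p.2.1 - F p.1)) hassemble
    (by fun_prop) (ae_of_all _ fun _ => by simp) (ae_of_all _ fun _ => by simp)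

theorem condMutualInfo_eq_klDiv_coords {k : ℕ} {T : Matrix (Fin n) (Fin k) ℝ}
    {R : Matrix (Fin k) (Fin n) ℝ} (hB : Measurable B) (hY : Measurable Y) (hF : Measurable F)
    (hs : IsCenteredGaussian μ s (T * Tᵀ)) (hRT : R * T = 1) (hS : S = fun ω => F (Y ω) + s ω)
    (hind : IndepFun s Y μ) :
    condMutualInfo μ S B Y = klDiv (μ.map fun ω => ((Y ω, B ω), coords R (s ω)))
      ((μ.map fun ω => (Y ω, B ω)).prod (Measure.pi fun _ : Fin k => gaussianReal 0 1)) := by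
  have hsm := hs.measurable
  have hc := measurable_coords R
  have hT := measurable_toEuclideanLin T
  have hR := measurable_toEuclideanLin R
  have hone : T * Tᵀ = T * diagonal (fun _ : Fin k => (1 : ℝ)) * Tᵀ := by simp
  have hlaw := map_coords_eq_pi_gaussianReal (hone ▸ hs) hRT
  rw [Real.toNNReal_one] at hlaw
  have hrange : ∀ᵐ v ∂(μ.map s), toEuclideanLin T (toEuclideanLin R v) = v :=
    (ae_map_iff hsm.aemeasurable (measurableSet_eq_fun (hT.comp hR) measurable_id)).mpr
      (ae_eq_of_covMat_range hs.gaussian.memLp_two hRT (hs.cov.trans hone))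
  have hmap : Measurable (Prod.map id (coords R) : (γ × β) × Vec n → (γ × β) × (Fin k → ℝ)) := by
    fun_prop
  have := Measure.isProbabilityMeasure_map (μ := μ) hsm.aemeasurable
  have := Measure.isProbabilityMeasure_map (μ := μ) (hY.prodMk hB).aemeasurable
  have hjoint : ∀ᵐ p ∂(μ.map fun ω => ((Y ω, B ω), s ω)),
      toEuclideanLin T (toEuclideanLin R p.2) = p.2 :=
    ae_of_ae_map (μ := μ.map fun ω => ((Y ω, B ω), s ω)) (f := Prod.snd)
      (p := fun v => toEuclideanLin T (toEuclideanLin R v) = v) measurable_snd.aemeasurable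
      (by rwa [Measure.map_map measurable_snd ((hY.prodMk hB).prodMk hsm)])
  have href : ∀ᵐ p ∂((μ.map fun ω => (Y ω, B ω)).prod (μ.map s)),
      toEuclideanLin T (toEuclideanLin R p.2) = p.2 :=
    Measure.quasiMeasurePreserving_snd.ae hrange
  rw [condMutualInfo_eq_klDiv_prod hB hY hsm hF hS hind, ← klDiv_map_of_ae_leftInverse
    (g := Prod.map id fun x => toEuclideanLin T (WithLp.toLp 2 x)) hmap (by fun_prop)
    (hjoint.mono fun p hp => Prod.ext rfl hp) (href.mono fun p hp => Prod.ext rfl hp),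
    Measure.map_map hmap (by fun_prop), ← Measure.map_prod_map _ _ measurable_id hc,
    Measure.map_id, Measure.map_map hc hsm]
  exact congrArg _ (congrArg _ hlaw)

end MutualInfo

section MutualInfoBounds

theorem tendsto_ofReal_half_log_inv_prod {k : ℕ} {lam : Fin k → ℝ} (hlam : ∀ i, 0 ≤ lam i) :
    Tendsto (fun δ : ℝ => ENNReal.ofReal (1 / 2 * Real.log (∏ i, (lam i + δ))⁻¹)) (𝓝[>] 0)
      (𝓝 (diagRate lam)) := by
  have hcont : Tendsto (fun δ : ℝ => ∏ i, (lam i + δ)) (𝓝[>] 0) (𝓝 (∏ i, lam i)) := by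
    have : Continuous fun δ : ℝ => ∏ i, (lam i + δ) := by fun_prop
    simpa using (this.tendsto 0).mono_left (nhdsWithin_le_nhds (s := Set.Ioi 0))
  unfold diagRate
  split_ifs with h0
  · have hpos : Tendsto (fun δ : ℝ => ∏ i, (lam i + δ)) (𝓝[>] 0) (𝓝[>] 0) := by
      refine tendsto_nhdsWithin_iff.mpr ⟨h0 ▸ hcont, ?_⟩
      filter_upwards [self_mem_nhdsWithin] with δ hδ
      exact Finset.prod_pos fun i _ => add_pos_of_nonneg_of_pos (hlam i) hδ
    exact ENNReal.tendsto_ofReal_atTop.comp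
      ((Real.tendsto_log_atTop.comp hpos.inv_tendsto_nhdsGT_zero).const_mul_atTop one_half_pos)
  · rw [one_div (∏ i, lam i)]
    exact ENNReal.tendsto_ofReal
      (((hcont.inv₀ h0).log (inv_ne_zero h0)).const_mul (1 / 2 : ℝ))

theorem diagRate_le_of_forall {k : ℕ} {lam : Fin k → ℝ} (hlam : ∀ i, 0 ≤ lam i) {c : ℝ≥0∞}
    (h : ∀ lam' : Fin k → ℝ, (∀ i, 0 < lam' i) → ENNReal.ofReal
      (∑ i, (-(1 / 2) * Real.log (lam' i) - lam i / (2 * lam' i) + 1 / 2)) ≤ c) :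
    diagRate lam ≤ c := by
  refine le_of_tendsto (tendsto_ofReal_half_log_inv_prod hlam) ?_
  filter_upwards [self_mem_nhdsWithin] with δ (hδ : 0 < δ)
  have hp : ∀ i, 0 < lam i + δ := fun i => by linarith [hlam i]
  refine le_trans (ENNReal.ofReal_le_ofReal ?_) (h _ hp)
  rw [Real.log_inv, Real.log_prod fun i _ => (hp i).ne', mul_neg, Finset.mul_sum,
    ← Finset.sum_neg_distrib]
  refine Finset.sum_le_sum fun i _ => ?_
  have hhalf : lam i / (2 * (lam i + δ)) ≤ 1 / 2 := by
    rw [div_le_div_iff₀ (by linarith [hp i]) two_pos]; linarith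
  linarith

theorem diagRate_eq_ofReal_sum {k : ℕ} {lam : Fin k → ℝ} (hl : ∀ i, 0 < lam i) :
    diagRate lam = ENNReal.ofReal
      (∑ i, (-(1 / 2) * Real.log (lam i) - lam i / (2 * lam i) + 1 / 2)) := by
  rw [diagRate, if_neg (Finset.prod_pos fun i _ => hl i).ne', one_div (∏ i, lam i), Real.log_inv,
    Real.log_prod fun i _ => (hl i).ne', mul_neg, Finset.mul_sum, ← Finset.sum_neg_distrib]
  congr 1
  refine Finset.sum_congr rfl fun i _ => ?_
  have := (hl i).ne'
  field_simp
  ring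

variable {Ω : Type*} [MeasurableSpace Ω] {μ : Measure Ω} [IsProbabilityMeasure μ] {n : ℕ}
  {s : Ω → Vec n} {A D : Matrix (Fin n) (Fin n) ℝ}

theorem integrable_gaussLLR_coords {k : ℕ} {R : Matrix (Fin k) (Fin n) ℝ} {lam : Fin k → ℝ}
    {r : Ω → Vec n} (hs : MemLp s 2 μ) (hr : MemLp r 2 μ) :
    Integrable (fun ω => gaussLLR lam (coords R (r ω)) (coords R (s ω))) μ :=
  integrable_gaussLLR (memLp_coords R hs) fun i => by
    simpa only [coords_sub, Pi.sub_apply] using memLp_coords R (hs.sub hr) i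

theorem IsJointDiagonalization.integral_gaussLLR_coords {k : ℕ} {T : Matrix (Fin n) (Fin k) ℝ}
    {R : Matrix (Fin k) (Fin n) ℝ} {lam lam' : Fin k → ℝ} {r : Ω → Vec n}
    (h : IsJointDiagonalization A D T R lam) (hs : MemLp s 2 μ) (hr : MemLp r 2 μ)
    (hA : covMat μ s s = A) (hD : covMat μ (fun ω => s ω - r ω) (fun ω => s ω - r ω) = D) :
    ∫ ω, gaussLLR lam' (coords R (r ω)) (coords R (s ω)) ∂μ
      = ∑ i, (-(1 / 2) * Real.log (lam' i) - lam i / (2 * lam' i) + 1 / 2) := by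
  have hone : covMat μ s s = T * diagonal (fun _ : Fin k => (1 : ℝ)) * Tᵀ := by
    rw [hA, h.eq_mul_transpose, diagonal_one, Matrix.mul_one]
  have herr : ∀ i, ∫ ω, (coords R (s ω) i - coords R (r ω) i) ^ 2 ∂μ = lam i := by
    simpa only [coords_sub, Pi.sub_apply] using
      integral_coords_sq (hs.sub hr) h.left_inv (hD.trans h.eq_conj)
  rw [integral_gaussLLR (memLp_coords R hs) fun i => by
    simpa only [coords_sub, Pi.sub_apply] using memLp_coords R (hs.sub hr) i]
  simp only [herr, integral_coords_sq hs h.left_inv hone]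

variable {β γ : Type*} [MeasurableSpace β] [StandardBorelSpace β] [Nonempty β] [MeasurableSpace γ]
  {S : Ω → Vec n} {B : Ω → β} {Y : Ω → γ} {F : γ → Vec n} {r : γ × β → Vec n}

-- The log-likelihood ratio of the estimation error against the prior is a test function in the
-- Donsker–Varadhan inequality. It depends on `r` and `D` only through second moments, so the
-- estimate `r (Y, B)` need not be Gaussian.
theorem halfLogDetRatio_le_condMutualInfo (hB : Measurable B) (hY : Measurable Y)
    (hF : Measurable F) (hr : Measurable r) (hs : IsCenteredGaussian μ s A)
    (hS : S = fun ω => F (Y ω) + s ω) (hind : IndepFun s Y μ)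
    (hr2 : MemLp (fun ω => r (Y ω, B ω)) 2 μ)
    (hD : covMat μ (fun ω => s ω - r (Y ω, B ω)) (fun ω => s ω - r (Y ω, B ω)) = D)
    (hAD : (A - D).PosSemidef) : halfLogDetRatio A D ≤ condMutualInfo μ S B Y := by
  have hs2 := hs.gaussian.memLp_two
  have hDpsd : D.PosSemidef := hD ▸ posSemidef_covMat_self (hs2.sub hr2)
  obtain ⟨k, T, R, lam, h⟩ := exists_isJointDiagonalization hDpsd hAD
  rw [h.halfLogDetRatio_eq, condMutualInfo_eq_klDiv_coords hB hY hF (h.eq_mul_transpose ▸ hs)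
    h.left_inv hS hind]
  refine diagRate_le_of_forall h.nonneg fun lam' hl => ?_
  rw [← h.integral_gaussLLR_coords hs2 hr2 hs.cov hD]
  exact ofReal_integral_gaussLLR_le_klDiv (ρ := fun z => coords R (r z)) (hY.prodMk hB)
    ((measurable_coords R).comp hs.measurable) ((measurable_coords R).comp hr) hl
    (integrable_gaussLLR_coords hs2 hr2)

theorem condMutualInfo_eq_halfLogDetRatio {w : Ω → Vec n} (hB : Measurable B) (hY : Measurable Y)
    (hF : Measurable F) (hr : Measurable r) (hs : IsCenteredGaussian μ s A)
    (hS : S = fun ω => F (Y ω) + s ω) (hind : IndepFun s Y μ)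
    (hr2 : MemLp (fun ω => r (Y ω, B ω)) 2 μ) (hw : w = fun ω => s ω - r (Y ω, B ω))
    (hwG : IsCenteredGaussian μ w D) (hindw : IndepFun w (fun ω => (Y ω, B ω)) μ)
    (hAD : (A - D).PosSemidef) : condMutualInfo μ S B Y = halfLogDetRatio A D := by
  have hs2 := hs.gaussian.memLp_two
  have hDpsd : D.PosSemidef := hwG.cov ▸ posSemidef_covMat_self hwG.gaussian.memLp_two
  have hD := hw ▸ hwG.cov
  have hlower := halfLogDetRatio_le_condMutualInfo hB hY hF hr hs hS hind hr2 hD hAD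
  obtain ⟨k, T, R, lam, h⟩ := exists_isJointDiagonalization hDpsd hAD
  rw [h.halfLogDetRatio_eq] at hlower ⊢
  by_cases hprod : ∏ i, lam i = 0
  · rw [diagRate, if_pos hprod] at hlower ⊢
    exact top_le_iff.mp hlower
  have hl : ∀ i, 0 < lam i := fun i => (h.nonneg i).lt_of_ne fun h0 =>
    hprod (Finset.prod_eq_zero (Finset.mem_univ i) h0.symm)
  have hc := measurable_coords R
  have hsplit : ∀ ω, coords R (s ω) = coords R (r (Y ω, B ω)) + coords R (w ω) := fun ω => by
    rw [hw, coords_sub, add_sub_cancel]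
  rw [condMutualInfo_eq_klDiv_coords hB hY hF (h.eq_mul_transpose ▸ hs) h.left_inv hS hind,
    diagRate_eq_ofReal_sum hl, ← h.integral_gaussLLR_coords hs2 hr2 hs.cov hD]
  have hint := integrable_gaussLLR_coords (R := R) (lam := lam) hs2 hr2
  simp only [hsplit] at hint ⊢
  exact klDiv_eq_ofReal_integral_gaussLLR (ρ := fun z => coords R (r z)) (hY.prodMk hB)
    (hc.comp hwG.measurable) (hc.comp hr) hl (hindw.symm.comp measurable_id hc)
    (map_coords_eq_pi_gaussianReal (h.eq_conj ▸ hwG) h.left_inv) hint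

end MutualInfoBounds

/-! ### Linear regression of jointly Gaussian vectors -/

section LinearImage

variable {Ω : Type*}

/-- `U` is a continuous linear image of `V`. All the vectors built from a jointly Gaussian `V` are
of this kind, which makes them centered and jointly Gaussian. -/
def IsLinearImage {E F : Type*} [NormedAddCommGroup E] [NormedSpace ℝ E] [NormedAddCommGroup F]
    [NormedSpace ℝ F] (V : Ω → E) (U : Ω → F) : Prop :=
  ∃ L : E →L[ℝ] F, U = fun ω => L (V ω)

namespace IsLinearImage

variable {E F G : Type*} [NormedAddCommGroup E] [NormedSpace ℝ E] [NormedAddCommGroup F]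
    [NormedSpace ℝ F] [NormedAddCommGroup G] [NormedSpace ℝ G] {V : Ω → E}

theorem refl (V : Ω → E) : IsLinearImage V V := ⟨.id ℝ E, rfl⟩

theorem comp {U : Ω → F} (h : IsLinearImage V U) (L : F →L[ℝ] G) :
    IsLinearImage V fun ω => L (U ω) := by
  obtain ⟨K, rfl⟩ := h
  exact ⟨L ∘L K, rfl⟩

theorem fst {U : Ω → F × G} (h : IsLinearImage V U) : IsLinearImage V fun ω => (U ω).1 :=
  h.comp (.fst ℝ F G)

theorem snd {U : Ω → F × G} (h : IsLinearImage V U) : IsLinearImage V fun ω => (U ω).2 :=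
  h.comp (.snd ℝ F G)

theorem prodMk {U : Ω → F} {U' : Ω → G} (h : IsLinearImage V U) (h' : IsLinearImage V U') :
    IsLinearImage V fun ω => (U ω, U' ω) := by
  obtain ⟨K, rfl⟩ := h
  obtain ⟨K', rfl⟩ := h'
  exact ⟨K.prod K', rfl⟩

theorem add {U U' : Ω → F} (h : IsLinearImage V U) (h' : IsLinearImage V U') :
    IsLinearImage V fun ω => U ω + U' ω :=
  (h.prodMk h').comp (ContinuousLinearMap.fst ℝ F F + ContinuousLinearMap.snd ℝ F F)

theorem sub {U U' : Ω → F} (h : IsLinearImage V U) (h' : IsLinearImage V U') :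
    IsLinearImage V fun ω => U ω - U' ω :=
  (h.prodMk h').comp (ContinuousLinearMap.fst ℝ F F - ContinuousLinearMap.snd ℝ F F)

theorem toEuclideanLin {m n : ℕ} (A : Matrix (Fin m) (Fin n) ℝ) {U : Ω → Vec n}
    (h : IsLinearImage V U) : IsLinearImage V fun ω => Matrix.toEuclideanLin A (U ω) :=
  h.comp (LinearMap.toContinuousLinearMap (Matrix.toEuclideanLin A))

end IsLinearImage

end LinearImage

section JointlyGaussian

variable {Ω E F : Type*} [MeasurableSpace Ω] {μ : Measure Ω}
  [NormedAddCommGroup E] [NormedSpace ℝ E] [MeasurableSpace E] [BorelSpace E]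
  [NormedAddCommGroup F] [NormedSpace ℝ F] [MeasurableSpace F] [BorelSpace F] {V : Ω → E}

/-- `V` is a centered Gaussian random element. With `E` a product of spaces, the components of `V`
are jointly Gaussian. -/
structure IsJointlyGaussian (μ : Measure Ω) (V : Ω → E) : Prop where
  measurable : Measurable V
  gaussian : HasGaussianLaw V μ
  mean : ∫ ω, V ω ∂μ = 0

namespace IsJointlyGaussian

variable [SecondCountableTopology E] [CompleteSpace E]

theorem integrable (hV : IsJointlyGaussian μ V) : Integrable V μ :=
  have := hV.gaussian.isProbabilityMeasure
  hV.gaussian.memLp_two.integrable one_le_two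

variable [CompleteSpace F]

theorem of_isLinearImage (hV : IsJointlyGaussian μ V) {U : Ω → F} (hU : IsLinearImage V U) :
    IsJointlyGaussian μ U := by
  obtain ⟨L, rfl⟩ := hU
  exact ⟨L.measurable.comp hV.measurable, hV.gaussian.map_fun L, by
    rw [L.integral_comp_comm hV.integrable, hV.mean, map_zero]⟩

variable [SecondCountableTopology F]

theorem memLp_two (hV : IsJointlyGaussian μ V) {U : Ω → F} (hU : IsLinearImage V U) :
    MemLp U 2 μ :=
  (hV.of_isLinearImage hU).gaussian.memLp_two

theorem indepFun_of_uncorrelated (hV : IsJointlyGaussian μ V) {n : ℕ} {U : Ω → Vec n} {T : Ω → F}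
    (hU : IsLinearImage V U) (hT : IsLinearImage V T) (h : Uncorrelated μ U T) : IndepFun U T μ :=
  h.indepFun (hV.of_isLinearImage (hU.prodMk hT)).gaussian (hV.of_isLinearImage hU).mean

theorem indepFun_of_covMat_eq_zero (hV : IsJointlyGaussian μ V) {m n : ℕ} {U : Ω → Vec m}
    {T : Ω → Vec n} (hU : IsLinearImage V U) (hT : IsLinearImage V T) (h : covMat μ U T = 0) :
    IndepFun U T μ :=
  hV.indepFun_of_uncorrelated hU hT (.of_covMat (hV.memLp_two hU) (hV.memLp_two hT) h)

theorem indepFun_prodMk_of_covMat_eq_zero (hV : IsJointlyGaussian μ V) {l m n : ℕ} {U : Ω → Vec l}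
    {T : Ω → Vec m} {T' : Ω → Vec n} (hU : IsLinearImage V U) (hT : IsLinearImage V T)
    (hT' : IsLinearImage V T') (h : covMat μ U T = 0) (h' : covMat μ U T' = 0) :
    IndepFun U (fun ω => (T ω, T' ω)) μ :=
  hV.indepFun_of_uncorrelated hU (hT.prodMk hT')
    (.prodMk (hV.memLp_two hU) (hV.memLp_two hT) (hV.memLp_two hT')
      (.of_covMat (hV.memLp_two hU) (hV.memLp_two hT) h)
      (.of_covMat (hV.memLp_two hU) (hV.memLp_two hT') h'))

theorem isCenteredGaussian (hV : IsJointlyGaussian μ V) {n : ℕ} {U : Ω → Vec n}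
    (hU : IsLinearImage V U) : IsCenteredGaussian μ U (covMat μ U U) :=
  ⟨(hV.of_isLinearImage hU).measurable, (hV.of_isLinearImage hU).gaussian,
    (hV.of_isLinearImage hU).mean, rfl⟩

end IsJointlyGaussian

end JointlyGaussian

section Residuals

variable {Ω : Type*} [MeasurableSpace Ω] {μ : Measure Ω} {l m n : ℕ}

theorem pinv_eq_inv {Q : Matrix (Fin n) (Fin n) ℝ} (hQ : IsUnit Q) (hH : Q.IsHermitian) :
    pinv Q = Q⁻¹ := by
  have hdet := (isUnit_iff_isUnit_det Q).mp hQ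
  refine (isPseudoinverse_pinv hH).unique ⟨?_, ?_, ?_, ?_⟩ <;>
    simp [mul_nonsing_inv _ hdet, nonsing_inv_mul _ hdet]

-- The columns of `1 - Q† Q` span the kernel of `Q = covMat μ V V`; these are the directions in
-- which `V` vanishes almost surely, so `covMat μ U V` vanishes on them too.
theorem covMat_mul_pinv_mul {U : Ω → Vec m} {V : Ω → Vec n} (hU : MemLp U 2 μ)
    (hV : MemLp V 2 μ) :
    covMat μ U V * pinv (covMat μ V V) * covMat μ V V = covMat μ U V := by
  set Q := covMat μ V V with hQ
  set N := (1 - pinv Q * Q)ᵀ with hN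
  have hQN : Q * Nᵀ = 0 := by
    rw [hN, transpose_transpose, Matrix.mul_sub, Matrix.mul_one, ← Matrix.mul_assoc,
      (isPseudoinverse_pinv (posSemidef_covMat_self hV).isHermitian).mul_mul_left, sub_self]
  have hNV : (fun ω => toEuclideanLin N (V ω)) =ᵐ[μ] 0 :=
    ae_eq_zero_of_covMat_self_eq_zero (memLp_toEuclideanLin N hV) (by
      rw [covMat_toEuclideanLin_self N hV, Matrix.mul_assoc, ← hQ, hQN, Matrix.mul_zero])
  have hUN : covMat μ U V * Nᵀ = 0 := by
    rw [← covMat_toEuclideanLin_right _ hU hV, covMat_congr (EventuallyEq.refl _ U) hNV]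
    ext i j
    simp [covMat]
  rw [hN, transpose_transpose, Matrix.mul_sub, Matrix.mul_one, sub_eq_zero,
    ← Matrix.mul_assoc] at hUN
  exact hUN.symm

/-- The coefficient matrix `Q_{U,Y} Q_Y†` of the linear regression of `U` on `Y`. The pseudoinverse
makes it meaningful for degenerate `Y`. -/
def regCoef (μ : Measure Ω) (U : Ω → Vec m) (Y : Ω → Vec n) : Matrix (Fin m) (Fin n) ℝ :=
  covMat μ U Y * pinv (covMat μ Y Y)

/-- The residual `U - Q_{U,Y} Q_Y† Y` of the linear regression of `U` on `Y`. -/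
def resid (μ : Measure Ω) (U : Ω → Vec m) (Y : Ω → Vec n) : Ω → Vec m :=
  fun ω => U ω - toEuclideanLin (regCoef μ U Y) (Y ω)

variable {U : Ω → Vec m} {T : Ω → Vec l} {Y : Ω → Vec n}

theorem regCoef_mul_covMat_self (hU : MemLp U 2 μ) (hY : MemLp Y 2 μ) :
    regCoef μ U Y * covMat μ Y Y = covMat μ U Y :=
  covMat_mul_pinv_mul hU hY

theorem eq_add_resid (μ : Measure Ω) (U : Ω → Vec m) (Y : Ω → Vec n) :
    U = fun ω => toEuclideanLin (regCoef μ U Y) (Y ω) + resid μ U Y ω := by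
  funext ω
  rw [resid, add_sub_cancel]

theorem memLp_resid (hU : MemLp U 2 μ) (hY : MemLp Y 2 μ) : MemLp (resid μ U Y) 2 μ :=
  hU.sub (memLp_toEuclideanLin _ hY)

theorem covMat_resid_left (hU : MemLp U 2 μ) (hY : MemLp Y 2 μ) (hT : MemLp T 2 μ) :
    covMat μ (resid μ U Y) T = covMat μ U T - regCoef μ U Y * covMat μ Y T := by
  unfold resid
  rw [covMat_sub_left hU (memLp_toEuclideanLin _ hY) hT, covMat_toEuclideanLin_left _ hY hT]

theorem covMat_resid_left_self (hU : MemLp U 2 μ) (hY : MemLp Y 2 μ) :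
    covMat μ (resid μ U Y) Y = 0 := by
  rw [covMat_resid_left hU hY hY, regCoef_mul_covMat_self hU hY, sub_self]

theorem covMat_resid_right_of_covMat_eq_zero (hT : MemLp T 2 μ) (hU : MemLp U 2 μ)
    (hY : MemLp Y 2 μ) (h : covMat μ T Y = 0) : covMat μ T (resid μ U Y) = covMat μ T U := by
  rw [← covMat_transpose, covMat_resid_left hU hY hT, ← covMat_transpose T Y, h, transpose_zero,
    Matrix.mul_zero, sub_zero, covMat_transpose]

theorem covMat_resid_resid (hU : MemLp U 2 μ) (hT : MemLp T 2 μ) (hY : MemLp Y 2 μ) :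
    covMat μ (resid μ U Y) (resid μ T Y)
      = covMat μ U T - covMat μ U Y * pinv (covMat μ Y Y) * covMat μ Y T := by
  rw [covMat_resid_right_of_covMat_eq_zero (memLp_resid hU hY) hT hY
    (covMat_resid_left_self hU hY), covMat_resid_left hU hY hT, regCoef]

theorem covMat_add_self_of_covMat_eq_zero {T : Ω → Vec m} (hU : MemLp U 2 μ) (hT : MemLp T 2 μ)
    (h : covMat μ U T = 0) :
    covMat μ (fun ω => U ω + T ω) (fun ω => U ω + T ω) = covMat μ U U + covMat μ T T := by
  have hUT : MemLp (fun ω => U ω + T ω) 2 μ := hU.add hT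
  rw [covMat_add_left hU hT hUT, covMat_add_right hU hU hT, covMat_add_right hT hU hT, h,
    ← covMat_transpose U T, h, transpose_zero, add_zero, zero_add]

theorem posSemidef_covMat_sub_covMat_resid (hU : MemLp U 2 μ) (hY : MemLp Y 2 μ) :
    (covMat μ U U - covMat μ (resid μ U Y) (resid μ U Y)).PosSemidef := by
  have hfit := memLp_toEuclideanLin (regCoef μ U Y) hY
  have hcov : covMat μ (fun ω => toEuclideanLin (regCoef μ U Y) (Y ω)) (resid μ U Y) = 0 := by
    rw [covMat_toEuclideanLin_left _ hY (memLp_resid hU hY), ← covMat_transpose,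
      covMat_resid_left_self hU hY, transpose_zero, Matrix.mul_zero]
  have hpyth := covMat_add_self_of_covMat_eq_zero hfit (memLp_resid hU hY) hcov
  rw [← eq_add_resid] at hpyth
  rw [hpyth, add_sub_cancel_right]
  exact posSemidef_covMat_self hfit

theorem IsLinearImage.resid {E : Type*} [NormedAddCommGroup E] [NormedSpace ℝ E] {V : Ω → E}
    (hU : IsLinearImage V U) (hY : IsLinearImage V Y) : IsLinearImage V (resid μ U Y) :=
  hU.sub (hY.toEuclideanLin _)

variable {E : Type*} [NormedAddCommGroup E] [NormedSpace ℝ E] [MeasurableSpace E] [BorelSpace E]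
  [SecondCountableTopology E] [CompleteSpace E] {V : Ω → E}

namespace IsJointlyGaussian

theorem indepFun_resid (hV : IsJointlyGaussian μ V) (hU : IsLinearImage V U)
    (hY : IsLinearImage V Y) : IndepFun (resid μ U Y) Y μ :=
  hV.indepFun_of_covMat_eq_zero (hU.resid hY) hY
    (covMat_resid_left_self (hV.memLp_two hU) (hV.memLp_two hY))

theorem cexp_ae_eq_regression (hV : IsJointlyGaussian μ V)
    (hU : IsLinearImage V U) (hY : IsLinearImage V Y) :
    cexp μ U Y =ᵐ[μ] fun ω => toEuclideanLin (regCoef μ U Y) (Y ω) :=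
  have := hV.gaussian.isProbabilityMeasure
  have hu := hV.of_isLinearImage (hU.resid (μ := μ) hY)
  cexp_ae_eq_of_indepFun (hV.of_isLinearImage hY).measurable (measurable_toEuclideanLin _)
    hu.measurable (EventuallyEq.of_eq (eq_add_resid μ U Y))
    (hV.of_isLinearImage (hY.toEuclideanLin _)).integrable hu.integrable hu.mean
    (hV.indepFun_resid hU hY)

theorem sub_cexp_ae_eq_resid (hV : IsJointlyGaussian μ V)
    (hU : IsLinearImage V U) (hY : IsLinearImage V Y) :
    (fun ω => U ω - cexp μ U Y ω) =ᵐ[μ] resid μ U Y := by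
  filter_upwards [hV.cexp_ae_eq_regression hU hY] with ω hω
  rw [hω, resid]

theorem condCov_eq_covMat_resid (hV : IsJointlyGaussian μ V)
    (hU : IsLinearImage V U) (hT : IsLinearImage V T) (hY : IsLinearImage V Y) :
    condCov μ U T Y = covMat μ (resid μ U Y) (resid μ T Y) :=
  covMat_congr (hV.sub_cexp_ae_eq_resid hU hY) (hV.sub_cexp_ae_eq_resid hT hY)

end IsJointlyGaussian

end Residuals

/-! ### The test channel -/

section NoisySource

variable {Ω : Type*} {nx ns ny : ℕ} {X : Ω → Vec nx} {S : Ω → Vec ns} {Y : Ω → Vec ny}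

theorem isLinearImage_fst_prod (X : Ω → Vec nx) (S : Ω → Vec ns) (Y : Ω → Vec ny) :
    IsLinearImage (fun ω => (X ω, S ω, Y ω)) X :=
  (IsLinearImage.refl _).fst

theorem isLinearImage_snd_prod (X : Ω → Vec nx) (S : Ω → Vec ns) (Y : Ω → Vec ny) :
    IsLinearImage (fun ω => (X ω, S ω, Y ω)) S :=
  (IsLinearImage.refl _).snd.fst

theorem isLinearImage_trd_prod (X : Ω → Vec nx) (S : Ω → Vec ns) (Y : Ω → Vec ny) :
    IsLinearImage (fun ω => (X ω, S ω, Y ω)) Y :=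
  (IsLinearImage.refl _).snd.snd

/-- The Gaussian vector generating all the random vectors of a test channel. -/
abbrev noisySource (X : Ω → Vec nx) (S : Ω → Vec ns) (Y : Ω → Vec ny) (W : Ω → Vec nx) :
    Ω → Vec nx × Vec nx × Vec ns × Vec ny :=
  fun ω => (W ω, X ω, S ω, Y ω)

theorem isLinearImage_noise (X : Ω → Vec nx) (S : Ω → Vec ns) (Y : Ω → Vec ny) (W : Ω → Vec nx) :
    IsLinearImage (noisySource X S Y W) W :=
  (IsLinearImage.refl _).fst

theorem IsLinearImage.noisySource {n : ℕ} {U : Ω → Vec n}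
    (hU : IsLinearImage (fun ω => (X ω, S ω, Y ω)) U) (W : Ω → Vec nx) :
    IsLinearImage (RemoteRDF.noisySource X S Y W) U := by
  obtain ⟨L, rfl⟩ := hU
  exact (IsLinearImage.refl _).snd.comp L

end NoisySource

section GaussianSource

variable {Ω : Type*} [MeasurableSpace Ω] {μ : Measure Ω} {nx ns ny : ℕ}
  {X : Ω → Vec nx} {S : Ω → Vec ns} {Y : Ω → Vec ny}

/-- `(X, S, Y)` is a centered jointly Gaussian triple with invertible `Q_Y`. -/
structure IsGaussianSource (μ : Measure Ω) (X : Ω → Vec nx) (S : Ω → Vec ns) (Y : Ω → Vec ny) :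
    Prop where
  joint : IsJointlyGaussian μ fun ω => (X ω, S ω, Y ω)
  isUnit : IsUnit (covMat μ Y Y)

theorem regCoef_eq_of_isUnit {m n : ℕ} {Y : Ω → Vec n} (hY : MemLp Y 2 μ)
    (hQ : IsUnit (covMat μ Y Y)) (U : Ω → Vec m) :
    regCoef μ U Y = covMat μ U Y * (covMat μ Y Y)⁻¹ := by
  rw [regCoef, pinv_eq_inv hQ (posSemidef_covMat_self hY).isHermitian]

theorem regCoef_eq_of_covMat_eq_zero {m n : ℕ} {U z : Ω → Vec m} {Y : Ω → Vec n}
    (hY : MemLp Y 2 μ) (hQ : IsUnit (covMat μ Y Y)) (hz : MemLp z 2 μ) (h : covMat μ z Y = 0)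
    {A : Matrix (Fin m) (Fin n) ℝ} (hU : U = fun ω => toEuclideanLin A (Y ω) + z ω) :
    regCoef μ U Y = A := by
  rw [regCoef_eq_of_isUnit hY hQ, hU, covMat_add_left (memLp_toEuclideanLin A hY) hz hY, h,
    covMat_toEuclideanLin_left A hY hY, add_zero, Matrix.mul_assoc,
    mul_nonsing_inv _ ((isUnit_iff_isUnit_det _).mp hQ), Matrix.mul_one]

/-- The error `X - E(X|S,Y)` of the regression of `X` on `(S, Y)`, computed by regressing first on
`Y` and then on the residual of `S`. -/
def regressionError (μ : Measure Ω) (X : Ω → Vec nx) (S : Ω → Vec ns) (Y : Ω → Vec ny) :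
    Ω → Vec nx :=
  resid μ (resid μ X Y) (resid μ S Y)

theorem isLinearImage_regressionError (μ : Measure Ω) (X : Ω → Vec nx) (S : Ω → Vec ns)
    (Y : Ω → Vec ny) : IsLinearImage (fun ω => (X ω, S ω, Y ω)) (regressionError μ X S Y) :=
  ((isLinearImage_fst_prod X S Y).resid (isLinearImage_trd_prod X S Y)).resid
    ((isLinearImage_snd_prod X S Y).resid (isLinearImage_trd_prod X S Y))

theorem lintegral_enorm_sq_eq_trace {n : ℕ} {U : Ω → Vec n} (hU : MemLp U 2 μ) :
    ∫⁻ ω, ‖U ω‖ₑ ^ 2 ∂μ = ENNReal.ofReal (covMat μ U U).trace := by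
  rw [trace_covMat_self hU, ofReal_integral_eq_lintegral_ofReal
    ((memLp_two_iff_integrable_sq_norm hU.1).mp hU) (ae_of_all _ fun ω => sq_nonneg _)]
  refine lintegral_congr fun ω => ?_
  rw [ENNReal.ofReal_pow (norm_nonneg _), ofReal_norm]

theorem covMat_resid_eq_postCovS {s : Ω → Vec ns} {z : Ω → Vec nx} (hs : MemLp s 2 μ)
    (hz : MemLp z 2 μ) {QX Sig : Matrix (Fin nx) (Fin nx) ℝ} {H : Matrix (Fin nx) (Fin ns) ℝ}
    (hsz : covMat μ s z = covMat μ s s * Hᵀ) (hzz : covMat μ z z = QX - Sig) :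
    covMat μ (resid μ s z) (resid μ s z) = postCovS QX (covMat μ s s) Sig H := by
  rw [covMat_resid_resid hs hs hz, hzz, ← covMat_transpose s z, hsz, transpose_mul,
    covMat_transpose, transpose_transpose, postCovS, Matrix.mul_assoc _ H]

namespace IsGaussianSource

variable (h : IsGaussianSource μ X S Y)
include h

theorem memLp_fst : MemLp X 2 μ :=
  h.joint.memLp_two (isLinearImage_fst_prod X S Y)

theorem memLp_snd : MemLp S 2 μ :=
  h.joint.memLp_two (isLinearImage_snd_prod X S Y)

theorem memLp_trd : MemLp Y 2 μ :=
  h.joint.memLp_two (isLinearImage_trd_prod X S Y)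

theorem measurable_fst : Measurable X :=
  h.joint.measurable.fst

theorem measurable_snd : Measurable S :=
  h.joint.measurable.snd.fst

theorem measurable_trd : Measurable Y :=
  h.joint.measurable.snd.snd

theorem condCov_fst_fst : condCov μ X X Y = covMat μ (resid μ X Y) (resid μ X Y) :=
  h.joint.condCov_eq_covMat_resid (isLinearImage_fst_prod X S Y) (isLinearImage_fst_prod X S Y)
    (isLinearImage_trd_prod X S Y)

theorem condCov_fst_snd : condCov μ X S Y = covMat μ (resid μ X Y) (resid μ S Y) :=
  h.joint.condCov_eq_covMat_resid (isLinearImage_fst_prod X S Y) (isLinearImage_snd_prod X S Y)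
    (isLinearImage_trd_prod X S Y)

theorem condCov_snd_snd : condCov μ S S Y = covMat μ (resid μ S Y) (resid μ S Y) :=
  h.joint.condCov_eq_covMat_resid (isLinearImage_snd_prod X S Y) (isLinearImage_snd_prod X S Y)
    (isLinearImage_trd_prod X S Y)

theorem cexp_fst : cexp μ X Y =ᵐ[μ] fun ω => toEuclideanLin (regCoef μ X Y) (Y ω) :=
  h.joint.cexp_ae_eq_regression (isLinearImage_fst_prod X S Y) (isLinearImage_trd_prod X S Y)

theorem cexp_snd : cexp μ S Y =ᵐ[μ] fun ω => toEuclideanLin (regCoef μ S Y) (Y ω) :=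
  h.joint.cexp_ae_eq_regression (isLinearImage_snd_prod X S Y) (isLinearImage_trd_prod X S Y)

theorem isCenteredGaussian_resid_snd : IsCenteredGaussian μ (resid μ S Y) (condCov μ S S Y) :=
  h.condCov_snd_snd ▸ h.joint.isCenteredGaussian
    ((isLinearImage_snd_prod X S Y).resid (isLinearImage_trd_prod X S Y))

theorem memLp_resid_fst : MemLp (resid μ X Y) 2 μ :=
  memLp_resid h.memLp_fst h.memLp_trd

theorem memLp_resid_snd : MemLp (resid μ S Y) 2 μ :=
  memLp_resid h.memLp_snd h.memLp_trd

theorem condCov_fst_snd_eq_sub :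
    condCov μ X S Y = covMat μ X S - covMat μ X Y * (covMat μ Y Y)⁻¹ * covMat μ Y S := by
  rw [h.condCov_fst_snd, covMat_resid_resid h.memLp_fst h.memLp_snd h.memLp_trd,
    pinv_eq_inv h.isUnit (posSemidef_covMat_self h.memLp_trd).isHermitian]

theorem posSemidef_condCov_fst : (condCov μ X X Y).PosSemidef :=
  h.condCov_fst_fst ▸ posSemidef_covMat_self h.memLp_resid_fst

theorem posSemidef_condCov_snd : (condCov μ S S Y).PosSemidef :=
  h.condCov_snd_snd ▸ posSemidef_covMat_self h.memLp_resid_snd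

theorem isCenteredGaussian_regressionError : IsCenteredGaussian μ (regressionError μ X S Y)
    (covMat μ (regressionError μ X S Y) (regressionError μ X S Y)) :=
  h.joint.isCenteredGaussian (isLinearImage_regressionError μ X S Y)

theorem memLp_regressionError : MemLp (regressionError μ X S Y) 2 μ :=
  h.joint.memLp_two (isLinearImage_regressionError μ X S Y)

theorem covMat_regressionError_resid_snd :
    covMat μ (regressionError μ X S Y) (resid μ S Y) = 0 :=
  covMat_resid_left_self h.memLp_resid_fst h.memLp_resid_snd

theorem covMat_regressionError_trd : covMat μ (regressionError μ X S Y) Y = 0 := by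
  rw [regressionError, covMat_resid_left h.memLp_resid_fst h.memLp_resid_snd h.memLp_trd,
    covMat_resid_left_self h.memLp_fst h.memLp_trd,
    covMat_resid_left_self h.memLp_snd h.memLp_trd, Matrix.mul_zero, sub_zero]

theorem covMat_regressionError_snd : covMat μ (regressionError μ X S Y) S = 0 := by
  rw [← covMat_resid_right_of_covMat_eq_zero h.memLp_regressionError h.memLp_snd h.memLp_trd
    h.covMat_regressionError_trd, h.covMat_regressionError_resid_snd]

theorem uncorrelated_regressionError :
    Uncorrelated μ (regressionError μ X S Y) fun ω => (S ω, Y ω) :=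
  .prodMk h.memLp_regressionError h.memLp_snd h.memLp_trd
    (.of_covMat h.memLp_regressionError h.memLp_snd h.covMat_regressionError_snd)
    (.of_covMat h.memLp_regressionError h.memLp_trd h.covMat_regressionError_trd)

end IsGaussianSource

end GaussianSource

theorem IsFeasible.mul_mul_transpose_add_noise {nx ns : ℕ} {QX Sig QW : Matrix (Fin nx) (Fin nx) ℝ}
    {QXS H : Matrix (Fin nx) (Fin ns) ℝ} {QS : Matrix (Fin ns) (Fin ns) ℝ}
    (hf : IsFeasible QX QXS QS Sig H QW) : H * QS * Hᵀ + QW = QX - Sig := by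
  rw [hf.noise, add_sub_cancel, hf.gain]

section TestChannel

variable {Ω : Type*} [MeasurableSpace Ω] {μ : Measure Ω} {nx ns ny : ℕ}
  {X : Ω → Vec nx} {S : Ω → Vec ns} {Y : Ω → Vec ny} {Sig QW : Matrix (Fin nx) (Fin nx) ℝ}
  {H : Matrix (Fin nx) (Fin ns) ℝ} {W : Ω → Vec nx}

/-- The data of a test channel: a Gaussian source, feasible parameters `(Σ, H, Q_W)`, and a
Gaussian noise `W` of covariance `Q_W` independent of the source. -/
structure IsTestChannel (μ : Measure Ω) (X : Ω → Vec nx) (S : Ω → Vec ns) (Y : Ω → Vec ny)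
    (Sig : Matrix (Fin nx) (Fin nx) ℝ) (H : Matrix (Fin nx) (Fin ns) ℝ)
    (QW : Matrix (Fin nx) (Fin nx) ℝ) (W : Ω → Vec nx) : Prop where
  source : IsGaussianSource μ X S Y
  feasible : IsFeasible (condCov μ X X Y) (condCov μ X S Y) (condCov μ S S Y) Sig H QW
  noise : IsCenteredGaussian μ W QW
  indep : IndepFun W (fun ω => (X ω, S ω, Y ω)) μ

/-- The part `H (S - E(S|Y)) + W` of the realization which is uncorrelated with `Y`. -/
def innovation (μ : Measure Ω) (S : Ω → Vec ns) (Y : Ω → Vec ny) (H : Matrix (Fin nx) (Fin ns) ℝ)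
    (W : Ω → Vec nx) : Ω → Vec nx :=
  fun ω => toEuclideanLin H (resid μ S Y ω) + W ω

theorem isLinearImage_innovation (μ : Measure Ω) (X : Ω → Vec nx) (S : Ω → Vec ns) (Y : Ω → Vec ny)
    (H : Matrix (Fin nx) (Fin ns) ℝ) (W : Ω → Vec nx) :
    IsLinearImage (noisySource X S Y W) (innovation μ S Y H W) :=
  ((((isLinearImage_snd_prod X S Y).resid (isLinearImage_trd_prod X S Y)).noisySource
    W).toEuclideanLin H).add (isLinearImage_noise X S Y W)

theorem isLinearImage_realization (μ : Measure Ω) (X : Ω → Vec nx) (S : Ω → Vec ns) (Y : Ω → Vec ny)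
    (H : Matrix (Fin nx) (Fin ns) ℝ) (W : Ω → Vec nx) :
    IsLinearImage (noisySource X S Y W) (realization μ X S Y H W) :=
  ((((isLinearImage_snd_prod X S Y).noisySource W).toEuclideanLin H).add
    (((isLinearImage_trd_prod X S Y).noisySource W).toEuclideanLin _)).add
    (isLinearImage_noise X S Y W)

theorem isLinearImage_error (μ : Measure Ω) (X : Ω → Vec nx) (S : Ω → Vec ns) (Y : Ω → Vec ny)
    (H : Matrix (Fin nx) (Fin ns) ℝ) (W : Ω → Vec nx) :
    IsLinearImage (noisySource X S Y W) fun ω => X ω - realization μ X S Y H W ω :=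
  ((isLinearImage_fst_prod X S Y).noisySource W).sub (isLinearImage_realization μ X S Y H W)

theorem isLinearImage_posterior (μ : Measure Ω) (X : Ω → Vec nx) (S : Ω → Vec ns) (Y : Ω → Vec ny)
    (H : Matrix (Fin nx) (Fin ns) ℝ) (W : Ω → Vec nx) :
    IsLinearImage (noisySource X S Y W) (resid μ (resid μ S Y) (innovation μ S Y H W)) :=
  (((isLinearImage_snd_prod X S Y).resid (isLinearImage_trd_prod X S Y)).noisySource W).resid
    (isLinearImage_innovation μ X S Y H W)

namespace IsTestChannel

variable (h : IsTestChannel μ X S Y Sig H QW W)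
include h

theorem joint : IsJointlyGaussian μ (noisySource X S Y W) where
  measurable := h.noise.measurable.prodMk h.source.joint.measurable
  gaussian := h.indep.hasGaussianLaw h.noise.gaussian h.source.joint.gaussian
  mean := by
    have := h.noise.gaussian.isProbabilityMeasure
    rw [integral_pair (h.noise.gaussian.memLp_two.integrable one_le_two) h.source.joint.integrable,
      h.noise.mean, h.source.joint.mean, Prod.mk_zero_zero]

theorem memLp_noise : MemLp W 2 μ :=
  h.noise.gaussian.memLp_two

theorem memLp_innovation : MemLp (innovation μ S Y H W) 2 μ :=
  h.joint.memLp_two (isLinearImage_innovation μ X S Y H W)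

theorem memLp_realization : MemLp (realization μ X S Y H W) 2 μ :=
  h.joint.memLp_two (isLinearImage_realization μ X S Y H W)

theorem measurable_realization : Measurable (realization μ X S Y H W) :=
  (h.joint.of_isLinearImage (isLinearImage_realization μ X S Y H W)).measurable

theorem covMat_noise_right {n : ℕ} {U : Ω → Vec n}
    (hU : IsLinearImage (fun ω => (X ω, S ω, Y ω)) U) : covMat μ U W = 0 := by
  have := h.noise.gaussian.isProbabilityMeasure
  have hind : IndepFun U W μ := by
    obtain ⟨L, rfl⟩ := hU
    exact (h.indep.comp measurable_id L.measurable).symm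
  exact covMat_eq_zero_of_indepFun (h.source.joint.of_isLinearImage hU).integrable
    (h.memLp_noise.integrable one_le_two) hind h.noise.mean

theorem covMat_innovation_right {n : ℕ} {U : Ω → Vec n} (hU : MemLp U 2 μ) :
    covMat μ U (innovation μ S Y H W) = covMat μ U (resid μ S Y) * Hᵀ + covMat μ U W := by
  have hs := h.source.memLp_resid_snd
  unfold innovation
  rw [covMat_add_right hU (memLp_toEuclideanLin H hs) h.memLp_noise,
    covMat_toEuclideanLin_right H hU hs]

theorem covMat_innovation_right_of_isLinearImage {n : ℕ} {U : Ω → Vec n}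
    (hU : IsLinearImage (fun ω => (X ω, S ω, Y ω)) U) :
    covMat μ U (innovation μ S Y H W) = covMat μ U (resid μ S Y) * Hᵀ := by
  rw [h.covMat_innovation_right (h.source.joint.memLp_two hU), h.covMat_noise_right hU, add_zero]

theorem covMat_innovation_side : covMat μ (innovation μ S Y H W) Y = 0 := by
  rw [← covMat_transpose, h.covMat_innovation_right_of_isLinearImage (isLinearImage_trd_prod X S Y),
    ← covMat_transpose (resid μ S Y), covMat_resid_left_self h.source.memLp_snd h.source.memLp_trd,
    transpose_zero, Matrix.zero_mul, transpose_zero]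

theorem covMat_resid_fst_innovation :
    covMat μ (resid μ X Y) (innovation μ S Y H W) = condCov μ X S Y * Hᵀ := by
  rw [h.covMat_innovation_right_of_isLinearImage
    ((isLinearImage_fst_prod X S Y).resid (isLinearImage_trd_prod X S Y)), h.source.condCov_fst_snd]

theorem covMat_resid_snd_innovation :
    covMat μ (resid μ S Y) (innovation μ S Y H W) = condCov μ S S Y * Hᵀ := by
  rw [h.covMat_innovation_right_of_isLinearImage
    ((isLinearImage_snd_prod X S Y).resid (isLinearImage_trd_prod X S Y)), h.source.condCov_snd_snd]

theorem covMat_innovation_self :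
    covMat μ (innovation μ S Y H W) (innovation μ S Y H W) = H * condCov μ S S Y * Hᵀ + QW := by
  have hs := h.source.memLp_resid_snd
  have hcov : covMat μ (fun ω => toEuclideanLin H (resid μ S Y ω)) W = 0 :=
    h.covMat_noise_right
      (((isLinearImage_snd_prod X S Y).resid (isLinearImage_trd_prod X S Y)).toEuclideanLin H)
  rw [h.source.condCov_snd_snd, ← covMat_toEuclideanLin_self H hs, ← h.noise.cov]
  exact covMat_add_self_of_covMat_eq_zero (memLp_toEuclideanLin H hs) h.memLp_noise hcov

theorem covMat_innovation_self_eq_sub :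
    covMat μ (innovation μ S Y H W) (innovation μ S Y H W) = condCov μ X X Y - Sig := by
  rw [h.covMat_innovation_self, h.feasible.mul_mul_transpose_add_noise]

theorem realization_eq_add_innovation : realization μ X S Y H W
    = fun ω => toEuclideanLin (regCoef μ X Y) (Y ω) + innovation μ S Y H W ω := by
  have hcoef : (covMat μ X Y - H * covMat μ S Y) * (covMat μ Y Y)⁻¹
      = regCoef μ X Y - H * regCoef μ S Y := by
    rw [regCoef_eq_of_isUnit h.source.memLp_trd h.source.isUnit,
      regCoef_eq_of_isUnit h.source.memLp_trd h.source.isUnit, Matrix.sub_mul, Matrix.mul_assoc]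
  funext ω
  simp only [realization, hcoef, innovation, resid, map_sub, LinearMap.sub_apply,
    toEuclideanLin_mul_apply]
  abel

theorem realization_sub (ω : Ω) : realization μ X S Y H W ω - toEuclideanLin (regCoef μ X Y) (Y ω)
    = innovation μ S Y H W ω := by
  rw [h.realization_eq_add_innovation, add_sub_cancel_left]

theorem regCoef_realization : regCoef μ (realization μ X S Y H W) Y = regCoef μ X Y :=
  regCoef_eq_of_covMat_eq_zero h.source.memLp_trd h.source.isUnit h.memLp_innovation
    h.covMat_innovation_side h.realization_eq_add_innovation

theorem resid_realization : resid μ (realization μ X S Y H W) Y = innovation μ S Y H W := by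
  funext ω
  rw [resid, h.regCoef_realization, h.realization_sub]

theorem sub_realization_eq : (fun ω => X ω - realization μ X S Y H W ω)
    = fun ω => resid μ X Y ω - innovation μ S Y H W ω := by
  rw [h.realization_eq_add_innovation]
  funext ω
  rw [resid, sub_sub]

theorem covMat_realization_right {n : ℕ} {U : Ω → Vec n} (hU : MemLp U 2 μ)
    (hUY : covMat μ U Y = 0) :
    covMat μ U (realization μ X S Y H W) = covMat μ U (innovation μ S Y H W) := by
  rw [← h.resid_realization, covMat_resid_right_of_covMat_eq_zero hU h.memLp_realization
    h.source.memLp_trd hUY]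

theorem indepFun_realization_side {n : ℕ} {u : Ω → Vec n}
    (hu : IsLinearImage (noisySource X S Y W) u) (huY : covMat μ u Y = 0)
    (huz : covMat μ u (innovation μ S Y H W) = 0) :
    IndepFun u (fun ω => (realization μ X S Y H W ω, Y ω)) μ :=
  h.joint.indepFun_prodMk_of_covMat_eq_zero hu (isLinearImage_realization μ X S Y H W)
    ((isLinearImage_trd_prod X S Y).noisySource W)
    ((h.covMat_realization_right (h.joint.memLp_two hu) huY).trans huz) huY

theorem covMat_error_innovation :
    covMat μ (fun ω => X ω - realization μ X S Y H W ω) (innovation μ S Y H W) = 0 := by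
  rw [h.sub_realization_eq, covMat_sub_left h.source.memLp_resid_fst h.memLp_innovation
    h.memLp_innovation, h.covMat_resid_fst_innovation, h.covMat_innovation_self_eq_sub,
    ← h.feasible.gain_symm, h.feasible.gain, sub_self]

theorem covMat_error_side : covMat μ (fun ω => X ω - realization μ X S Y H W ω) Y = 0 := by
  rw [h.sub_realization_eq, covMat_sub_left h.source.memLp_resid_fst h.memLp_innovation
    h.source.memLp_trd, covMat_resid_left_self h.source.memLp_fst h.source.memLp_trd,
    h.covMat_innovation_side, sub_zero]

theorem indepFun_error : IndepFun (fun ω => X ω - realization μ X S Y H W ω)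
    (fun ω => (realization μ X S Y H W ω, Y ω)) μ :=
  h.indepFun_realization_side (isLinearImage_error μ X S Y H W) h.covMat_error_side
    h.covMat_error_innovation

theorem error_cov : covMat μ (fun ω => X ω - realization μ X S Y H W ω)
    (fun ω => X ω - realization μ X S Y H W ω) = Sig := by
  have hsum : resid μ X Y
      = fun ω => (X ω - realization μ X S Y H W ω) + innovation μ S Y H W ω := by
    funext ω
    rw [congrFun h.sub_realization_eq ω, sub_add_cancel]
  have hpyth := covMat_add_self_of_covMat_eq_zero
    (h.joint.memLp_two (isLinearImage_error μ X S Y H W)) h.memLp_innovation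
    h.covMat_error_innovation
  rw [← hsum, ← h.source.condCov_fst_fst, h.covMat_innovation_self_eq_sub] at hpyth
  rw [← add_right_cancel_iff, ← hpyth, add_sub_cancel]

theorem isCenteredGaussian_error :
    IsCenteredGaussian μ (fun ω => X ω - realization μ X S Y H W ω) Sig := by
  simpa only [h.error_cov] using h.joint.isCenteredGaussian (isLinearImage_error μ X S Y H W)

theorem lintegral_enorm_error_sq :
    ∫⁻ ω, ‖X ω - realization μ X S Y H W ω‖ₑ ^ 2 ∂μ = ENNReal.ofReal Sig.trace := by
  rw [lintegral_enorm_sq_eq_trace (h.joint.memLp_two (isLinearImage_error μ X S Y H W)),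
    h.error_cov]

theorem eq_cexp : realization μ X S Y H W =ᵐ[μ] fun ω => toEuclideanLin H (S ω) + cexp μ X Y ω
    - toEuclideanLin H (cexp μ S Y ω) + W ω := by
  filter_upwards [h.source.cexp_fst, h.source.cexp_snd] with ω hX hS
  rw [hX, hS, h.realization_eq_add_innovation]
  simp only [innovation, resid, map_sub]
  abel

theorem cexp_side : cexp μ X Y =ᵐ[μ] cexp μ (realization μ X S Y H W) Y := by
  have hcexp := h.joint.cexp_ae_eq_regression (isLinearImage_realization μ X S Y H W)
    ((isLinearImage_trd_prod X S Y).noisySource W)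
  rw [h.regCoef_realization] at hcexp
  exact h.source.cexp_fst.trans hcexp.symm

theorem condCov_realization : condCov μ (realization μ X S Y H W) (realization μ X S Y H W) Y
    = covMat μ (innovation μ S Y H W) (innovation μ S Y H W) := by
  rw [h.joint.condCov_eq_covMat_resid (isLinearImage_realization μ X S Y H W)
    (isLinearImage_realization μ X S Y H W) ((isLinearImage_trd_prod X S Y).noisySource W),
    h.resid_realization]

theorem reproduction_cov : condCov μ (realization μ X S Y H W) (realization μ X S Y H W) Y
    = H * condCov μ S S Y * Hᵀ + QW :=
  h.condCov_realization.trans h.covMat_innovation_self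

theorem reproduction_cov_eq_sub :
    condCov μ (realization μ X S Y H W) (realization μ X S Y H W) Y = condCov μ X X Y - Sig :=
  h.condCov_realization.trans h.covMat_innovation_self_eq_sub

theorem cexp_pair :
    cexp μ X (fun ω => (realization μ X S Y H W ω, Y ω)) =ᵐ[μ] realization μ X S Y H W :=
  have := h.noise.gaussian.isProbabilityMeasure
  have he := h.isCenteredGaussian_error
  cexp_ae_eq_of_indepFun (M := Prod.fst) (h.measurable_realization.prodMk h.source.measurable_trd)
    measurable_fst he.measurable (ae_of_all _ fun _ => (add_sub_cancel _ _).symm)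
    (h.memLp_realization.integrable one_le_two) (he.gaussian.memLp_two.integrable one_le_two)
    he.mean h.indepFun_error

theorem cexp_self : cexp μ X (realization μ X S Y H W) =ᵐ[μ] realization μ X S Y H W :=
  have := h.noise.gaussian.isProbabilityMeasure
  have he := h.isCenteredGaussian_error
  cexp_ae_eq_of_indepFun (M := id) h.measurable_realization
    measurable_id he.measurable (ae_of_all _ fun _ => (add_sub_cancel _ _).symm)
    (h.memLp_realization.integrable one_le_two) (he.gaussian.memLp_two.integrable one_le_two)
    he.mean (h.indepFun_error.comp measurable_id measurable_fst)

-- The posterior error of `S` given `(Xhat, Y)` is the residual of the regression of `resid μ S Y`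
-- on the innovation.
theorem covMat_posterior_side :
    covMat μ (resid μ (resid μ S Y) (innovation μ S Y H W)) Y = 0 := by
  rw [covMat_resid_left h.source.memLp_resid_snd h.memLp_innovation h.source.memLp_trd,
    covMat_resid_left_self h.source.memLp_snd h.source.memLp_trd, h.covMat_innovation_side,
    Matrix.mul_zero, sub_zero]

theorem covMat_posterior :
    covMat μ (resid μ (resid μ S Y) (innovation μ S Y H W))
        (resid μ (resid μ S Y) (innovation μ S Y H W))
      = postCovS (condCov μ X X Y) (condCov μ S S Y) Sig H := by
  have hsz := h.covMat_resid_snd_innovation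
  rw [h.source.condCov_snd_snd] at hsz ⊢
  exact covMat_resid_eq_postCovS h.source.memLp_resid_snd h.memLp_innovation hsz
    h.covMat_innovation_self_eq_sub

theorem isCenteredGaussian_posterior :
    IsCenteredGaussian μ (resid μ (resid μ S Y) (innovation μ S Y H W))
      (postCovS (condCov μ X X Y) (condCov μ S S Y) Sig H) :=
  h.covMat_posterior ▸ h.joint.isCenteredGaussian (isLinearImage_posterior μ X S Y H W)

theorem indepFun_posterior : IndepFun (resid μ (resid μ S Y) (innovation μ S Y H W))
    (fun ω => (realization μ X S Y H W ω, Y ω)) μ :=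
  h.indepFun_realization_side (isLinearImage_posterior μ X S Y H W) h.covMat_posterior_side
    (covMat_resid_left_self h.source.memLp_resid_snd h.memLp_innovation)

theorem postCov_psd : (postCovS (condCov μ X X Y) (condCov μ S S Y) Sig H).PosSemidef :=
  h.covMat_posterior ▸
    posSemidef_covMat_self (memLp_resid h.source.memLp_resid_snd h.memLp_innovation)

theorem sub_postCov_psd :
    (condCov μ S S Y - postCovS (condCov μ X X Y) (condCov μ S S Y) Sig H).PosSemidef := by
  rw [← h.covMat_posterior, h.source.condCov_snd_snd]
  exact posSemidef_covMat_sub_covMat_resid h.source.memLp_resid_snd h.memLp_innovation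

theorem snd_eq_add_posterior : S = fun ω => toEuclideanLin (regCoef μ S Y) (Y ω)
    + toEuclideanLin (regCoef μ (resid μ S Y) (innovation μ S Y H W))
      (realization μ X S Y H W ω - toEuclideanLin (regCoef μ X Y) (Y ω))
    + resid μ (resid μ S Y) (innovation μ S Y H W) ω := by
  funext ω
  rw [h.realization_sub, add_assoc, resid.eq_1 μ (resid μ S Y), add_sub_cancel, resid,
    add_sub_cancel]

theorem postCov : condCov μ S S (fun ω => (realization μ X S Y H W ω, Y ω))
    = postCovS (condCov μ X X Y) (condCov μ S S Y) Sig H := by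
  have := h.noise.gaussian.isProbabilityMeasure
  have hv := h.isCenteredGaussian_posterior
  have hcexp := cexp_ae_eq_of_indepFun (U := S) (M := fun p : Vec nx × Vec ny =>
      toEuclideanLin (regCoef μ S Y) p.2
        + toEuclideanLin (regCoef μ (resid μ S Y) (innovation μ S Y H W))
          (p.1 - toEuclideanLin (regCoef μ X Y) p.2))
    (h.measurable_realization.prodMk h.source.measurable_trd) (by fun_prop) hv.measurable
    (EventuallyEq.of_eq h.snd_eq_add_posterior)
    (by
      simp only [h.realization_sub]
      exact ((memLp_toEuclideanLin _ h.source.memLp_trd).add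
        (memLp_toEuclideanLin _ h.memLp_innovation)).integrable one_le_two)
    (hv.gaussian.memLp_two.integrable one_le_two) hv.mean h.indepFun_posterior
  have herr : (fun ω => S ω - cexp μ S (fun ω => (realization μ X S Y H W ω, Y ω)) ω)
      =ᵐ[μ] resid μ (resid μ S Y) (innovation μ S Y H W) := by
    filter_upwards [hcexp] with ω hω
    rw [hω, sub_eq_iff_eq_add']
    exact congrFun h.snd_eq_add_posterior ω
  exact (covMat_congr herr herr).trans h.covMat_posterior

theorem indepFun_regressionError : IndepFun (regressionError μ X S Y)
    (fun ω => ((S ω, Y ω), realization μ X S Y H W ω)) μ := by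
  have hSY := (isLinearImage_snd_prod X S Y).prodMk (isLinearImage_trd_prod X S Y)
  have hXhat := isLinearImage_realization μ X S Y H W
  have huXhat : covMat μ (regressionError μ X S Y) (realization μ X S Y H W) = 0 := by
    rw [h.covMat_realization_right h.source.memLp_regressionError
      h.source.covMat_regressionError_trd, h.covMat_innovation_right_of_isLinearImage
      (isLinearImage_regressionError μ X S Y), h.source.covMat_regressionError_resid_snd,
      Matrix.zero_mul]
  exact h.joint.indepFun_of_uncorrelated ((isLinearImage_regressionError μ X S Y).noisySource W)
    ((((isLinearImage_snd_prod X S Y).noisySource W).prodMk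
      ((isLinearImage_trd_prod X S Y).noisySource W)).prodMk hXhat)
    (.prodMk h.source.memLp_regressionError (h.source.joint.memLp_two hSY) h.memLp_realization
      h.source.uncorrelated_regressionError
      (.of_covMat h.source.memLp_regressionError h.memLp_realization huXhat))

section Laws

variable [IsProbabilityMeasure μ]

theorem drops_side : CondLawDrops μ X (realization μ X S Y H W) Y :=
  condLawDrops_of_indepFun (M := id) h.measurable_realization h.source.measurable_trd
    measurable_id h.isCenteredGaussian_error.measurable
    (funext fun _ => (add_sub_cancel _ _).symm) h.indepFun_error

theorem drops_source :
    CondLawDrops μ (realization μ X S Y H W) (fun ω => (S ω, Y ω)) X :=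
  condLawDrops_of_indepFun (M := fun p : Vec ns × Vec ny => toEuclideanLin H p.1
      + toEuclideanLin ((covMat μ X Y - H * covMat μ S Y) * (covMat μ Y Y)⁻¹) p.2)
    (h.source.measurable_snd.prodMk h.source.measurable_trd) h.source.measurable_fst
    (by fun_prop) h.noise.measurable rfl
    (h.indep.comp (φ := id) (ψ := fun p : Vec nx × Vec ns × Vec ny => ((p.2.1, p.2.2), p.1))
      measurable_id (by fun_prop))

theorem drops_reproduction :
    CondLawDrops μ X (fun ω => (S ω, Y ω)) (realization μ X S Y H W) := by
  refine condLawDrops_of_indepFun (u := regressionError μ X S Y)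
    (M := fun p : Vec ns × Vec ny => toEuclideanLin (regCoef μ X Y) p.2
      + toEuclideanLin (regCoef μ (resid μ X Y) (resid μ S Y))
        (p.1 - toEuclideanLin (regCoef μ S Y) p.2))
    (h.source.measurable_snd.prodMk h.source.measurable_trd) h.measurable_realization
    (by fun_prop) h.source.isCenteredGaussian_regressionError.measurable ?_
    h.indepFun_regressionError
  funext ω
  simp only [regressionError, resid]
  abel

theorem isAdmissible {Δ : ℝ≥0} (hΔ : Sig.trace ≤ Δ) :
    IsAdmissible μ X S Y (realization μ X S Y H W) Δ where
  measurable := h.measurable_realization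
  markov := h.drops_source
  distortion := by
    rw [h.lintegral_enorm_error_sq, ← ENNReal.ofReal_coe_nnreal]
    exact ENNReal.ofReal_le_ofReal hΔ

theorem rate_source : condMutualInfo μ S (realization μ X S Y H W) Y
    = halfLogDetRatio (condCov μ S S Y)
      (postCovS (condCov μ X X Y) (condCov μ S S Y) Sig H) := by
  refine condMutualInfo_eq_halfLogDetRatio
    (w := resid μ (resid μ S Y) (innovation μ S Y H W))
    (F := fun y => toEuclideanLin (regCoef μ S Y) y)
    (r := fun p : Vec ny × Vec nx =>
      toEuclideanLin (regCoef μ (resid μ S Y) (innovation μ S Y H W))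
        (p.2 - toEuclideanLin (regCoef μ X Y) p.1))
    h.measurable_realization h.source.measurable_trd (by fun_prop) (by fun_prop)
    h.source.isCenteredGaussian_resid_snd (eq_add_resid μ S Y)
    (h.source.joint.indepFun_resid (isLinearImage_snd_prod X S Y) (isLinearImage_trd_prod X S Y))
    ?_ ?_ h.isCenteredGaussian_posterior (h.indepFun_posterior.comp measurable_id measurable_swap)
    h.sub_postCov_psd
  · simpa only [h.realization_sub] using memLp_toEuclideanLin _ h.memLp_innovation
  · simp only [h.realization_sub]
    rfl

theorem rate_reproduction : condMutualInfo μ S (realization μ X S Y H W) Y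
    = halfLogDetRatio (condCov μ X X Y - Sig) QW := by
  have hz := h.joint.isCenteredGaussian (isLinearImage_innovation μ X S Y H W)
  have hlz := isLinearImage_innovation μ X S Y H W
  rw [condMutualInfo_comm h.source.measurable_snd h.measurable_realization
    h.source.measurable_trd, ← h.covMat_innovation_self_eq_sub]
  refine condMutualInfo_eq_halfLogDetRatio (s := innovation μ S Y H W) (w := W)
    (F := fun y => toEuclideanLin (regCoef μ X Y) y)
    (r := fun p : Vec ny × Vec ns =>
      toEuclideanLin H (p.2 - toEuclideanLin (regCoef μ S Y) p.1))
    h.source.measurable_snd h.source.measurable_trd (by fun_prop) (by fun_prop) hz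
    h.realization_eq_add_innovation
    (h.joint.indepFun_of_covMat_eq_zero hlz ((isLinearImage_trd_prod X S Y).noisySource W)
      h.covMat_innovation_side)
    (memLp_toEuclideanLin H h.source.memLp_resid_snd)
    (funext fun _ => (add_sub_cancel_left _ _).symm) h.noise
    (h.indep.comp (φ := id) (ψ := fun p : Vec nx × Vec ns × Vec ny => (p.2.2, p.2.1))
      measurable_id (by fun_prop)) ?_
  rw [h.covMat_innovation_self, add_sub_cancel_right]
  exact posSemidef_mul_mul_transpose h.source.posSemidef_condCov_snd H

end Laws

end IsTestChannel

end TestChannel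

/-! ### Invariance under a change of the probability space -/

section Law

variable {Ω Ω' : Type*} [MeasurableSpace Ω] [MeasurableSpace Ω'] {μ : Measure Ω}
  {μ' : Measure Ω'}

theorem covMat_congr_law {m n : ℕ} {U : Ω → Vec m} {V : Ω → Vec n} {U' : Ω' → Vec m}
    {V' : Ω' → Vec n} (h : IdentDistrib (fun ω => (U ω, V ω)) (fun ω => (U' ω, V' ω)) μ μ') :
    covMat μ U V = covMat μ' U' V' := by
  ext i j
  exact (h.comp (u := fun p : Vec m × Vec n => p.1 i * p.2 j) (by fun_prop)).integral_eq

theorem covMat_resid_congr_law {l m n : ℕ} {U : Ω → Vec l} {T : Ω → Vec m} {Y : Ω → Vec n}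
    {U' : Ω' → Vec l} {T' : Ω' → Vec m} {Y' : Ω' → Vec n}
    (h : IdentDistrib (fun ω => (U ω, T ω, Y ω)) (fun ω => (U' ω, T' ω, Y' ω)) μ μ') :
    covMat μ (resid μ U Y) (resid μ T Y) = covMat μ' (resid μ' U' Y') (resid μ' T' Y') := by
  have hY : covMat μ Y Y = covMat μ' Y' Y' := covMat_congr_law
    (h.comp (u := fun p : Vec l × Vec m × Vec n => (p.2.2, p.2.2)) (by fun_prop))
  have hU : regCoef μ U Y = regCoef μ' U' Y' := by
    rw [regCoef, regCoef, hY, covMat_congr_law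
      (h.comp (u := fun p : Vec l × Vec m × Vec n => (p.1, p.2.2)) (by fun_prop))]
  have hT : regCoef μ T Y = regCoef μ' T' Y' := by
    rw [regCoef, regCoef, hY, covMat_congr_law
      (h.comp (u := fun p : Vec l × Vec m × Vec n => (p.2.1, p.2.2)) (by fun_prop))]
  refine covMat_congr_law ?_
  simp only [resid, hU, hT]
  exact h.comp (u := fun p : Vec l × Vec m × Vec n =>
    (p.1 - toEuclideanLin (regCoef μ' U' Y') p.2.2,
      p.2.1 - toEuclideanLin (regCoef μ' T' Y') p.2.2)) (by fun_prop)

section Kernels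

variable {α β γ : Type*} [MeasurableSpace α] [StandardBorelSpace α] [Nonempty α]
  [MeasurableSpace β] [MeasurableSpace γ] [IsFiniteMeasure μ] [IsFiniteMeasure μ']

theorem condDistrib_congr_law {U : Ω → α} {V : Ω → β} {U' : Ω' → α} {V' : Ω' → β}
    (h : IdentDistrib (fun ω => (V ω, U ω)) (fun ω => (V' ω, U' ω)) μ μ') :
    condDistrib U V μ = condDistrib U' V' μ' := by
  simp only [condDistrib, h.map_eq]

theorem CondLawDrops.congr_law {U : Ω → α} {V : Ω → β} {T : Ω → γ} {U' : Ω' → α} {V' : Ω' → β}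
    {T' : Ω' → γ}
    (hlaw : IdentDistrib (fun ω => (U ω, V ω, T ω)) (fun ω => (U' ω, V' ω, T' ω)) μ μ')
    (h : CondLawDrops μ U V T) : CondLawDrops μ' U' V' T' := by
  have hVT : μ.map (fun ω => (V ω, T ω)) = μ'.map fun ω => (V' ω, T' ω) :=
    (hlaw.comp (u := fun p : α × β × γ => p.2) (by fun_prop)).map_eq
  rw [CondLawDrops, ← hVT, ← condDistrib_congr_law
      (hlaw.comp (u := fun p : α × β × γ => (p.2, p.1)) (by fun_prop)), ← condDistrib_congr_law
      (hlaw.comp (u := fun p : α × β × γ => (p.2.1, p.1)) (by fun_prop))]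
  exact h

theorem condMutualInfo_congr_law [StandardBorelSpace β] [Nonempty β] {A : Ω → α} {B : Ω → β}
    {C : Ω → γ} {A' : Ω' → α} {B' : Ω' → β} {C' : Ω' → γ}
    (h : IdentDistrib (fun ω => (C ω, A ω, B ω)) (fun ω => (C' ω, A' ω, B' ω)) μ μ') :
    condMutualInfo μ A B C = condMutualInfo μ' A' B' C' := by
  rw [condMutualInfo, condMutualInfo, h.map_eq, condDistrib_congr_law
      (h.comp (u := fun p : γ × α × β => (p.1, p.2.1)) (by fun_prop)), condDistrib_congr_law
      (h.comp (u := fun p : γ × α × β => (p.1, p.2.2)) (by fun_prop))]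
  congr 2
  exact (h.comp (u := fun p : γ × α × β => p.1) (by fun_prop)).map_eq

end Kernels

variable {nx ns ny : ℕ} {X : Ω → Vec nx} {S : Ω → Vec ns} {Y : Ω → Vec ny} {Xhat : Ω → Vec nx}
  {X' : Ω' → Vec nx} {S' : Ω' → Vec ns} {Y' : Ω' → Vec ny} {Xhat' : Ω' → Vec nx} {Δ : ℝ≥0}

theorem IsAdmissible.congr_law [IsFiniteMeasure μ] [IsFiniteMeasure μ']
    (h : IsAdmissible μ X S Y Xhat Δ) (hXhat' : Measurable Xhat')
    (hlaw : IdentDistrib (fun ω => ((X ω, S ω, Y ω), Xhat ω))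
      (fun ω => ((X' ω, S' ω, Y' ω), Xhat' ω)) μ μ') : IsAdmissible μ' X' S' Y' Xhat' Δ where
  measurable := hXhat'
  markov := h.markov.congr_law (hlaw.comp (u := fun q : (Vec nx × Vec ns × Vec ny) × Vec nx =>
    (q.2, (q.1.2.1, q.1.2.2), q.1.1)) (by fun_prop))
  distortion := (hlaw.comp (u := fun q : (Vec nx × Vec ns × Vec ny) × Vec nx =>
    ‖q.1.1 - q.2‖ₑ ^ 2) (by fun_prop)).lintegral_eq.symm.trans_le h.distortion

theorem IsAdmissible.exists_law [IsProbabilityMeasure μ] (hX : Measurable X) (hS : Measurable S)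
    (hY : Measurable Y) (h : IsAdmissible μ X S Y Xhat Δ) :
    ∃ ν ∈ admissibleLaws (μ.map fun ω => (X ω, S ω, Y ω)) Δ,
      condMutualInfo (ν : Measure ((Vec nx × Vec ns × Vec ny) × Vec nx))
        (fun q => q.1.2.1) (fun q => q.2) (fun q => q.1.2.2) = condMutualInfo μ S Xhat Y := by
  have hXhat := h.measurable
  have hΦ : Measurable fun ω => ((X ω, S ω, Y ω), Xhat ω) := by fun_prop
  have := Measure.isProbabilityMeasure_map (μ := μ) hΦ.aemeasurable
  have hlaw : IdentDistrib (fun ω => ((X ω, S ω, Y ω), Xhat ω)) id μ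
      (μ.map fun ω => ((X ω, S ω, Y ω), Xhat ω)) :=
    ⟨hΦ.aemeasurable, aemeasurable_id, Measure.map_id.symm⟩
  refine ⟨⟨μ.map fun ω => ((X ω, S ω, Y ω), Xhat ω), this⟩, ⟨?_,
    h.congr_law (μ' := μ.map fun ω => ((X ω, S ω, Y ω), Xhat ω)) measurable_snd hlaw⟩, ?_⟩
  · exact Measure.map_map measurable_fst hΦ
  · exact (condMutualInfo_congr_law (hlaw.comp (u := fun q : (Vec nx × Vec ns × Vec ny) × Vec nx =>
      (q.1.2.2, q.1.2.1, q.2)) (by fun_prop))).symm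

theorem IsAdmissible.rdf_le [IsProbabilityMeasure μ] (hX : Measurable X) (hS : Measurable S)
    (hY : Measurable Y) (h : IsAdmissible μ X S Y Xhat Δ) :
    rdf (μ.map fun ω => (X ω, S ω, Y ω)) Δ ≤ condMutualInfo μ S Xhat Y := by
  obtain ⟨ν, hν, he⟩ := h.exists_law hX hS hY
  exact he ▸ iInf₂_le ν hν

namespace IsGaussianSource

variable (h : IsGaussianSource μ X S Y) (hV' : Measurable fun ω => (X' ω, S' ω, Y' ω))
  (hlaw : IdentDistrib (fun ω => (X ω, S ω, Y ω)) (fun ω => (X' ω, S' ω, Y' ω)) μ μ')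
include h hV' hlaw

theorem congr_law : IsGaussianSource μ' X' S' Y' where
  joint := ⟨hV', ⟨hlaw.map_eq ▸ h.joint.gaussian.isGaussian_map⟩,
    hlaw.integral_eq.symm.trans h.joint.mean⟩
  isUnit := covMat_congr_law (hlaw.comp (u := fun p : Vec nx × Vec ns × Vec ny =>
    (p.2.2, p.2.2)) (by fun_prop)) ▸ h.isUnit

theorem condCov_fst_fst_congr_law : condCov μ X X Y = condCov μ' X' X' Y' := by
  rw [h.condCov_fst_fst, (h.congr_law hV' hlaw).condCov_fst_fst]
  exact covMat_resid_congr_law (hlaw.comp (u := fun p : Vec nx × Vec ns × Vec ny =>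
    (p.1, p.1, p.2.2)) (by fun_prop))

theorem condCov_fst_snd_congr_law : condCov μ X S Y = condCov μ' X' S' Y' := by
  rw [h.condCov_fst_snd, (h.congr_law hV' hlaw).condCov_fst_snd]
  exact covMat_resid_congr_law hlaw

theorem condCov_snd_snd_congr_law : condCov μ S S Y = condCov μ' S' S' Y' := by
  rw [h.condCov_snd_snd, (h.congr_law hV' hlaw).condCov_snd_snd]
  exact covMat_resid_congr_law (hlaw.comp (u := fun p : Vec nx × Vec ns × Vec ny =>
    (p.2.1, p.2.1, p.2.2)) (by fun_prop))

end IsGaussianSource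

end Law

/-! ### The converse -/

section Converse

variable {Ω : Type*} [MeasurableSpace Ω] {μ : Measure Ω}

section Markov

variable {α β γ : Type*} [MeasurableSpace α] [StandardBorelSpace α] [Nonempty α]
  [MeasurableSpace β] [MeasurableSpace γ] [IsFiniteMeasure μ] {V : Ω → β} {T : Ω → γ}

theorem CondLawDrops.integral_mul_eq {A : Ω → α} (h : CondLawDrops μ A V T) (hA : Measurable A)
    (hV : Measurable V) (hT : Measurable T) {a : α → ℝ} (ha : Measurable a) {g : β × γ → ℝ}
    (hg : Measurable g) (hint : Integrable (fun ω => a (A ω) * g (V ω, T ω)) μ) :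
    ∫ ω, a (A ω) * g (V ω, T ω) ∂μ
      = ∫ ω, (∫ b, a b ∂condDistrib A V μ (V ω)) * g (V ω, T ω) ∂μ := by
  have hVT : Measurable fun ω => (V ω, T ω) := hV.prodMk hT
  have hf : Measurable fun q : (β × γ) × α => a q.2 * g q.1 := by fun_prop
  have hmean : Measurable fun v => ∫ b, a b ∂condDistrib A V μ v :=
    (StronglyMeasurable.integral_kernel ha.stronglyMeasurable).measurable
  have hjoint : (μ.map fun ω => (V ω, T ω)) ⊗ₘ condDistrib A (fun ω => (V ω, T ω)) μ
      = μ.map fun ω => ((V ω, T ω), A ω) :=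
    compProd_map_condDistrib hA.aemeasurable
  calc ∫ ω, a (A ω) * g (V ω, T ω) ∂μ
      = ∫ q, a q.2 * g q.1
          ∂((μ.map fun ω => (V ω, T ω)) ⊗ₘ condDistrib A (fun ω => (V ω, T ω)) μ) := by
        rw [hjoint, integral_map (by fun_prop) hf.aestronglyMeasurable]
    _ = ∫ p, (∫ b, a b ∂condDistrib A V μ p.1) * g p ∂(μ.map fun ω => (V ω, T ω)) := by
        rw [Measure.integral_compProd (by
          rwa [hjoint, integrable_map_measure hf.aestronglyMeasurable (by fun_prop)])]
        refine integral_congr_ae ?_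
        filter_upwards [h] with p hp
        rw [hp, integral_mul_const]
    _ = ∫ ω, (∫ b, a b ∂condDistrib A V μ (V ω)) * g (V ω, T ω) ∂μ :=
        integral_map hVT.aemeasurable
          ((hmean.comp measurable_fst).mul hg).aestronglyMeasurable

theorem CondLawDrops.covMat_eq_zero {m n : ℕ} {A : Ω → Vec m} (h : CondLawDrops μ A V T)
    (hA : Measurable A) (hV : Measurable V) (hT : Measurable T) {g : β × γ → Vec n}
    (hg : Measurable g) (hA2 : MemLp A 2 μ) (hg2 : MemLp (fun ω => g (V ω, T ω)) 2 μ)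
    (hind : IndepFun (fun ω => g (V ω, T ω)) V μ) (h0 : ∫ ω, g (V ω, T ω) ∂μ = 0) :
    covMat μ A (fun ω => g (V ω, T ω)) = 0 := by
  ext i j
  have hmean : Measurable fun v => ∫ b : Vec m, b i ∂condDistrib A V μ v :=
    (StronglyMeasurable.integral_kernel (f := fun b : Vec m => b i)
      (by fun_prop : Measurable fun b : Vec m => b i).stronglyMeasurable).measurable
  have hindij : IndepFun (fun ω => ∫ b : Vec m, b i ∂condDistrib A V μ (V ω))
      (fun ω => g (V ω, T ω) j) μ :=
    hind.symm.comp (ψ := fun v : Vec n => v j) hmean (by fun_prop)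
  have hg0 : ∫ ω, g (V ω, T ω) j ∂μ = 0 := by
    rw [← eval_integral_piLp fun k => (hg2.integrable one_le_two).eval_piLp k, h0]
    rfl
  calc ∫ ω, A ω i * g (V ω, T ω) j ∂μ
      = ∫ ω, (∫ b : Vec m, b i ∂condDistrib A V μ (V ω)) * g (V ω, T ω) j ∂μ :=
        h.integral_mul_eq hA hV hT (a := fun b : Vec m => b i) (by fun_prop)
          (g := fun p => g p j) (by fun_prop) (integrable_coord_mul hA2 hg2 i j)
    _ = (∫ ω, ∫ b : Vec m, b i ∂condDistrib A V μ (V ω) ∂μ) * ∫ ω, g (V ω, T ω) j ∂μ :=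
        hindij.integral_fun_mul_eq_mul_integral (hmean.comp hV).aestronglyMeasurable
          (by fun_prop : Measurable fun ω => g (V ω, T ω) j).aestronglyMeasurable
    _ = 0 := by rw [hg0, mul_zero]

end Markov

section SecondMoments

variable {m n : ℕ}

theorem trace_covMat_le_of_covMat_eq_zero {U V : Ω → Vec n} (hU : MemLp U 2 μ)
    (hV : MemLp V 2 μ) (h : covMat μ U V = 0) :
    (covMat μ U U).trace ≤ (covMat μ (fun ω => U ω + V ω) (fun ω => U ω + V ω)).trace := by
  rw [covMat_add_self_of_covMat_eq_zero hU hV h, trace_add]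
  exact le_add_of_nonneg_right (posSemidef_covMat_self hV).trace_nonneg

theorem covMat_self_mul_transpose_regCoef {U : Ω → Vec m} {Y : Ω → Vec n} (hU : MemLp U 2 μ)
    (hY : MemLp Y 2 μ) : covMat μ Y Y * (regCoef μ U Y)ᵀ = covMat μ Y U := by
  rw [← covMat_transpose U Y, ← regCoef_mul_covMat_self hU hY, transpose_mul, covMat_transpose]

theorem covMat_self_eq_add_of_covMat_sub_eq_zero {x q : Ω → Vec n} (hx : MemLp x 2 μ)
    (hq : MemLp q 2 μ) (h : covMat μ (fun ω => x ω - q ω) q = 0) :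
    covMat μ x x = covMat μ (fun ω => x ω - q ω) (fun ω => x ω - q ω) + covMat μ q q := by
  have hxq : MemLp (fun ω => x ω - q ω) 2 μ := hx.sub hq
  rw [← covMat_add_self_of_covMat_eq_zero hxq hq h]
  simp only [sub_add_cancel]

-- `q` plays the role of the best linear estimate of `x` from the reproduction, and the second
-- orthogonality is what the Markov chain leaves of the structure of the reproduction.
theorem isFeasible_of_covMat_eq_zero {x q : Ω → Vec m} {s : Ω → Vec n} (hx : MemLp x 2 μ)
    (hs : MemLp s 2 μ) (hq : MemLp q 2 μ) (hxq : covMat μ (fun ω => x ω - q ω) q = 0)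
    (hres : covMat μ (resid μ x s) q = 0) :
    IsFeasible (covMat μ x x) (covMat μ x s) (covMat μ s s)
      (covMat μ (fun ω => x ω - q ω) fun ω => x ω - q ω) (regCoef μ q s)
      (covMat μ (resid μ q s) (resid μ q s)) := by
  have hproj : covMat μ x q = covMat μ q q := by
    rwa [covMat_sub_left hx hq hq, sub_eq_zero] at hxq
  have hvia : covMat μ x q = regCoef μ x s * covMat μ s q := by
    rwa [covMat_resid_left hx hs hq, sub_eq_zero] at hres
  have hgain : regCoef μ q s * (covMat μ x s)ᵀ = covMat μ q q := calc
    regCoef μ q s * (covMat μ x s)ᵀ = regCoef μ q s * covMat μ s s * (regCoef μ x s)ᵀ := by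
      rw [covMat_transpose, ← covMat_self_mul_transpose_regCoef hx hs, Matrix.mul_assoc]
    _ = (regCoef μ x s * covMat μ s q)ᵀ := by
      rw [regCoef_mul_covMat_self hq hs, transpose_mul, covMat_transpose]
    _ = covMat μ q q := by rw [← hvia, hproj, covMat_transpose]
  refine ⟨posSemidef_covMat_self (hx.sub hq), ?_, ?_, ?_, ?_,
    posSemidef_covMat_self (memLp_resid hq hs)⟩
  · rw [hgain, covMat_self_eq_add_of_covMat_sub_eq_zero hx hq hxq, add_sub_cancel_left]
  · rw [hgain, ← covMat_transpose q q, ← hgain, transpose_mul, transpose_transpose]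
  · exact hgain ▸ posSemidef_covMat_self hq
  · rw [hgain, covMat_resid_resid hq hq hs, Matrix.mul_assoc (regCoef μ q s),
      covMat_self_mul_transpose_regCoef hq hs, regCoef]

/-- The best linear estimate of `X - E(X|Y)` from the residual of `Xhat` given `Y`. It is the
reproduction, minus `E(X|Y)`, whose second moments define the test channel improving on `Xhat`. -/
def innovationEstimate (μ : Measure Ω) (X : Ω → Vec m) (Y : Ω → Vec n) (Xhat : Ω → Vec m) :
    Ω → Vec m :=
  fun ω => toEuclideanLin (regCoef μ (resid μ X Y) (resid μ Xhat Y)) (resid μ Xhat Y ω)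

variable {X Xhat : Ω → Vec m} {Y : Ω → Vec n}

theorem memLp_innovationEstimate (hXhat : MemLp Xhat 2 μ) (hY : MemLp Y 2 μ) :
    MemLp (innovationEstimate μ X Y Xhat) 2 μ :=
  memLp_toEuclideanLin _ (memLp_resid hXhat hY)

theorem covMat_innovationEstimate_right {l : ℕ} {U : Ω → Vec l} (hU : MemLp U 2 μ)
    (hXhat : MemLp Xhat 2 μ) (hY : MemLp Y 2 μ) (h : covMat μ U (resid μ Xhat Y) = 0) :
    covMat μ U (innovationEstimate μ X Y Xhat) = 0 := by
  unfold innovationEstimate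
  rw [covMat_toEuclideanLin_right _ hU (memLp_resid hXhat hY), h, Matrix.zero_mul]

theorem covMat_sub_innovationEstimate (hX : MemLp X 2 μ) (hXhat : MemLp Xhat 2 μ)
    (hY : MemLp Y 2 μ) :
    covMat μ (fun ω => resid μ X Y ω - innovationEstimate μ X Y Xhat ω)
      (innovationEstimate μ X Y Xhat) = 0 :=
  covMat_innovationEstimate_right
    ((memLp_resid hX hY).sub (memLp_innovationEstimate hXhat hY)) hXhat hY
    (covMat_resid_left_self (memLp_resid hX hY) (memLp_resid hXhat hY))

-- `X - Xhat` differs from the error of the estimate by a linear function of the residual of `Xhat`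
-- and of `Y`, with which the error is uncorrelated.
theorem trace_covMat_resid_sub_innovationEstimate_le (hX : MemLp X 2 μ) (hXhat : MemLp Xhat 2 μ)
    (hY : MemLp Y 2 μ) :
    (covMat μ (fun ω => resid μ X Y ω - innovationEstimate μ X Y Xhat ω)
        (fun ω => resid μ X Y ω - innovationEstimate μ X Y Xhat ω)).trace
      ≤ (covMat μ (fun ω => X ω - Xhat ω) (fun ω => X ω - Xhat ω)).trace := by
  have hx := memLp_resid hX hY
  have hz := memLp_resid hXhat hY
  have hq : MemLp (innovationEstimate μ X Y Xhat) 2 μ := memLp_innovationEstimate hXhat hY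
  have hd : MemLp (fun ω => resid μ X Y ω - innovationEstimate μ X Y Xhat ω) 2 μ := hx.sub hq
  have hqz : MemLp (fun ω => innovationEstimate μ X Y Xhat ω - resid μ Xhat Y ω) 2 μ := hq.sub hz
  have hside := memLp_toEuclideanLin (regCoef μ X Y - regCoef μ Xhat Y) hY
  have hdz : covMat μ (fun ω => resid μ X Y ω - innovationEstimate μ X Y Xhat ω)
      (resid μ Xhat Y) = 0 := covMat_resid_left_self hx hz
  have hdY : covMat μ (fun ω => resid μ X Y ω - innovationEstimate μ X Y Xhat ω) Y = 0 :=
    (covMat_resid_left hx hz hY).trans (by rw [covMat_resid_left_self hX hY,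
      covMat_resid_left_self hXhat hY, Matrix.mul_zero, sub_zero])
  have herror : (fun ω => X ω - Xhat ω)
      = fun ω => (resid μ X Y ω - innovationEstimate μ X Y Xhat ω)
        + ((innovationEstimate μ X Y Xhat ω - resid μ Xhat Y ω)
          + toEuclideanLin (regCoef μ X Y - regCoef μ Xhat Y) (Y ω)) := by
    funext ω
    simp only [resid, map_sub, LinearMap.sub_apply]
    abel
  rw [herror]
  refine trace_covMat_le_of_covMat_eq_zero hd (hqz.add hside) ?_
  rw [covMat_add_right hd hqz hside, covMat_sub_right hd hq hz, hdz,
    covMat_sub_innovationEstimate hX hXhat hY, covMat_toEuclideanLin_right _ hd hY, hdY,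
    Matrix.zero_mul, sub_zero, add_zero]

end SecondMoments

section Admissible

variable [IsProbabilityMeasure μ] {nx ns ny : ℕ} {X Xhat : Ω → Vec nx} {S : Ω → Vec ns}
  {Y : Ω → Vec ny} {Δ : ℝ≥0}

namespace IsAdmissible

theorem memLp_sub (h : IsAdmissible μ X S Y Xhat Δ) (hX : Measurable X) :
    MemLp (fun ω => X ω - Xhat ω) 2 μ := by
  refine ⟨(hX.sub h.measurable).aestronglyMeasurable, ?_⟩
  rw [eLpNorm_lt_top_iff_lintegral_rpow_enorm_lt_top two_ne_zero ENNReal.ofNat_ne_top]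
  simpa using h.distortion.trans_lt ENNReal.coe_lt_top

variable (h : IsAdmissible μ X S Y Xhat Δ) (hsrc : IsGaussianSource μ X S Y)
include h hsrc

theorem memLp_reproduction : MemLp Xhat 2 μ := by
  have hsub := hsrc.memLp_fst.sub (h.memLp_sub hsrc.measurable_fst)
  rwa [show X - (fun ω => X ω - Xhat ω) = Xhat by funext ω; simp] at hsub

theorem covMat_regressionError : covMat μ Xhat (regressionError μ X S Y) = 0 :=
  h.markov.covMat_eq_zero (g := fun q => (q.2 - toEuclideanLin (regCoef μ X Y) q.1.2)
      - toEuclideanLin (regCoef μ (resid μ X Y) (resid μ S Y))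
        (q.1.1 - toEuclideanLin (regCoef μ S Y) q.1.2))
    h.measurable (hsrc.measurable_snd.prodMk hsrc.measurable_trd) hsrc.measurable_fst
    (by fun_prop) (h.memLp_reproduction hsrc) hsrc.memLp_regressionError
    (hsrc.joint.indepFun_of_uncorrelated (isLinearImage_regressionError μ X S Y)
      ((isLinearImage_snd_prod X S Y).prodMk (isLinearImage_trd_prod X S Y))
      hsrc.uncorrelated_regressionError)
    (hsrc.joint.of_isLinearImage (isLinearImage_regressionError μ X S Y)).mean

theorem covMat_regressionError_innovationEstimate :
    covMat μ (regressionError μ X S Y) (innovationEstimate μ X Y Xhat) = 0 := by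
  have hXhat := h.memLp_reproduction hsrc
  refine covMat_innovationEstimate_right hsrc.memLp_regressionError hXhat hsrc.memLp_trd ?_
  rw [covMat_resid_right_of_covMat_eq_zero hsrc.memLp_regressionError hXhat hsrc.memLp_trd
    hsrc.covMat_regressionError_trd, ← covMat_transpose, h.covMat_regressionError hsrc,
    transpose_zero]

theorem trace_covMat_sub_innovationEstimate_le :
    (covMat μ (fun ω => resid μ X Y ω - innovationEstimate μ X Y Xhat ω)
      (fun ω => resid μ X Y ω - innovationEstimate μ X Y Xhat ω)).trace ≤ Δ := by
  refine (trace_covMat_resid_sub_innovationEstimate_le hsrc.memLp_fst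
    (h.memLp_reproduction hsrc) hsrc.memLp_trd).trans ?_
  rw [← ENNReal.ofReal_le_coe, ← lintegral_enorm_sq_eq_trace (h.memLp_sub hsrc.measurable_fst)]
  exact h.distortion

theorem exists_feasible : ∃ (Sig : Matrix (Fin nx) (Fin nx) ℝ) (H : Matrix (Fin nx) (Fin ns) ℝ)
    (QW : Matrix (Fin nx) (Fin nx) ℝ),
    IsFeasible (condCov μ X X Y) (condCov μ X S Y) (condCov μ S S Y) Sig H QW ∧ Sig.trace ≤ Δ ∧
    halfLogDetRatio (condCov μ S S Y) (postCovS (condCov μ X X Y) (condCov μ S S Y) Sig H)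
      ≤ condMutualInfo μ S Xhat Y := by
  have hXhat := h.memLp_reproduction hsrc
  have hx := hsrc.memLp_resid_fst
  have hs := hsrc.memLp_resid_snd
  set q := innovationEstimate μ X Y Xhat
  have hq : MemLp q 2 μ := memLp_innovationEstimate hXhat hsrc.memLp_trd
  have hxq : covMat μ (fun ω => resid μ X Y ω - q ω) q = 0 :=
    covMat_sub_innovationEstimate hsrc.memLp_fst hXhat hsrc.memLp_trd
  have hpost := covMat_resid_eq_postCovS hs hq
    (covMat_self_mul_transpose_regCoef hq hs).symm
    (eq_sub_of_add_eq' (covMat_self_eq_add_of_covMat_sub_eq_zero hx hq hxq).symm)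
  refine ⟨covMat μ (fun ω => resid μ X Y ω - q ω) (fun ω => resid μ X Y ω - q ω),
    regCoef μ q (resid μ S Y), covMat μ (resid μ q (resid μ S Y)) (resid μ q (resid μ S Y)), ?_,
    h.trace_covMat_sub_innovationEstimate_le hsrc, ?_⟩
  · rw [hsrc.condCov_fst_fst, hsrc.condCov_fst_snd, hsrc.condCov_snd_snd]
    exact isFeasible_of_covMat_eq_zero hx hs hq hxq
      (h.covMat_regressionError_innovationEstimate hsrc)
  · rw [hsrc.condCov_fst_fst, hsrc.condCov_snd_snd, ← hpost]
    exact halfLogDetRatio_le_condMutualInfo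
      (F := fun y => toEuclideanLin (regCoef μ S Y) y)
      (r := fun p : Vec ny × Vec nx => toEuclideanLin (regCoef μ (resid μ S Y) q)
        (toEuclideanLin (regCoef μ (resid μ X Y) (resid μ Xhat Y))
          (p.2 - toEuclideanLin (regCoef μ Xhat Y) p.1)))
      h.measurable hsrc.measurable_trd (measurable_toEuclideanLin _) (by fun_prop)
      (hsrc.condCov_snd_snd ▸ hsrc.isCenteredGaussian_resid_snd) (eq_add_resid μ S Y)
      (hsrc.joint.indepFun_resid (isLinearImage_snd_prod X S Y) (isLinearImage_trd_prod X S Y))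
      (memLp_toEuclideanLin _ hq) rfl (posSemidef_covMat_sub_covMat_resid hs hq)

end IsAdmissible

end Admissible

end Converse

/-! ### Optimal test channels -/

section Minimizer

theorem isClosed_setOf_posSemidef {n : Type*} [Finite n] :
    IsClosed {A : Matrix n n ℝ | A.PosSemidef} := by
  have := Fintype.ofFinite n
  simp only [posSemidef_iff_dotProduct_mulVec, Set.ofPred_and, Set.ofPred_forall]
  refine IsClosed.inter ?_ (isClosed_iInter fun x => ?_)
  · exact isClosed_eq (by fun_prop) continuous_id
  · exact isClosed_le continuous_const (by fun_prop)

theorem sq_apply_le_trace_mul_transpose {m n : Type*} [Fintype m] [Fintype n] (N : Matrix m n ℝ)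
    (i : m) (j : n) : N i j ^ 2 ≤ (N * Nᵀ).trace := calc
  N i j ^ 2 ≤ ∑ l, N i l ^ 2 :=
    Finset.single_le_sum (f := fun l => N i l ^ 2) (fun l _ => sq_nonneg _) (Finset.mem_univ j)
  _ ≤ ∑ k, ∑ l, N k l ^ 2 :=
    Finset.single_le_sum (f := fun k => ∑ l, N k l ^ 2)
      (fun k _ => Finset.sum_nonneg fun l _ => sq_nonneg _) (Finset.mem_univ i)
  _ = (N * Nᵀ).trace := by
    simp only [trace, diag_apply, mul_apply, transpose_apply, sq]

theorem isCompact_setOf_apply_mem_Icc {m n : Type*} (a b : ℝ) :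
    IsCompact {N : Matrix m n ℝ | ∀ i j, N i j ∈ Set.Icc a b} := by
  have h : IsCompact (Set.univ.pi fun _ : m => Set.univ.pi fun _ : n => Set.Icc a b) :=
    isCompact_univ_pi fun _ => isCompact_univ_pi fun _ => isCompact_Icc
  simpa only [Set.pi, Set.mem_univ, true_imp_iff, Set.mem_ofPred_eq] using! h

theorem lowerSemicontinuousOn_regLogDetRatio {E : Type*} [TopologicalSpace E] {s : Set E} {n : ℕ}
    {A B : E → Matrix (Fin n) (Fin n) ℝ} (hA : ContinuousOn A s) (hB : ContinuousOn B s)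
    (hApsd : ∀ x ∈ s, (A x).PosSemidef) (hBpsd : ∀ x ∈ s, (B x).PosSemidef) :
    LowerSemicontinuousOn (fun x => regLogDetRatio (A x) (B x)) s := by
  refine lowerSemicontinuousOn_biSup fun ε hε => ContinuousOn.lowerSemicontinuousOn ?_
  have hdetA : ∀ x ∈ s, (A x + ε • (1 : Matrix (Fin n) (Fin n) ℝ)).det ≠ 0 := fun x hx =>
    (posDef_add_smul_one (hApsd x hx) hε).det_pos.ne'
  have hdetB : ∀ x ∈ s, (B x + ε • (1 : Matrix (Fin n) (Fin n) ℝ)).det ≠ 0 := fun x hx =>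
    (posDef_add_smul_one (hBpsd x hx) hε).det_pos.ne'
  have hdet : Continuous fun M : Matrix (Fin n) (Fin n) ℝ => (M + ε • 1).det := by fun_prop
  exact ENNReal.continuous_ofReal.comp_continuousOn (continuousOn_const.mul
    (((hdet.comp_continuousOn hA).div (hdet.comp_continuousOn hB) hdetB).log
      fun x hx => div_ne_zero (hdetA x hx) (hdetB x hx)))

variable {nx ns : ℕ} {QX Sig QW : Matrix (Fin nx) (Fin nx) ℝ} {QXS : Matrix (Fin nx) (Fin ns) ℝ}
  {QS : Matrix (Fin ns) (Fin ns) ℝ} {H H' : Matrix (Fin nx) (Fin ns) ℝ} {Δ : ℝ}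

theorem pinv_mul_self_mul_self (hQS : QS.PosSemidef) : pinv QS * QS * QS = QS := by
  have hp := isPseudoinverse_pinv hQS.isHermitian
  have h := congrArg transpose hp.mul_mul_left
  rwa [Matrix.mul_assoc, transpose_mul, hp.symm_right, transpose_eq_of_posSemidef hQS] at h

namespace IsFeasible

theorem posSemidef_sub_sub (h : IsFeasible QX QXS QS Sig H QW) (hQS : QS.PosSemidef) :
    (QX - Sig - QW).PosSemidef := by
  rw [← h.gain, h.noise, sub_sub_cancel]
  exact posSemidef_mul_mul_transpose hQS H

theorem congr_gain (h : IsFeasible QX QXS QS Sig H QW) (hgain : H' * QXSᵀ = H * QXSᵀ)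
    (hquad : H' * QS * H'ᵀ = H * QS * Hᵀ) : IsFeasible QX QXS QS Sig H' QW where
  sig_psd := h.sig_psd
  gain := hgain.trans h.gain
  gain_symm := by
    have hT : QXS * H'ᵀ = QXS * Hᵀ := by simpa [transpose_mul] using congrArg transpose hgain
    rw [hgain, hT, h.gain_symm]
  gain_psd := hgain ▸ h.gain_psd
  noise := by rw [hgain, hquad, h.noise]
  noise_psd := h.noise_psd

theorem mul_pinv_mul_self (h : IsFeasible QX QXS QS Sig H QW) (hQS : QS.PosSemidef)
    (hQXS : QXS * pinv QS * QS = QXS) : IsFeasible QX QXS QS Sig (H * (pinv QS * QS)) QW := by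
  have hp := isPseudoinverse_pinv hQS.isHermitian
  have hQXST : pinv QS * QS * QXSᵀ = QXSᵀ := by
    have hT := congrArg transpose hQXS
    rwa [Matrix.mul_assoc, transpose_mul, hp.symm_right] at hT
  refine h.congr_gain (by rw [Matrix.mul_assoc, hQXST]) ?_
  rw [transpose_mul, hp.symm_right, Matrix.mul_assoc H, pinv_mul_self_mul_self hQS,
    ← Matrix.mul_assoc, Matrix.mul_assoc H QS, ← Matrix.mul_assoc QS, hp.mul_mul_left]

end IsFeasible

/-- The gains `H` of the feasible parameters of distortion at most `Δ` which vanish on the kernel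
of `QS`. Without the last condition the set of gains need not be bounded. -/
def reducedGains (QX : Matrix (Fin nx) (Fin nx) ℝ) (QXS : Matrix (Fin nx) (Fin ns) ℝ)
    (QS : Matrix (Fin ns) (Fin ns) ℝ) (Δ : ℝ) : Set (Matrix (Fin nx) (Fin ns) ℝ) :=
  {H | IsFeasible QX QXS QS (QX - H * QXSᵀ) H (H * QXSᵀ - H * QS * Hᵀ) ∧
    (QX - H * QXSᵀ).trace ≤ Δ ∧ H * (pinv QS * QS) = H}

theorem isClosed_reducedGains : IsClosed (reducedGains QX QXS QS Δ) := by
  have h : reducedGains QX QXS QS Δ =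
      {H | (QX - H * QXSᵀ).PosSemidef} ∩ {H | H * QXSᵀ = QXS * Hᵀ} ∩ {H | (H * QXSᵀ).PosSemidef} ∩
      {H | (H * QXSᵀ - H * QS * Hᵀ).PosSemidef} ∩ {H | (QX - H * QXSᵀ).trace ≤ Δ} ∩
      {H | H * (pinv QS * QS) = H} := by
    ext H
    constructor
    · rintro ⟨⟨hSig, -, hsymm, hgain, -, hQW⟩, hΔ, hker⟩
      exact ⟨⟨⟨⟨⟨hSig, hsymm⟩, hgain⟩, hQW⟩, hΔ⟩, hker⟩
    · rintro ⟨⟨⟨⟨⟨hSig, hsymm⟩, hgain⟩, hQW⟩, hΔ⟩, hker⟩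
      exact ⟨⟨hSig, (sub_sub_cancel _ _).symm, hsymm, hgain, rfl, hQW⟩, hΔ, hker⟩
  rw [h]
  refine (((((isClosed_setOf_posSemidef.preimage ?_).inter (isClosed_eq ?_ ?_)).inter
    (isClosed_setOf_posSemidef.preimage ?_)).inter (isClosed_setOf_posSemidef.preimage ?_)).inter
    (isClosed_le ?_ continuous_const)).inter (isClosed_eq ?_ continuous_id)
  all_goals fun_prop

theorem IsFeasible.trace_mul_mul_transpose_le (h : IsFeasible QX QXS QS Sig H QW) :
    (H * QS * Hᵀ).trace ≤ QX.trace := by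
  have hSig := h.sig_psd.trace_nonneg
  have hQW := h.noise_psd.trace_nonneg
  rw [h.noise, h.gain, trace_sub, trace_sub] at hQW
  linarith

-- With `QS = T * Tᵀ`, a reduced gain `H` is a fixed linear function of `H * T`, and the entries of
-- `H * T` are bounded since `(H * T) * (H * T)ᵀ = H * QS * Hᵀ ⪯ QX`.
theorem isCompact_reducedGains (hQS : QS.PosSemidef) : IsCompact (reducedGains QX QXS QS Δ) := by
  obtain ⟨k, T, -, -, hT⟩ := exists_full_rank_factorization hQS
  have hp := isPseudoinverse_pinv hQS.isHermitian
  refine ((isCompact_setOf_apply_mem_Icc (-√QX.trace) √QX.trace).image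
    (f := fun N => N * (Tᵀ * (pinv QS)ᵀ)) (by fun_prop)).of_isClosed_subset
    isClosed_reducedGains ?_
  rintro H ⟨hf, -, hker⟩
  refine ⟨H * T, fun i j => abs_le.mp (Real.abs_le_sqrt ?_), ?_⟩
  · refine (sq_apply_le_trace_mul_transpose (H * T) i j).trans (le_trans (le_of_eq ?_)
      hf.trace_mul_mul_transpose_le)
    rw [hT, transpose_mul]
    simp only [Matrix.mul_assoc]
  · calc H * T * (Tᵀ * (pinv QS)ᵀ) = H * (pinv QS * QS)ᵀ := by
          rw [transpose_mul, transpose_eq_of_posSemidef hQS, hT]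
          simp only [Matrix.mul_assoc]
      _ = H := by rw [hp.symm_right, hker]

theorem IsFeasible.exists_mem_reducedGains (h : IsFeasible QX QXS QS Sig H QW)
    (hQS : QS.PosSemidef) (hQXS : QXS * pinv QS * QS = QXS) (hΔ : Sig.trace ≤ Δ) :
    ∃ H' ∈ reducedGains QX QXS QS Δ, H' * QXSᵀ = QX - Sig ∧ H' * QXSᵀ - H' * QS * H'ᵀ = QW := by
  have hred := h.mul_pinv_mul_self hQS hQXS
  have hSig : QX - H * (pinv QS * QS) * QXSᵀ = Sig := by rw [hred.gain, sub_sub_cancel]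
  refine ⟨H * (pinv QS * QS), ⟨?_, hSig ▸ hΔ, ?_⟩, hred.gain, hred.noise.symm⟩
  · rwa [hSig, ← hred.noise]
  · rw [Matrix.mul_assoc H, ← Matrix.mul_assoc (pinv QS * QS), Matrix.mul_assoc (pinv QS) QS,
      Matrix.mul_assoc (pinv QS) (QS * pinv QS),
      (isPseudoinverse_pinv hQS.isHermitian).mul_mul_left]

theorem exists_feasible_minimizer (hQS : QS.PosSemidef) (hQXS : QXS * pinv QS * QS = QXS)
    (hne : ∃ Sig H QW, IsFeasible QX QXS QS Sig H QW ∧ Sig.trace ≤ Δ) :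
    ∃ Sig H QW, IsFeasible QX QXS QS Sig H QW ∧ Sig.trace ≤ Δ ∧
      ∀ Sig' H' QW', IsFeasible QX QXS QS Sig' H' QW' → Sig'.trace ≤ Δ →
        halfLogDetRatio (QX - Sig) QW ≤ halfLogDetRatio (QX - Sig') QW' := by
  have hrate : ∀ {Sig H QW}, IsFeasible QX QXS QS Sig H QW →
      halfLogDetRatio (QX - Sig) QW = regLogDetRatio (QX - Sig) QW := fun hf =>
    halfLogDetRatio_eq_regLogDetRatio hf.noise_psd (hf.posSemidef_sub_sub hQS)
  obtain ⟨Sig₀, H₀, QW₀, hf₀, hΔ₀⟩ := hne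
  obtain ⟨H₁, hmem₁, -⟩ := hf₀.exists_mem_reducedGains hQS hQXS hΔ₀
  obtain ⟨H, hH, hmin⟩ := LowerSemicontinuousOn.exists_isMinOn ⟨H₁, hmem₁⟩
    (isCompact_reducedGains hQS)
    (lowerSemicontinuousOn_regLogDetRatio (A := fun H => H * QXSᵀ)
      (B := fun H => H * QXSᵀ - H * QS * Hᵀ) (by fun_prop) (by fun_prop)
      (fun H hH => hH.1.gain_psd) fun H hH => hH.1.noise_psd)
  refine ⟨_, H, _, hH.1, hH.2.1, fun Sig' H' QW' hf hΔ => ?_⟩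
  obtain ⟨H'', hmem, hgain, hnoise⟩ := hf.exists_mem_reducedGains hQS hQXS hΔ
  rw [hrate hH.1, hrate hf, ← hgain, ← hnoise, sub_sub_cancel]
  exact hmin hmem

end Minimizer

section Existence

theorem IsCenteredGaussian.congr_law {Ω Ω' : Type*} [MeasurableSpace Ω] [MeasurableSpace Ω']
    {μ : Measure Ω} {μ' : Measure Ω'} {n : ℕ} {Q : Matrix (Fin n) (Fin n) ℝ} {U : Ω → Vec n}
    {U' : Ω' → Vec n} (h : IsCenteredGaussian μ U Q) (hU' : Measurable U')
    (hlaw : IdentDistrib U U' μ μ') : IsCenteredGaussian μ' U' Q where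
  measurable := hU'
  gaussian := ⟨hlaw.map_eq ▸ h.gaussian.isGaussian_map⟩
  mean := hlaw.integral_eq.symm.trans h.mean
  cov := (covMat_congr_law (hlaw.comp (u := fun v : Vec n => (v, v)) (by fun_prop))).symm.trans
    h.cov

theorem isCenteredGaussian_multivariateGaussian {n : ℕ} {Q : Matrix (Fin n) (Fin n) ℝ}
    (hQ : Q.PosSemidef) : IsCenteredGaussian (multivariateGaussian 0 Q) id Q where
  measurable := measurable_id
  gaussian := ⟨by rw [Measure.map_id]; infer_instance⟩
  mean := integral_id_multivariateGaussian
  cov := by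
    have hmem : MemLp (fun x : Vec n => x) 2 (multivariateGaussian 0 Q) := IsGaussian.memLp_two_id
    have hmean (i : Fin n) : ∫ x : Vec n, x i ∂multivariateGaussian 0 Q = 0 := by
      rw [← eval_integral_piLp fun k => (hmem.integrable one_le_two).eval_piLp k,
        integral_id_multivariateGaussian]
      rfl
    ext i j
    rw [← covariance_eval_multivariateGaussian (μ := (0 : Vec n)) hQ i j,
      covariance_eq_sub (hmem.eval_piLp i) (hmem.eval_piLp j), hmean, zero_mul, sub_zero]
    rfl

namespace IsGaussianSource

variable {Ω : Type*} [MeasurableSpace Ω] {μ : Measure Ω} [IsProbabilityMeasure μ]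
  {nx ns ny : ℕ} {X : Ω → Vec nx} {S : Ω → Vec ns} {Y : Ω → Vec ny}
  (hsrc : IsGaussianSource μ X S Y)
include hsrc

section Feasible

variable {Sig QW : Matrix (Fin nx) (Fin nx) ℝ} {H : Matrix (Fin nx) (Fin ns) ℝ} {Δ : ℝ≥0}
  (hf : IsFeasible (condCov μ X X Y) (condCov μ X S Y) (condCov μ S S Y) Sig H QW)
include hf

theorem exists_isTestChannel :
    ∃ (Ω' : Type) (_ : MeasurableSpace Ω') (μ' : Measure Ω') (_ : IsProbabilityMeasure μ')
      (X' : Ω' → Vec nx) (S' : Ω' → Vec ns) (Y' : Ω' → Vec ny) (W' : Ω' → Vec nx),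
      (μ'.map fun ω => (X' ω, S' ω, Y' ω)) = (μ.map fun ω => (X ω, S ω, Y ω)) ∧
      condCov μ' X' X' Y' = condCov μ X X Y ∧ condCov μ' S' S' Y' = condCov μ S S Y ∧
      IsTestChannel μ' X' S' Y' Sig H QW W' := by
  have hV := hsrc.joint.measurable
  have := Measure.isProbabilityMeasure_map (μ := μ) hV.aemeasurable
  set P := μ.map fun ω => (X ω, S ω, Y ω)
  set N : Measure (Vec nx) := multivariateGaussian 0 QW
  have hV' : Measurable fun q : (Vec nx × Vec ns × Vec ny) × Vec nx =>
    (q.1.1, q.1.2.1, q.1.2.2) := by fun_prop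
  have hmap : (P.prod N).map (fun q => (q.1.1, q.1.2.1, q.1.2.2)) = P :=
    (measurePreserving_fst (μ := P) (ν := N)).map_eq
  have hlaw : IdentDistrib (fun ω => (X ω, S ω, Y ω)) (fun q => (q.1.1, q.1.2.1, q.1.2.2)) μ
      (P.prod N) := ⟨hV.aemeasurable, hV'.aemeasurable, hmap.symm⟩
  have hnoise : IsCenteredGaussian (P.prod N) Prod.snd QW :=
    (isCenteredGaussian_multivariateGaussian hf.noise_psd).congr_law _root_.measurable_snd
      ⟨aemeasurable_id, _root_.measurable_snd.aemeasurable,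
        Measure.map_id.trans (measurePreserving_snd (μ := P) (ν := N)).map_eq.symm⟩
  refine ⟨_, inferInstance, P.prod N, inferInstance, _, _, _, Prod.snd, hmap,
    (hsrc.condCov_fst_fst_congr_law hV' hlaw).symm, (hsrc.condCov_snd_snd_congr_law hV' hlaw).symm,
    hsrc.congr_law hV' hlaw, ?_, hnoise, ?_⟩
  · rwa [← hsrc.condCov_fst_fst_congr_law hV' hlaw, ← hsrc.condCov_fst_snd_congr_law hV' hlaw,
      ← hsrc.condCov_snd_snd_congr_law hV' hlaw]
  · exact (indepFun_prod (X := id) (Y := id) measurable_id measurable_id).symm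

theorem posSemidef_postCovS :
    (postCovS (condCov μ X X Y) (condCov μ S S Y) Sig H).PosSemidef := by
  obtain ⟨Ω', _, μ', _, X', S', Y', W', -, hQX, hQS, h⟩ := hsrc.exists_isTestChannel hf
  exact hQX ▸ hQS ▸ h.postCov_psd

theorem posSemidef_sub_postCovS :
    (condCov μ S S Y - postCovS (condCov μ X X Y) (condCov μ S S Y) Sig H).PosSemidef := by
  obtain ⟨Ω', _, μ', _, X', S', Y', W', -, hQX, hQS, h⟩ := hsrc.exists_isTestChannel hf
  exact hQX ▸ hQS ▸ h.sub_postCov_psd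

theorem halfLogDetRatio_postCovS :
    halfLogDetRatio (condCov μ S S Y) (postCovS (condCov μ X X Y) (condCov μ S S Y) Sig H)
      = halfLogDetRatio (condCov μ X X Y - Sig) QW := by
  obtain ⟨Ω', _, μ', _, X', S', Y', W', -, hQX, hQS, h⟩ := hsrc.exists_isTestChannel hf
  rw [← hQX, ← hQS, ← h.rate_source, h.rate_reproduction]

theorem rdf_le_halfLogDetRatio (hΔ : Sig.trace ≤ Δ) :
    rdf (μ.map fun ω => (X ω, S ω, Y ω)) Δ ≤ halfLogDetRatio (condCov μ X X Y - Sig) QW := by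
  obtain ⟨Ω', _, μ', _, X', S', Y', W', hlaw, hQX, -, h⟩ := hsrc.exists_isTestChannel hf
  rw [← hlaw, ← hQX, ← h.rate_reproduction]
  exact (h.isAdmissible hΔ).rdf_le h.source.measurable_fst h.source.measurable_snd
    h.source.measurable_trd

end Feasible

variable (Δ : ℝ≥0)

omit [IsProbabilityMeasure μ] in
variable {Δ} in
theorem exists_feasible_of_mem_admissibleLaws
    {ν : ProbabilityMeasure ((Vec nx × Vec ns × Vec ny) × Vec nx)}
    (hν : ν ∈ admissibleLaws (μ.map fun ω => (X ω, S ω, Y ω)) Δ) :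
    ∃ (Sig : Matrix (Fin nx) (Fin nx) ℝ) (H : Matrix (Fin nx) (Fin ns) ℝ)
      (QW : Matrix (Fin nx) (Fin nx) ℝ),
      IsFeasible (condCov μ X X Y) (condCov μ X S Y) (condCov μ S S Y) Sig H QW ∧
      Sig.trace ≤ Δ ∧
      halfLogDetRatio (condCov μ S S Y) (postCovS (condCov μ X X Y) (condCov μ S S Y) Sig H)
        ≤ condMutualInfo (ν : Measure ((Vec nx × Vec ns × Vec ny) × Vec nx))
          (fun q => q.1.2.1) (fun q => q.2) (fun q => q.1.2.2) := by
  have hV' : Measurable fun q : (Vec nx × Vec ns × Vec ny) × Vec nx =>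
    (q.1.1, q.1.2.1, q.1.2.2) := by fun_prop
  have hlaw : IdentDistrib (fun ω => (X ω, S ω, Y ω)) (fun q => (q.1.1, q.1.2.1, q.1.2.2)) μ
      (ν : Measure ((Vec nx × Vec ns × Vec ny) × Vec nx)) :=
    ⟨hsrc.joint.measurable.aemeasurable, hV'.aemeasurable, hν.1.symm⟩
  rw [hsrc.condCov_fst_fst_congr_law hV' hlaw, hsrc.condCov_fst_snd_congr_law hV' hlaw,
    hsrc.condCov_snd_snd_congr_law hV' hlaw]
  exact hν.2.exists_feasible (hsrc.congr_law hV' hlaw)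

theorem rdf_eq_iInf_source : rdf (μ.map fun ω => (X ω, S ω, Y ω)) Δ =
    ⨅ (Sig : Matrix (Fin nx) (Fin nx) ℝ) (H : Matrix (Fin nx) (Fin ns) ℝ)
      (QW : Matrix (Fin nx) (Fin nx) ℝ)
      (_ : IsFeasible (condCov μ X X Y) (condCov μ X S Y) (condCov μ S S Y) Sig H QW)
      (_ : Sig.trace ≤ Δ)
      (_ : (postCovS (condCov μ X X Y) (condCov μ S S Y) Sig H).PosSemidef ∧
        (condCov μ S S Y - postCovS (condCov μ X X Y) (condCov μ S S Y) Sig H).PosSemidef),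
      halfLogDetRatio (condCov μ S S Y)
        (postCovS (condCov μ X X Y) (condCov μ S S Y) Sig H) := by
  refine le_antisymm ?_ (le_iInf₂ fun ν hν => ?_)
  · simp only [le_iInf_iff]
    intro Sig H QW hf hΔ _
    exact (hsrc.rdf_le_halfLogDetRatio hf hΔ).trans_eq (hsrc.halfLogDetRatio_postCovS hf).symm
  · obtain ⟨Sig, H, QW, hf, hΔ, hle⟩ := hsrc.exists_feasible_of_mem_admissibleLaws hν
    exact iInf_le_of_le Sig <| iInf_le_of_le H <| iInf_le_of_le QW <| iInf_le_of_le hf <|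
      iInf_le_of_le hΔ <| iInf_le_of_le
        ⟨hsrc.posSemidef_postCovS hf, hsrc.posSemidef_sub_postCovS hf⟩ hle

theorem rdf_eq_iInf_reproduction : rdf (μ.map fun ω => (X ω, S ω, Y ω)) Δ =
    ⨅ (Sig : Matrix (Fin nx) (Fin nx) ℝ) (H : Matrix (Fin nx) (Fin ns) ℝ)
      (QW : Matrix (Fin nx) (Fin nx) ℝ)
      (_ : IsFeasible (condCov μ X X Y) (condCov μ X S Y) (condCov μ S S Y) Sig H QW)
      (_ : Sig.trace ≤ Δ) (_ : (condCov μ X X Y - Sig - QW).PosSemidef),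
      halfLogDetRatio (condCov μ X X Y - Sig) QW := by
  rw [hsrc.rdf_eq_iInf_source Δ]
  refine iInf_congr fun Sig => iInf_congr fun H => iInf_congr fun QW => iInf_congr fun hf =>
    iInf_congr fun hΔ => ?_
  rw [iInf_pos ⟨hsrc.posSemidef_postCovS hf, hsrc.posSemidef_sub_postCovS hf⟩,
    iInf_pos (hf.posSemidef_sub_sub hsrc.posSemidef_condCov_snd), hsrc.halfLogDetRatio_postCovS hf]

variable {Δ}

theorem exists_feasible_eq_rdf
    (hne : (admissibleLaws (μ.map fun ω => (X ω, S ω, Y ω)) Δ).Nonempty) :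
    ∃ (Sig : Matrix (Fin nx) (Fin nx) ℝ) (H : Matrix (Fin nx) (Fin ns) ℝ)
      (QW : Matrix (Fin nx) (Fin nx) ℝ),
      IsFeasible (condCov μ X X Y) (condCov μ X S Y) (condCov μ S S Y) Sig H QW ∧
      Sig.trace ≤ Δ ∧
      halfLogDetRatio (condCov μ X X Y - Sig) QW = rdf (μ.map fun ω => (X ω, S ω, Y ω)) Δ := by
  obtain ⟨ν, hν⟩ := hne
  obtain ⟨Sig₀, H₀, QW₀, hf₀, hΔ₀, -⟩ := hsrc.exists_feasible_of_mem_admissibleLaws hν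
  have hQXS : condCov μ X S Y * pinv (condCov μ S S Y) * condCov μ S S Y = condCov μ X S Y := by
    rw [hsrc.condCov_fst_snd, hsrc.condCov_snd_snd]
    exact covMat_mul_pinv_mul hsrc.memLp_resid_fst hsrc.memLp_resid_snd
  obtain ⟨Sig, H, QW, hf, hΔ, hmin⟩ := exists_feasible_minimizer hsrc.posSemidef_condCov_snd hQXS
    ⟨Sig₀, H₀, QW₀, hf₀, hΔ₀⟩
  refine ⟨Sig, H, QW, hf, hΔ, le_antisymm ?_ (hsrc.rdf_le_halfLogDetRatio hf hΔ)⟩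
  rw [hsrc.rdf_eq_iInf_reproduction]
  simp only [le_iInf_iff]
  exact fun Sig' H' QW' hf' hΔ' _ => hmin Sig' H' QW' hf' hΔ'

theorem exists_isTestChannel_attaining_rdf
    (hne : (admissibleLaws (μ.map fun ω => (X ω, S ω, Y ω)) Δ).Nonempty) :
    ∃ (Sig : Matrix (Fin nx) (Fin nx) ℝ) (H : Matrix (Fin nx) (Fin ns) ℝ)
      (QW : Matrix (Fin nx) (Fin nx) ℝ),
      IsFeasible (condCov μ X X Y) (condCov μ X S Y) (condCov μ S S Y) Sig H QW ∧
      Sig.trace ≤ Δ ∧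
      halfLogDetRatio (condCov μ S S Y) (postCovS (condCov μ X X Y) (condCov μ S S Y) Sig H)
        = rdf (μ.map fun ω => (X ω, S ω, Y ω)) Δ ∧
      halfLogDetRatio (condCov μ X X Y - Sig) QW = rdf (μ.map fun ω => (X ω, S ω, Y ω)) Δ ∧
      ∃ (Ω' : Type) (_ : MeasurableSpace Ω') (μ' : Measure Ω') (_ : IsProbabilityMeasure μ')
        (X' : Ω' → Vec nx) (S' : Ω' → Vec ns) (Y' : Ω' → Vec ny) (W' : Ω' → Vec nx),
        Measurable X' ∧ Measurable S' ∧ Measurable Y' ∧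
        (μ'.map fun ω => (X' ω, S' ω, Y' ω)) = (μ.map fun ω => (X ω, S ω, Y ω)) ∧
        IsCenteredGaussian μ' W' QW ∧ IndepFun W' (fun ω => (X' ω, S' ω, Y' ω)) μ' ∧
        IsAdmissible μ' X' S' Y' (realization μ' X' S' Y' H W') Δ ∧
        condMutualInfo μ' S' (realization μ' X' S' Y' H W') Y'
          = rdf (μ.map fun ω => (X ω, S ω, Y ω)) Δ := by
  obtain ⟨Sig, H, QW, hf, hΔ, hrate⟩ := hsrc.exists_feasible_eq_rdf hne
  obtain ⟨Ω', mΩ', μ', hμ', X', S', Y', W', hlaw, hQX, -, h⟩ := hsrc.exists_isTestChannel hf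
  exact ⟨Sig, H, QW, hf, hΔ, (hsrc.halfLogDetRatio_postCovS hf).trans hrate, hrate,
    Ω', mΩ', μ', hμ', X', S', Y', W', h.source.measurable_fst, h.source.measurable_snd,
    h.source.measurable_trd, hlaw, h.noise, h.indep, h.isAdmissible hΔ,
    h.rate_reproduction.trans (hQX ▸ hrate)⟩

end IsGaussianSource

end Existence

end RemoteRDF

end

open RemoteRDF

theorem theorem4 {nx ns ny : ℕ} {Ω : Type*} [MeasurableSpace Ω]
    (μ : Measure Ω) [IsProbabilityMeasure μ]
    (X : Ω → Vec nx) (S : Ω → Vec ns) (Y : Ω → Vec ny)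
    (hX : Measurable X) (hS : Measurable S) (hY : Measurable Y)
    -- `(X, S, Y)` is a centered jointly Gaussian triple with invertible `Q_Y`
    (hG : HasGaussianLaw (fun ω => (X ω, S ω, Y ω)) μ)
    (hX0 : ∫ ω, X ω ∂μ = 0) (hS0 : ∫ ω, S ω ∂μ = 0) (hY0 : ∫ ω, Y ω ∂μ = 0)
    (hQY : IsUnit (covMat μ Y Y))
    -- the matrices `Q_{X|Y}`, `Q_{X,S|Y}`, `Q_{S|Y}`
    (QX : Matrix (Fin nx) (Fin nx) ℝ) (hQX : QX = condCov μ X X Y)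
    (QXS : Matrix (Fin nx) (Fin ns) ℝ) (hQXS : QXS = condCov μ X S Y)
    (QS : Matrix (Fin ns) (Fin ns) ℝ) (hQS : QS = condCov μ S S Y)
    (Δ : ℝ≥0) :
    (QX.PosSemidef ∧ QS.PosSemidef ∧
      QXS = covMat μ X S - covMat μ X Y * (covMat μ Y Y)⁻¹ * covMat μ Y S) ∧
    -- (a) the realization determined by `(Σ, H, Q_W)` and its structural properties
    (∀ (Sig : Matrix (Fin nx) (Fin nx) ℝ) (H : Matrix (Fin nx) (Fin ns) ℝ)
        (QW : Matrix (Fin nx) (Fin nx) ℝ), IsFeasible QX QXS QS Sig H QW →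
      ∀ W : Ω → Vec nx, IsCenteredGaussian μ W QW →
        IndepFun W (fun ω => (X ω, S ω, Y ω)) μ →
      ∀ Xhat : Ω → Vec nx, Xhat = realization μ X S Y H W →
        (Xhat =ᵐ[μ] fun ω => Matrix.toEuclideanLin H (S ω) + cexp μ X Y ω
          - Matrix.toEuclideanLin H (cexp μ S Y ω) + W ω) ∧
        covMat μ (fun ω => X ω - Xhat ω) (fun ω => X ω - Xhat ω) = Sig ∧
        -- (i)
        CondLawDrops μ X Xhat Y ∧
        -- (ii)
        CondLawDrops μ Xhat (fun ω => (S ω, Y ω)) X ∧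
        CondLawDrops μ X (fun ω => (S ω, Y ω)) Xhat ∧
        -- (iii)
        cexp μ X (fun ω => (Xhat ω, Y ω)) =ᵐ[μ] Xhat ∧
        cexp μ X Xhat =ᵐ[μ] Xhat ∧
        cexp μ X Y =ᵐ[μ] cexp μ Xhat Y ∧
        -- the conditional covariances
        condCov μ S S (fun ω => (Xhat ω, Y ω)) = postCovS QX QS Sig H ∧
        condCov μ Xhat Xhat Y = H * QS * Hᵀ + QW ∧
        condCov μ Xhat Xhat Y = QX - Sig ∧
        -- admissibility and rate
        (Sig.trace ≤ Δ → IsAdmissible μ X S Y Xhat Δ) ∧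
        condMutualInfo μ S Xhat Y = halfLogDetRatio QS (postCovS QX QS Sig H) ∧
        condMutualInfo μ S Xhat Y = halfLogDetRatio (QX - Sig) QW) ∧
    -- (b) the two characterizations of the RDF
    rdf (μ.map fun ω => (X ω, S ω, Y ω)) Δ =
      (⨅ (Sig : Matrix (Fin nx) (Fin nx) ℝ) (H : Matrix (Fin nx) (Fin ns) ℝ)
        (QW : Matrix (Fin nx) (Fin nx) ℝ) (_ : IsFeasible QX QXS QS Sig H QW)
        (_ : Sig.trace ≤ Δ)
        (_ : (postCovS QX QS Sig H).PosSemidef ∧ (QS - postCovS QX QS Sig H).PosSemidef),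
        halfLogDetRatio QS (postCovS QX QS Sig H)) ∧
    rdf (μ.map fun ω => (X ω, S ω, Y ω)) Δ =
      (⨅ (Sig : Matrix (Fin nx) (Fin nx) ℝ) (H : Matrix (Fin nx) (Fin ns) ℝ)
        (QW : Matrix (Fin nx) (Fin nx) ℝ) (_ : IsFeasible QX QXS QS Sig H QW)
        (_ : Sig.trace ≤ Δ) (_ : (QX - Sig - QW).PosSemidef),
        halfLogDetRatio (QX - Sig) QW) ∧
    -- no admissible reproduction on `Ω` has a rate below the RDF
    (∀ Xhat : Ω → Vec nx, IsAdmissible μ X S Y Xhat Δ →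
      rdf (μ.map fun ω => (X ω, S ω, Y ω)) Δ ≤ condMutualInfo μ S Xhat Y) ∧
    -- the RDF is achieved by a realization as in (a), as soon as some reproduction is admissible
    ((admissibleLaws (μ.map fun ω => (X ω, S ω, Y ω)) Δ).Nonempty →
      ∃ (Sig : Matrix (Fin nx) (Fin nx) ℝ) (H : Matrix (Fin nx) (Fin ns) ℝ)
        (QW : Matrix (Fin nx) (Fin nx) ℝ),
        IsFeasible QX QXS QS Sig H QW ∧ Sig.trace ≤ Δ ∧
        halfLogDetRatio QS (postCovS QX QS Sig H) =
          rdf (μ.map fun ω => (X ω, S ω, Y ω)) Δ ∧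
        halfLogDetRatio (QX - Sig) QW = rdf (μ.map fun ω => (X ω, S ω, Y ω)) Δ ∧
        ∃ (Ω' : Type) (_ : MeasurableSpace Ω') (μ' : Measure Ω') (_ : IsProbabilityMeasure μ')
          (X' : Ω' → Vec nx) (S' : Ω' → Vec ns) (Y' : Ω' → Vec ny) (W' : Ω' → Vec nx),
          Measurable X' ∧ Measurable S' ∧ Measurable Y' ∧
          (μ'.map fun ω => (X' ω, S' ω, Y' ω)) = (μ.map fun ω => (X ω, S ω, Y ω)) ∧
          IsCenteredGaussian μ' W' QW ∧
          IndepFun W' (fun ω => (X' ω, S' ω, Y' ω)) μ' ∧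
          IsAdmissible μ' X' S' Y' (realization μ' X' S' Y' H W') Δ ∧
          condMutualInfo μ' S' (realization μ' X' S' Y' H W') Y' =
            rdf (μ.map fun ω => (X ω, S ω, Y ω)) Δ) := by
  subst hQX hQXS hQS
  have hsrc : IsGaussianSource μ X S Y :=
    ⟨⟨hX.prodMk (hS.prodMk hY), hG, by
      rw [integral_pair hG.fst.integrable hG.snd.integrable,
        integral_pair hG.snd.fst.integrable hG.snd.snd.integrable, hX0, hS0, hY0]
      rfl⟩, hQY⟩
  refine ⟨⟨hsrc.posSemidef_condCov_fst, hsrc.posSemidef_condCov_snd, hsrc.condCov_fst_snd_eq_sub⟩,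
    ?_, hsrc.rdf_eq_iInf_source Δ, hsrc.rdf_eq_iInf_reproduction Δ,
    fun Xhat hXhat => hXhat.rdf_le hX hS hY, hsrc.exists_isTestChannel_attaining_rdf⟩
  rintro Sig H QW hf W hW hind Xhat rfl
  have h : IsTestChannel μ X S Y Sig H QW W := ⟨hsrc, hf, hW, hind⟩
  exact ⟨h.eq_cexp, h.error_cov, h.drops_side, h.drops_source, h.drops_reproduction, h.cexp_pair,
    h.cexp_self, h.cexp_side, h.postCov, h.reproduction_cov, h.reproduction_cov_eq_sub,
    h.isAdmissible, h.rate_source, h.rate_reproduction⟩
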